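/- **Theorem.** An instance of the parity-constrained $k$-center problem consists of a finite node set $V$, a metric $c$ on $V$ (distinct nodes may have distance $0$), an integer $k\ge 0$, and labels $\pi:V\to\{\mathsf{odd},\mathsf{even},\mathsf{unconstrained}\}$. A feasible solution is a set $S\subseteq V$ with $|S|\le k$ together with an assignment $\sigma:V\to S$ such that, for every $u\in S$, $|\sigma^{-1}(u)|$ is odd if $\pi(u)=\mathsf{odd}$ and even if $\pi(u)=\mathsf{even}$; its value is $\max_{v\in V}c(\sigma(v),v)$, which is to be minimized. There is a deterministic $6$-approximation algorithm for this problem with worst-case running time $O(|V|^2\log|V|)$, in particular polynomial: on every instance it halts within $O(|V|^2\log|V|)$ steps and either outputs a feasible solution $(S,\sigma)$ whose value is at most $6$ times the value of every feasible solution, or reports, correctly, that the instance has no feasible solution. Here steps are those of a uniform-cost random access machine over the natural numbers with addition, truncated subtraction and halving, which accesses the distance matrix only by comparing two entries in one step. -/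

import Mathlib

/-! ## The parity-constrained k-center problem -/

namespace ParityKCenter

/-- The parity label of a node. -/
inductive Label where
  | even
  | odd
  | unconstrained

/-- An instance with node set `Fin n`: a metric `c`, a budget `k` and parity labels `π`.
Distinct nodes may be at distance zero, so every metric is covered. Nonnegativity of `c` follows
from the three axioms. -/
structure Instance (n : ℕ) where
  c : Fin n → Fin n → ℝ
  c_self : ∀ u, c u u = 0
  c_symm : ∀ u v, c u v = c v u
  c_triangle : ∀ u v w, c u w ≤ c u v + c v w
  k : ℕ
  π : Fin n → Label

/-- `S` together with `σ : V → S` is a feasible solution: at most `k` centers, every node is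
assigned to a center, and the number of nodes assigned to each center obeys its label. -/
structure Instance.IsSolution {n : ℕ} (I : Instance n) (S : Finset (Fin n))
    (σ : Fin n → Fin n) : Prop where
  card_le : S.card ≤ I.k
  mem : ∀ v, σ v ∈ S
  odd : ∀ u ∈ S, I.π u = Label.odd → Odd (Finset.univ.filter fun v => σ v = u).card
  even : ∀ u ∈ S, I.π u = Label.even → Even (Finset.univ.filter fun v => σ v = u).card

/-- The objective value `max_v c(σ(v), v)` (and `0` if there are no nodes). -/
noncomputable def Instance.cost {n : ℕ} (I : Instance n) (σ : Fin n → Fin n) : ℝ :=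
  ⨆ v, I.c (σ v) v

/-- `(S, σ)` is feasible and its value is at most `ρ` times the value of every feasible
solution, that is, at most `ρ` times the optimum. -/
def Instance.IsApproxSolution {n : ℕ} (I : Instance n) (ρ : ℝ) (S : Finset (Fin n))
    (σ : Fin n → Fin n) : Prop :=
  I.IsSolution S σ ∧ ∀ S' σ', I.IsSolution S' σ' → I.cost σ ≤ ρ * I.cost σ'

/-! ## The machine model

A uniform-cost random access machine, programmed in a structured language. The memory consists of
scalar registers and of arrays, all holding natural numbers. The arithmetic operations are addition,
truncated subtraction and halving (there is no multiplication). The distance matrix is a read-only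
input, on which the only available operation is to compare two of its entries. A program is a fixed
finite piece of syntax, independent of the instance, and every operation performed is charged. -/

/-- Arithmetic expressions. Registers and arrays are named by numerals in the program text. -/
inductive Exp where
  | const (a : ℕ)
  | var (x : ℕ)
  | read (A : ℕ) (i : Exp)
  | add (e f : Exp)
  | sub (e f : Exp)
  | half (e : Exp)

/-- Tests. `distLe e f g h` is the comparison `c(e, f) ≤ c(g, h)` of two input distances. -/
inductive Test where
  | le (e f : Exp)
  | distLe (e f g h : Exp)
  | not (b : Test)
  | and (b b' : Test)

/-- Programs. -/
inductive Cmd where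
  | skip
  | assign (x : ℕ) (e : Exp)
  | write (A : ℕ) (i e : Exp)
  | seq (p q : Cmd)
  | ite (b : Test) (p q : Cmd)
  | while (b : Test) (p : Cmd)

/-- The contents of the memory: `var x` is register `x`, `arr A i` is cell `i` of array `A`. -/
@[ext]
structure Store where
  var : ℕ → ℕ
  arr : ℕ → ℕ → ℕ

/-- The value of an expression. -/
def Exp.eval (s : Store) : Exp → ℕ
  | const a => a
  | var x => s.var x
  | read A i => s.arr A (i.eval s)
  | add e f => e.eval s + f.eval s
  | sub e f => e.eval s - f.eval s
  | half e => e.eval s / 2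

/-- The number of operations performed when an expression is evaluated. -/
def Exp.time : Exp → ℕ
  | const _ => 1
  | var _ => 1
  | read _ i => i.time + 1
  | add e f => e.time + f.time + 1
  | sub e f => e.time + f.time + 1
  | half e => e.time + 1

/-- The truth of a test, for the distance matrix `d`. -/
def Test.Holds (d : ℕ → ℕ → ℝ) (s : Store) : Test → Prop
  | le e f => e.eval s ≤ f.eval s
  | distLe e f g h => d (e.eval s) (f.eval s) ≤ d (g.eval s) (h.eval s)
  | not b => ¬ b.Holds d s
  | and b b' => b.Holds d s ∧ b'.Holds d s

/-- The number of operations performed when a test is evaluated. -/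
def Test.time : Test → ℕ
  | le e f => e.time + f.time + 1
  | distLe e f g h => e.time + f.time + g.time + h.time + 1
  | not b => b.time + 1
  | and b b' => b.time + b'.time + 1

/-- The store after register `x` is set to `a`. -/
def Store.setVar (s : Store) (x a : ℕ) : Store :=
  { s with var := Function.update s.var x a }

/-- The store after cell `i` of array `A` is set to `a`. -/
def Store.setArr (s : Store) (A i a : ℕ) : Store :=
  { s with arr := Function.update s.arr A (Function.update (s.arr A) i a) }

/-- `Exec d p s s' t`: on the distance matrix `d`, the program `p` started in the store `s` halts in
the store `s'` after exactly `t` steps. -/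
inductive Exec (d : ℕ → ℕ → ℝ) : Cmd → Store → Store → ℕ → Prop
  | skip (s : Store) : Exec d Cmd.skip s s 1
  | assign (s : Store) (x : ℕ) (e : Exp) :
      Exec d (Cmd.assign x e) s (s.setVar x (e.eval s)) (e.time + 1)
  | write (s : Store) (A : ℕ) (i e : Exp) :
      Exec d (Cmd.write A i e) s (s.setArr A (i.eval s) (e.eval s)) (i.time + e.time + 1)
  | seq {p q : Cmd} {s s' s'' : Store} {t t' : ℕ} :
      Exec d p s s' t → Exec d q s' s'' t' → Exec d (Cmd.seq p q) s s'' (t + t')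
  | ite_true {b : Test} {p q : Cmd} {s s' : Store} {t : ℕ} :
      b.Holds d s → Exec d p s s' t → Exec d (Cmd.ite b p q) s s' (b.time + 1 + t)
  | ite_false {b : Test} {p q : Cmd} {s s' : Store} {t : ℕ} :
      ¬ b.Holds d s → Exec d q s s' t → Exec d (Cmd.ite b p q) s s' (b.time + 1 + t)
  | while_true {b : Test} {p : Cmd} {s s' s'' : Store} {t t' : ℕ} :
      b.Holds d s → Exec d p s s' t → Exec d (Cmd.while b p) s' s'' t' →
        Exec d (Cmd.while b p) s s'' (b.time + 1 + t + t')
  | while_false {b : Test} {p : Cmd} {s : Store} :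
      ¬ b.Holds d s → Exec d (Cmd.while b p) s s (b.time + 1)

/-! ## Input, output and approximation algorithms -/

/-- Labels as numbers. -/
def Label.code : Label → ℕ
  | even => 0
  | odd => 1
  | unconstrained => 2

/-- The distance matrix that the machine sees (entries outside the matrix are `0`). -/
noncomputable def Instance.matrix {n : ℕ} (I : Instance n) (i j : ℕ) : ℝ :=
  if h : i < n ∧ j < n then I.c ⟨i, h.1⟩ ⟨j, h.2⟩ else 0

/-- The initial store: register `0` holds `n`, register `1` holds `k`, array `0` holds the labels,
and all else is `0`. -/
def Instance.input {n : ℕ} (I : Instance n) : Store where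
  var x := if x = 0 then n else if x = 1 then I.k else 0
  arr A i := if h : A = 0 ∧ i < n then (I.π ⟨i, h.2⟩).code else 0

/-- The final store `s` encodes the solution `(S, σ)`: array `0` holds the indicator function of `S`
and array `1` holds `σ`. -/
def Store.Encodes {n : ℕ} (s : Store) (S : Finset (Fin n)) (σ : Fin n → Fin n) : Prop :=
  ∀ v : Fin n, s.arr 0 v = (if v ∈ S then 1 else 0) ∧ s.arr 1 v = (σ v : ℕ)

/-- The final store `s` is a correct answer on `I`: either register `0` is `1` and the arrays hold
a `ρ`-approximate solution, or register `0` is `0` and `I` has no feasible solution. -/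
def Instance.IsCorrectAnswer {n : ℕ} (I : Instance n) (ρ : ℝ) (s : Store) : Prop :=
  (s.var 0 = 1 ∧ ∃ S σ, s.Encodes S σ ∧ I.IsApproxSolution ρ S σ) ∨
    (s.var 0 = 0 ∧ ¬ ∃ S σ, I.IsSolution S σ)

/-- `p` is a `ρ`-approximation algorithm for the parity-constrained k-center problem whose running
time on all instances with `n` nodes is at most `T n`. -/
def IsApproxAlgorithm (ρ : ℝ) (T : ℕ → ℕ) (p : Cmd) : Prop :=
  ∀ (n : ℕ) (I : Instance n), ∃ (s : Store) (t : ℕ),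
    Exec I.matrix p I.input s t ∧ t ≤ T n ∧ I.IsCorrectAnswer ρ s

end ParityKCenter

namespace ParityKCenter

/-! ### Verification of programs -/

/-! Fix a threshold r, and join two nodes when their distance is at most r. Let M be a set of nodes
no two of which have a common neighbour (a node being its own neighbour), while every node is within
2r of M. In a solution of value at most r, the nodes of M go to distinct centers, and these stay in
the same connected component; so each component K contains at least |M ∩ K| centers.

Conversely, open one cluster at each m in M, with the parity demanded by the label of m (even if m
is unconstrained). These parities can be realised in K as soon as their sum has the parity of |K|:
send every node to its nearest cluster and correct the parities along a spanning tree of K, from the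
leaves to the root, by moving a node to the cluster of its parent where necessary. If the sum is
wrong, one flip in K suffices. It is free if some m in M ∩ K has a neighbour whose label is not the
default parity of m: that neighbour becomes the center. Otherwise it costs one more cluster, opened
with odd parity at a node of K outside M whose label is not even. `Sol.card_lt` shows that, when no
free flip exists, every solution of value at most r has more than |M ∩ K| centers in K, and a paid
flip exists. Hence the number of clusters is at most that of any solution. A node is moved by at
most r, the nearest cluster is 2r further on, and its center another r: the value is at most 4r, so
the factor 6 holds with room to spare.

For quadratic time, two greedy orders serve all thresholds at once. The farthest-first order
(`farCmd_ok`) yields for every node the least threshold at which it drops out of M. The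
nearest-first order of Prim (`nearCmd_ok`) makes the components at any threshold intervals; a node
other than the first starts an interval when its parent is further away than the threshold. With the
distances to the nearest node of another label this gives 3n candidate thresholds, and r matters
only through its comparisons with them (`Agree`). Each candidate is tested by one backward pass in
linear time (`scanCmd_ok`). The largest candidate not exceeding the value of a solution compares
with all candidates as that value does, so it is accepted; hence the least accepted candidate is at
most the optimum (`found_le`). The total is O(n²), so the logarithm is slack.

The program is verified by triples `Ok` with a step bound; `Frame` carries everything that a piece
of code does not assign. -/

/-- Started in `s`, the program `p` halts within `B` steps in a store that satisfies `Q`. -/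
def Ok (d : ℕ → ℕ → ℝ) (p : Cmd) (s : Store) (B : ℕ) (Q : Store → Prop) : Prop :=
  ∃ s' t, Exec d p s s' t ∧ t ≤ B ∧ Q s'

/-- The weakest precondition of a program without loops. -/
def Cmd.wp (d : ℕ → ℕ → ℝ) : Cmd → (Store → Prop) → Store → Prop
  | skip, Q, s => Q s
  | assign x e, Q, s => Q (s.setVar x (e.eval s))
  | write A i e, Q, s => Q (s.setArr A (i.eval s) (e.eval s))
  | seq p q, Q, s => p.wp d (fun s' => q.wp d Q s') s
  | ite b p q, Q, s => (b.Holds d s → p.wp d Q s) ∧ (¬ b.Holds d s → q.wp d Q s)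
  | .while _ _, _, _ => False

/-- A bound for the running time of a program without loops. -/
def Cmd.bound : Cmd → ℕ
  | skip => 1
  | assign _ e => e.time + 1
  | write _ i e => i.time + e.time + 1
  | seq p q => p.bound + q.bound
  | ite b p q => b.time + 1 + max p.bound q.bound
  | .while _ _ => 0

/-- The program contains no assignment to register `x`. -/
def Cmd.keepsVar (x : ℕ) : Cmd → Bool
  | skip => true
  | assign y _ => x != y
  | write _ _ _ => true
  | seq p q => p.keepsVar x && q.keepsVar x
  | ite _ p q => p.keepsVar x && q.keepsVar x
  | .while _ p => p.keepsVar x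

/-- The program contains no assignment to a cell of array `A`. -/
def Cmd.keepsArr (A : ℕ) : Cmd → Bool
  | skip => true
  | assign _ _ => true
  | write C _ _ => A != C
  | seq p q => p.keepsArr A && q.keepsArr A
  | ite _ p q => p.keepsArr A && q.keepsArr A
  | .while _ p => p.keepsArr A

/-- The stores `s` and `s'` agree outside the registers and arrays that `p` assigns to. -/
structure Frame (p : Cmd) (s s' : Store) : Prop where
  var' : ∀ x, p.keepsVar x = true → s'.var x = s.var x
  arr' : ∀ A, p.keepsArr A = true → s'.arr A = s.arr A

theorem Frame.var {p : Cmd} {s s' : Store} (h : Frame p s s') (x : ℕ)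
    (hx : p.keepsVar x = true := by rfl) : s'.var x = s.var x := h.var' x hx

theorem Frame.arr {p : Cmd} {s s' : Store} (h : Frame p s s') (A : ℕ)
    (hA : p.keepsArr A = true := by rfl) : s'.arr A = s.arr A := h.arr' A hA

theorem Frame.rfl {p : Cmd} {s : Store} : Frame p s s := ⟨fun _ _ => Eq.refl _, fun _ _ => Eq.refl _⟩

theorem Frame.trans {p : Cmd} {s s' s'' : Store} (h : Frame p s s') (h' : Frame p s' s'') :
    Frame p s s'' :=
  ⟨fun x hx => (h'.var' x hx).trans (h.var' x hx), fun A hA => (h'.arr' A hA).trans (h.arr' A hA)⟩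

theorem Frame.mono {p q : Cmd} {s s' : Store} (h : Frame p s s')
    (hv : ∀ x, q.keepsVar x = true → p.keepsVar x = true)
    (ha : ∀ A, q.keepsArr A = true → p.keepsArr A = true) : Frame q s s' :=
  ⟨fun x hx => h.var' x (hv x hx), fun A hA => h.arr' A (ha A hA)⟩

@[simp] theorem Store.setVar_var (s : Store) (x a y : ℕ) :
    (s.setVar x a).var y = if y = x then a else s.var y := by
  simp [Store.setVar, Function.update_apply]

@[simp] theorem Store.setVar_arr (s : Store) (x a A : ℕ) : (s.setVar x a).arr A = s.arr A := rfl

@[simp] theorem Store.setArr_var (s : Store) (A i a y : ℕ) : (s.setArr A i a).var y = s.var y := rfl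

theorem Store.setArr_arr (s : Store) (A i a C : ℕ) :
    (s.setArr A i a).arr C = if C = A then Function.update (s.arr A) i a else s.arr C := by
  simp [Store.setArr, Function.update_apply]

theorem Store.setArr_arr_ne (s : Store) (A i a C : ℕ) (h : C ≠ A) :
    (s.setArr A i a).arr C = s.arr C := by
  rw [Store.setArr_arr, if_neg h]

@[simp] theorem Store.setArr_arr_apply (s : Store) (A i a C j : ℕ) :
    (s.setArr A i a).arr C j = if C = A ∧ j = i then a else s.arr C j := by
  by_cases h : C = A
  · subst h; simp [Store.setArr_arr, Function.update_apply]
  · simp [Store.setArr_arr, h]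

theorem Exec.frame {d : ℕ → ℕ → ℝ} {p : Cmd} {s s' : Store} {t : ℕ} (h : Exec d p s s' t) :
    Frame p s s' := by
  induction h with
  | skip s => exact Frame.rfl
  | assign s x e =>
    refine ⟨fun y hy => ?_, fun A _ => rfl⟩
    have : y ≠ x := by simpa [Cmd.keepsVar] using hy
    simp [this]
  | write s A i e =>
    refine ⟨fun y _ => rfl, fun C hC => ?_⟩
    have : C ≠ A := by simpa [Cmd.keepsArr] using hC
    exact Store.setArr_arr_ne _ _ _ _ _ this
  | seq _ _ ih ih' =>
    refine Frame.trans (ih.mono ?_ ?_) (ih'.mono ?_ ?_) <;>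
      simp +contextual [Cmd.keepsVar, Cmd.keepsArr]
  | ite_true _ _ ih => refine ih.mono ?_ ?_ <;> simp +contextual [Cmd.keepsVar, Cmd.keepsArr]
  | ite_false _ _ ih => refine ih.mono ?_ ?_ <;> simp +contextual [Cmd.keepsVar, Cmd.keepsArr]
  | while_true _ _ _ ih ih' =>
    refine Frame.trans (ih.mono ?_ ?_) ih' <;> simp +contextual [Cmd.keepsVar, Cmd.keepsArr]
  | while_false _ => exact Frame.rfl

/-! ### Proof rules for the time-bounded triples. -/

section rules

variable {d : ℕ → ℕ → ℝ} {p q : Cmd} {s : Store} {B B' : ℕ} {Q Q' : Store → Prop}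

/-- The frame is handed over together with the postcondition, so specifications need to mention only
what changes. `Ok.seq` does the same. -/
theorem Ok.mono (h : Ok d p s B Q) (hB : B ≤ B') (hQ : ∀ s', Frame p s s' → Q s' → Q' s') :
    Ok d p s B' Q' :=
  let ⟨s', t, he, ht, hq⟩ := h
  ⟨s', t, he, ht.trans hB, hQ s' he.frame hq⟩

theorem Ok.seq (h : Ok d p s B Q) (h' : ∀ s', Frame p s s' → Q s' → Ok d q s' B' Q') :
    Ok d (Cmd.seq p q) s (B + B') Q' :=
  let ⟨s', t, he, ht, hq⟩ := h
  let ⟨s'', t', he', ht', hq'⟩ := h' s' he.frame hq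
  ⟨s'', t + t', he.seq he', Nat.add_le_add ht ht', hq'⟩

theorem Ok.ite {b : Test} (h : b.Holds d s → Ok d p s B Q) (h' : ¬ b.Holds d s → Ok d q s B Q) :
    Ok d (Cmd.ite b p q) s (b.time + 1 + B) Q := by
  by_cases hb : b.Holds d s
  · obtain ⟨s', t, he, ht, hq⟩ := h hb
    exact ⟨s', _, Exec.ite_true hb he, by omega, hq⟩
  · obtain ⟨s', t, he, ht, hq⟩ := h' hb
    exact ⟨s', _, Exec.ite_false hb he, by omega, hq⟩

theorem Ok.of_wp (h : p.wp d Q s) : Ok d p s p.bound Q := by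
  induction p generalizing s Q with
  | skip => exact ⟨s, 1, Exec.skip s, le_rfl, h⟩
  | assign x e => exact ⟨_, _, Exec.assign s x e, le_rfl, h⟩
  | write A i e => exact ⟨_, _, Exec.write s A i e, le_rfl, h⟩
  | seq p q ihp ihq => exact (ihp h).seq fun s' _ h' => ihq h'
  | ite b p q ihp ihq =>
    exact Ok.ite (fun hb => (ihp (h.1 hb)).mono (le_max_left _ _) fun _ _ h => h)
      (fun hb => (ihq (h.2 hb)).mono (le_max_right _ _) fun _ _ h => h)
  | _ => exact h.elim

/-- Run `body` for `x` from its present value up to `n - 1`, where `n` is in register `0`. -/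
def Cmd.up (x : ℕ) (body : Cmd) : Cmd :=
  .while (.le (.add (.var x) (.const 1)) (.var 0))
    (.seq body (.assign x (.add (.var x) (.const 1))))

/-- Run `body` for `x` from its present value minus `1` down to `0`. -/
def Cmd.down (x : ℕ) (body : Cmd) : Cmd :=
  .while (.le (.const 1) (.var x)) (.seq (.assign x (.sub (.var x) (.const 1))) body)

/-- A round costs 6 for the test and the branch, 4 for the increment, and T for the body; the last 6
pays for the failing test. The invariant is required after the increment, hence the `setVar` in the
obligation. -/
theorem Ok.up {x n a T : ℕ} {body : Cmd} (I : ℕ → Store → Prop)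
    (h0 : (Cmd.up x body).keepsVar 0 = true) (hx : body.keepsVar x = true)
    (hn : s.var 0 = n) (ha : s.var x = a) (han : a ≤ n) (hI : I a s)
    (hstep : ∀ i s', a ≤ i → i < n → Frame (Cmd.up x body) s s' → s'.var x = i → I i s' →
      Ok d body s' T (fun s'' => I (i + 1) (s''.setVar x (i + 1)))) :
    Ok d (Cmd.up x body) s (n * (T + 10) + 6) (I n) := by
  suffices H : ∀ j i s', i + j = n → a ≤ i → Frame (Cmd.up x body) s s' → s'.var x = i → I i s' →
      Ok d (Cmd.up x body) s' (j * (T + 10) + 6) (I n) by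
    refine (H (n - a) a s (by omega) le_rfl Frame.rfl ha hI).mono ?_ fun _ _ h => h
    have := Nat.mul_le_mul_right (T + 10) (Nat.sub_le n a)
    omega
  intro j
  induction j with
  | zero =>
    intro i s' hi hai hF hxi hIi
    have : i = n := by omega
    subst this
    refine ⟨s', _, Exec.while_false ?_, ?_, hIi⟩
    · simp [Test.Holds, Exp.eval, hxi, hF.var' 0 h0, hn]
    · simp [Test.time, Exp.time]
  | succ j ih =>
    intro i s' hi hai hF hxi hIi
    obtain ⟨s'', t, he, ht, hq⟩ := hstep i s' hai (by omega) hF hxi hIi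
    have h2 : (Exp.add (.var x) (.const 1)).eval s'' = i + 1 := by
      simp [Exp.eval, he.frame.var' x hx, hxi]
    have he' := he.seq (Exec.assign s'' x (.add (.var x) (.const 1)))
    rw [h2] at he'
    have hF' : Frame (Cmd.up x body) s' (s''.setVar x (i + 1)) :=
      he'.frame.mono (fun _ h => h) (fun _ h => h)
    obtain ⟨s3, t3, he3, ht3, hq3⟩ := ih (i + 1) (s''.setVar x (i + 1)) (by omega) (by omega)
      (hF.trans hF') (by simp) hq
    refine ⟨s3, _, Exec.while_true ?_ he' he3, ?_, hq3⟩
    · simp [Test.Holds, Exp.eval, hxi, hF.var' 0 h0, hn]; omega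
    · simp only [Test.time, Exp.time]
      rw [Nat.succ_mul]; omega

/-- Here the register is decremented before the body runs, so the body starts in `s'.setVar x i`. A
round costs 4 for the test, 4 for the decrement, and T. -/
theorem Ok.down {x n T : ℕ} {body : Cmd} (I : ℕ → Store → Prop)
    (hx : body.keepsVar x = true) (hn : s.var x = n) (hI : I n s)
    (hstep : ∀ i s', i < n → Frame (Cmd.down x body) s s' → s'.var x = i + 1 → I (i + 1) s' →
      Ok d body (s'.setVar x i) T (I i)) :
    Ok d (Cmd.down x body) s (n * (T + 8) + 4) (I 0) := by
  suffices H : ∀ i s', i ≤ n → Frame (Cmd.down x body) s s' → s'.var x = i → I i s' →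
      Ok d (Cmd.down x body) s' (i * (T + 8) + 4) (I 0) from H n s le_rfl Frame.rfl hn hI
  intro i
  induction i with
  | zero =>
    intro s' _ hF hxi hIi
    refine ⟨s', _, Exec.while_false ?_, ?_, hIi⟩
    · simp [Test.Holds, Exp.eval, hxi]
    · simp [Test.time, Exp.time]
  | succ i ih =>
    intro s' hi hF hxi hIi
    obtain ⟨s'', t, he, ht, hq⟩ := hstep i s' (by omega) hF hxi hIi
    have h2 : (Exp.sub (.var x) (.const 1)).eval s' = i := by simp [Exp.eval, hxi]
    have he' : Exec d (.seq (.assign x (.sub (.var x) (.const 1))) body) s' s''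
        ((Exp.sub (.var x) (.const 1)).time + 1 + t) := by
      refine Exec.seq (Exec.assign _ _ _) ?_
      rw [h2]; exact he
    have hF' : Frame (Cmd.down x body) s' s'' := he'.frame.mono (fun _ h => h) (fun _ h => h)
    have hx' : s''.var x = i := by rw [he.frame.var' x hx]; simp
    obtain ⟨s3, t3, he3, ht3, hq3⟩ := ih s'' (by omega) (hF.trans hF') hx' hq
    refine ⟨s3, _, Exec.while_true ?_ he' he3, ?_, hq3⟩
    · simp [Test.Holds, Exp.eval, hxi]
    · simp only [Test.time, Exp.time]
      rw [Nat.succ_mul]; omega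

end rules

/-! ### Lower bounds for the number of centers -/

/-- `d` is a metric on the numbers below `n`. -/
structure IsMetric (n : ℕ) (d : ℕ → ℕ → ℝ) : Prop where
  self : ∀ u, d u u = 0
  symm : ∀ u v, d u v = d v u
  tri : ∀ u v w, u < n → v < n → w < n → d u w ≤ d u v + d v w

theorem IsMetric.nonneg {n : ℕ} {d : ℕ → ℕ → ℝ} (h : IsMetric n d) {u v : ℕ} (hu : u < n)
    (hv : v < n) : 0 ≤ d u v := by
  have := h.tri u v u hu hv hu
  rw [h.self, h.symm v u] at this
  linarith

/-- `(S, σ)` obeys the parity labels `lab` and assigns every node to a center at distance at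
most `r`. -/
structure Sol (n : ℕ) (lab : ℕ → ℕ) (d : ℕ → ℕ → ℝ) (r : ℝ) (S : Finset ℕ) (σ : ℕ → ℕ) : Prop where
  lt : ∀ u ∈ S, u < n
  mem : ∀ v < n, σ v ∈ S
  odd : ∀ u ∈ S, lab u = 1 → Odd ((Finset.range n).filter fun v => σ v = u).card
  even : ∀ u ∈ S, lab u = 0 → Even ((Finset.range n).filter fun v => σ v = u).card
  dist : ∀ v < n, d v (σ v) ≤ r

/-- No two nodes in `M` have a common neighbour at distance at most `r`. -/
def Separated (n : ℕ) (d : ℕ → ℕ → ℝ) (r : ℝ) (M : ℕ → Prop) : Prop :=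
  ∀ v < n, ∀ w < n, M v → M w → ∀ u < n, d v u ≤ r → d w u ≤ r → v = w

/-! ### What a solution of radius r must do on a union of components. -/

section lower

variable {n : ℕ} {lab : ℕ → ℕ} {d : ℕ → ℕ → ℝ} {r : ℝ} {S : Finset ℕ} {σ : ℕ → ℕ}
  {K : Finset ℕ} {M : ℕ → Prop} [DecidablePred M]

/-- A shared center would be a common neighbour. -/
theorem Sol.injOn (h : Sol n lab d r S σ) (hK : ∀ u ∈ K, u < n) (hM : Separated n d r M) :
    Set.InjOn σ (K.filter M) := by
  intro v hv w hw hvw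
  simp only [Finset.coe_filter, Set.mem_ofPred_eq] at hv hw
  refine hM v (hK v hv.1) w (hK w hw.1) hv.2 hw.2 (σ v) (h.lt _ (h.mem v (hK v hv.1)))
    (h.dist v (hK v hv.1)) ?_
  rw [hvw]; exact h.dist w (hK w hw.1)

theorem Sol.mapsTo (h : Sol n lab d r S σ) (hK : ∀ u ∈ K, u < n)
    (hcl : ∀ u ∈ K, ∀ v < n, d u v ≤ r → v ∈ K) {v : ℕ} (hv : v ∈ K) :
    σ v ∈ K.filter (· ∈ S) := by
  have hm := h.mem v (hK v hv)
  exact Finset.mem_filter.2 ⟨hcl v hv _ (h.lt _ hm) (h.dist v (hK v hv)), hm⟩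

theorem Sol.image_subset (h : Sol n lab d r S σ) (hK : ∀ u ∈ K, u < n)
    (hcl : ∀ u ∈ K, ∀ v < n, d u v ≤ r → v ∈ K) :
    (K.filter M).image σ ⊆ K.filter (· ∈ S) :=
  Finset.image_subset_iff.2 fun _ hv => h.mapsTo hK hcl (Finset.mem_filter.1 hv).1

theorem Sol.card_le (h : Sol n lab d r S σ) (hK : ∀ u ∈ K, u < n)
    (hcl : ∀ u ∈ K, ∀ v < n, d u v ≤ r → v ∈ K) (hM : Separated n d r M) :
    (K.filter M).card ≤ (K.filter (· ∈ S)).card := by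
  rw [← Finset.card_image_of_injOn (h.injOn hK hM)]
  exact Finset.card_le_card (h.image_subset hK hcl)

/-- Since K is closed under taking neighbours, the fibre of a center in K lies entirely in K, and
the fibres over S ∩ K partition K. -/
theorem Sol.card_eq_sum (h : Sol n lab d r S σ) (hd : IsMetric n d) (hK : ∀ u ∈ K, u < n)
    (hcl : ∀ u ∈ K, ∀ v < n, d u v ≤ r → v ∈ K) :
    K.card = ∑ u ∈ K.filter (· ∈ S), ((Finset.range n).filter fun v => σ v = u).card := by
  rw [Finset.card_eq_sum_card_fiberwise (f := σ) (t := K.filter (· ∈ S))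
    (fun v hv => h.mapsTo hK hcl hv)]
  refine Finset.sum_congr rfl fun u hu => congrArg _ ?_
  ext v
  simp only [Finset.mem_filter, Finset.mem_range] at hu ⊢
  refine ⟨fun hv => ⟨hK v hv.1, hv.2⟩, fun hv => ⟨?_, hv.2⟩⟩
  refine hcl u hu.1 v hv.1 ?_
  rw [hd.symm, ← hv.2]
  exact h.dist v hv.1

/-- The parity of the number of nodes at a center of a constrained label. -/
theorem Sol.cast_card (h : Sol n lab d r S σ) {u : ℕ} (hu : u ∈ S) (hl : lab u ≤ 1) :
    (((Finset.range n).filter fun v => σ v = u).card : ZMod 2) = lab u := by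
  interval_cases hlu : lab u
  · simpa using (ZMod.natCast_eq_zero_iff_even).2 (h.even u hu hlu)
  · simpa using (ZMod.natCast_eq_one_iff_odd).2 (h.odd u hu hlu)

/-- The default parity of a center with label `a`. -/
def target (a : ℕ) : ℕ := if a = 1 then 1 else 0

theorem target_le (a : ℕ) : target a ≤ 1 := by unfold target; split <;> simp

/-- `1` minus the default parity of a node, which is that of its label for the nodes in `M`
and `0` for all other nodes. -/
def defect (lab : ℕ → ℕ) (M : ℕ → Prop) [DecidablePred M] (v : ℕ) : ℕ :=
  if M v ∧ lab v = 1 then 0 else 1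

/-- Modulo 2, the total defect measures whether the size of K agrees with the sum of the default
parities of its clusters. -/
theorem cast_sum_defect (K : Finset ℕ) :
    ((∑ v ∈ K, defect lab M v : ℕ) : ZMod 2) = K.card + ∑ m ∈ K.filter M, (target (lab m) : ZMod 2) := by
  rw [Finset.sum_filter, Finset.card_eq_sum_ones]
  push_cast
  rw [← Finset.sum_add_distrib]
  refine Finset.sum_congr rfl fun v _ => ?_
  unfold defect target
  by_cases h1 : M v <;> by_cases h2 : lab v = 1 <;> simp [h1, h2]
  decide

/-- This justifies the paid flip. With `hlab`, the label of the center of any m in M is forced to be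
the default parity of m, so a solution with only |M ∩ K| centers in K, or an instance whose nodes of
K outside M are all even, would make the size of K agree with the default parities, contrary to
`hodd`. -/
theorem Sol.card_lt (h : Sol n lab d r S σ) (hd : IsMetric n d) (hr : 0 ≤ r)
    (hK : ∀ u ∈ K, u < n)
    (hcl : ∀ u ∈ K, ∀ v < n, d u v ≤ r → v ∈ K) (hM : Separated n d r M)
    (hlab : ∀ m ∈ K, M m → ∀ w < n, d m w ≤ r → lab w = target (lab m))
    (hodd : Odd (∑ v ∈ K, defect lab M v)) :
    (K.filter M).card < (K.filter (· ∈ S)).card ∧ ∃ w ∈ K, ¬ M w ∧ lab w ≠ 0 := by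
  have hne : (K.card : ZMod 2) ≠ ∑ m ∈ K.filter M, (target (lab m) : ZMod 2) := by
    intro he
    have h1 := (ZMod.natCast_eq_one_iff_odd).2 hodd
    rw [cast_sum_defect, he, CharTwo.add_self_eq_zero] at h1
    exact zero_ne_one h1
  have hσ : ∀ m ∈ K, M m → lab (σ m) = target (lab m) := fun m hm hMm =>
    hlab m hm hMm _ (h.lt _ (h.mem m (hK m hm))) (h.dist m (hK m hm))
  have hsum := h.card_eq_sum hd hK hcl
  constructor
  -- With equality, σ maps M ∩ K bijectively onto S ∩ K, and the size of K is the sum of the default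
  -- parities.
  · refine lt_of_le_of_ne (h.card_le hK hcl hM) fun he => hne ?_
    have himg : (K.filter M).image σ = K.filter (· ∈ S) := by
      refine Finset.eq_of_subset_of_card_le (h.image_subset hK hcl) ?_
      rw [Finset.card_image_of_injOn (h.injOn hK hM), he]
    rw [hsum, ← himg, Finset.sum_image (h.injOn hK hM)]
    push_cast
    refine Finset.sum_congr rfl fun m hm => ?_
    rw [Finset.mem_filter] at hm
    rw [h.cast_card (h.mem m (hK m hm.1)) (by rw [hσ m hm.1 hm.2]; exact target_le _),
      hσ m hm.1 hm.2]
  -- Now every label in K is constrained, so modulo 2 the size of K counts the odd centers. It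
  -- remains to see that these are exactly the odd nodes of M ∩ K.
  · by_contra! hno
    apply hne
    rw [hsum]
    have hself : ∀ m ∈ K, M m → lab m = target (lab m) := fun m hm hMm =>
      hlab m hm hMm m (hK m hm) (by rw [hd.self]; exact hr)
    have hle : ∀ u ∈ K, lab u ≤ 1 := fun u hu => by
      by_cases hMu : M u
      · rw [hself u hu hMu]; exact target_le _
      · rw [hno u hu hMu]; exact zero_le_one
    have h1 : ((∑ u ∈ K.filter (· ∈ S), ((Finset.range n).filter fun v => σ v = u).card : ℕ) : ZMod 2)
        = ∑ u ∈ K, if u ∈ S then (lab u : ZMod 2) else 0 := by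
      push_cast
      rw [Finset.sum_filter]
      refine Finset.sum_congr rfl fun u hu => ?_
      split
      · exact h.cast_card ‹_› (hle u hu)
      · rfl
    rw [h1, Finset.sum_filter]
    refine Finset.sum_congr rfl fun u hu => ?_
    by_cases hMu : M u
    · rw [if_pos hMu, ← hself u hu hMu]
      by_cases hl : lab u = 0
      · simp [hl]
      · have hl1 : lab u = 1 := by have := hle u hu; omega
        have h2 := h.mapsTo hK hcl hu
        rw [Finset.mem_filter] at h2
        have h3 : lab (σ u) = 1 := by rw [hσ u hu hMu, hl1]; rfl
        have h4 : M (σ u) := by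
          by_contra h5
          rw [hno _ h2.1 h5] at h3
          exact zero_ne_one h3
        -- The center of an odd node of M is odd, hence itself in M, and it is a neighbour of both;
        -- separation forces the node to be its own center.
        have h5 : u = σ u := hM u (hK u hu) _ (hK _ h2.1) hMu h4 (σ u) (hK _ h2.1)
          (h.dist u (hK u hu)) (by rw [hd.self]; exact hr)
        rw [if_pos (by rw [h5]; exact h2.2)]
    · rw [if_neg hMu, hno u hu hMu]; simp

end lower

/-! ### Registers and arrays -/

@[simp] abbrev rN : ℕ := 0
@[simp] abbrev rK : ℕ := 1
@[simp] abbrev rI : ℕ := 2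
@[simp] abbrev rL : ℕ := 3
@[simp] abbrev rBest : ℕ := 4
@[simp] abbrev rV : ℕ := 5
@[simp] abbrev rU : ℕ := 6
@[simp] abbrev rX : ℕ := 7
@[simp] abbrev rY : ℕ := 8
@[simp] abbrev rP : ℕ := 9
@[simp] abbrev rQ : ℕ := 10
@[simp] abbrev rA : ℕ := 11
@[simp] abbrev rB : ℕ := 12
@[simp] abbrev rCnt : ℕ := 13
@[simp] abbrev rFail : ℕ := 14
@[simp] abbrev rPar : ℕ := 15
@[simp] abbrev rFree : ℕ := 16
@[simp] abbrev rPaid : ℕ := 17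
@[simp] abbrev rFound : ℕ := 18
@[simp] abbrev rBX : ℕ := 19
@[simp] abbrev rBY : ℕ := 20
@[simp] abbrev rT : ℕ := 21

@[simp] abbrev aLab : ℕ := 0
@[simp] abbrev aSig : ℕ := 1
@[simp] abbrev aOrd : ℕ := 2
@[simp] abbrev aNear : ℕ := 3
@[simp] abbrev aPar : ℕ := 4
@[simp] abbrev aTX : ℕ := 5
@[simp] abbrev aTY : ℕ := 6
@[simp] abbrev aWl : ℕ := 7
@[simp] abbrev aHw : ℕ := 8
@[simp] abbrev aZ : ℕ := 9
@[simp] abbrev aRep : ℕ := 10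
@[simp] abbrev aIsc : ℕ := 11
@[simp] abbrev aOwn : ℕ := 12
@[simp] abbrev aZB : ℕ := 13
@[simp] abbrev aRepB : ℕ := 14
@[simp] abbrev aIscB : ℕ := 15

/-- Run `body` for `x` from `0` to `n - 1`. -/
def Cmd.for (x : ℕ) (body : Cmd) : Cmd := .seq (.assign x (.const 0)) (.up x body)

theorem Ok.for {d : ℕ → ℕ → ℝ} {s : Store} {x n T : ℕ} {body : Cmd} (I : ℕ → Store → Prop)
    (h0 : (Cmd.for x body).keepsVar 0 = true) (hx : body.keepsVar x = true)
    (hn : s.var 0 = n) (hI : I 0 (s.setVar x 0))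
    (hstep : ∀ i s', i < n → Frame (Cmd.for x body) s s' → s'.var x = i → I i s' →
      Ok d body s' T (fun s'' => I (i + 1) (s''.setVar x (i + 1)))) :
    Ok d (Cmd.for x body) s (n * (T + 10) + 8) (I n) := by
  have hx0 : 0 ≠ x := by
    simp only [Cmd.for, Cmd.keepsVar, Bool.and_eq_true] at h0
    simpa using h0.1
  have h1 : Ok d (.assign x (.const 0)) s 2 (fun s' => s' = s.setVar x 0) :=
    ⟨_, _, Exec.assign _ _ _, le_rfl, rfl⟩
  refine (h1.seq (B' := n * (T + 10) + 6) fun s' hF hs' => ?_).mono (by omega) fun _ _ h => h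
  subst hs'
  refine Ok.up I ?_ hx (by simp [hx0, hn]) (a := 0) (by simp) (Nat.zero_le _) hI ?_
  · simp only [Cmd.for, Cmd.keepsVar, Bool.and_eq_true] at h0
    exact h0.2
  · intro i s' _ hi hF' hs' hI'
    refine hstep i s' hi (Frame.trans (hF.mono ?_ ?_) (hF'.mono ?_ ?_)) hs' hI' <;>
      simp +contextual [Cmd.for, Cmd.keepsVar, Cmd.keepsArr]

/-! ### Greedy orders of the nodes -/

/-- `ord` is a permutation of the nodes, and `near v` is a node closest to `v` among the
first `i` nodes of `ord`. -/
structure Stage (n : ℕ) (d : ℕ → ℕ → ℝ) (i : ℕ) (ord near : ℕ → ℕ) : Prop where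
  ord_lt : ∀ l < n, ord l < n
  ord_inj : ∀ l < n, ∀ l' < n, ord l = ord l' → l = l'
  ord_zero : ord 0 = 0
  near_mem : ∀ v < n, ∃ j < i, near v = ord j
  near_le : ∀ v < n, ∀ j < i, d v (near v) ≤ d v (ord j)

theorem Stage.near_lt {n : ℕ} {d : ℕ → ℕ → ℝ} {i : ℕ} {ord near : ℕ → ℕ}
    (h : Stage n d i ord near) (hi : i ≤ n) {v : ℕ} (hv : v < n) : near v < n := by
  obtain ⟨j, hj, he⟩ := h.near_mem v hv
  rw [he]; exact h.ord_lt j (by omega)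

theorem Stage.surj {n : ℕ} {d : ℕ → ℕ → ℝ} {i : ℕ} {ord near : ℕ → ℕ}
    (h : Stage n d i ord near) {v : ℕ} (hv : v < n) : ∃ l < n, ord l = v := by
  have hs : Set.SurjOn ord (Finset.range n) (Finset.range n) := by
    refine Finset.surjOn_of_injOn_of_card_le _ ?_ ?_ le_rfl
    · intro l hl; simpa using h.ord_lt l (by simpa using hl)
    · intro l hl l' hl' he
      exact h.ord_inj l (by simpa using hl) l' (by simpa using hl') he
  obtain ⟨l, hl, he⟩ := hs (by simpa using hv : v ∈ (Finset.range n : Set ℕ))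
  exact ⟨l, by simpa using hl, he⟩

/-- Start with the identity order and node `0` as the only chosen node. -/
def resetCmd : Cmd :=
  .for rV (.seq (.write aOrd (.var rV) (.var rV)) (.write aNear (.var rV) (.const 0)))

theorem resetCmd_ok {n : ℕ} {d : ℕ → ℕ → ℝ} (hn : 0 < n) (s : Store)
    (hs : s.var rN = n) :
    Ok d resetCmd s (n * 16 + 8) (fun s' => Stage n d 1 (s'.arr aOrd) (s'.arr aNear)) := by
  refine (Ok.for (n := n) (T := 6)
    (fun i s' => ∀ v < i, s'.arr aOrd v = v ∧ s'.arr aNear v = 0) rfl rfl hs (by simp) ?_).mono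
      le_rfl ?_
  · intro i s' hi _ hv hI
    refine (Ok.of_wp ?_).mono (B := Cmd.bound _) (by decide) fun _ _ h => h
    simp only [rV] at hv
    simp only [Cmd.wp, Exp.eval]
    intro v hvi
    rcases Nat.lt_succ_iff_lt_or_eq.1 hvi with h | h
    · have := hI v h
      simp [hv, h.ne, this]
    · simp [hv, h]
  · intro s' _ h
    refine ⟨fun l hl => by rw [(h l hl).1]; exact hl, fun l hl l' hl' he => ?_, (h 0 hn).1,
      fun v hv => ⟨0, one_pos, ?_⟩, fun v hv j hj => ?_⟩
    · rwa [(h l hl).1, (h l' hl').1] at he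
    · rw [(h v hv).2, (h 0 hn).1]
    · obtain rfl : j = 0 := by omega
      rw [(h v hv).2, (h 0 hn).1]

/-- The key `x` is at least as good as `y`, where large (`far`) or small keys are preferred. -/
def Better (far : Bool) (x y : ℝ) : Prop := if far then y ≤ x else x ≤ y

theorem Better.refl (far : Bool) (x : ℝ) : Better far x x := by cases far <;> simp [Better]

theorem Better.trans {far : Bool} {x y z : ℝ} (h : Better far x y) (h' : Better far y z) :
    Better far x z := by
  cases far
  · simp only [Better] at *; exact h.trans h'
  · simp only [Better] at *; exact h'.trans h

theorem Better.of_not {far : Bool} {x y : ℝ} (h : ¬ Better far x y) : Better far y x := by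
  cases far
  · simp only [Better] at *; simp at h ⊢; exact h.le
  · simp only [Better] at *; simp at h ⊢; exact h.le

/-- The node at position `x` of the order. -/
abbrev nodeAt (x : ℕ) : Exp := .read aOrd (.var x)

/-- The position in `rL` has at least as good a key as that in `rBest`. -/
def betterTest : Bool → Test
  | true => .distLe (nodeAt rBest) (.read aNear (nodeAt rBest)) (nodeAt rL)
      (.read aNear (nodeAt rL))
  | false => .distLe (nodeAt rL) (.read aNear (nodeAt rL)) (nodeAt rBest)
      (.read aNear (nodeAt rBest))

/-- Find the best position from `rI` on. -/
def selectCmd (far : Bool) : Cmd := .up rL (.ite (betterTest far) (.assign rBest (.var rL)) .skip)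

/-- Find the best node from position `rI` on, and swap it with the one at `rI`. -/
def pickCmd (far : Bool) : Cmd :=
  .seq (.seq (.assign rBest (.var rI)) (.assign rL (.var rI)))
    (.seq (selectCmd far)
      (.seq (.assign rV (nodeAt rBest))
        (.seq (.write aOrd (.var rBest) (nodeAt rI)) (.write aOrd (.var rI) (.var rV)))))

/-- The fourth clause, that positions from i on receive nodes from positions from i on, lets
`nearCmd_ok` keep its minimality statement about nodes that are not yet chosen. -/
theorem pickCmd_ok {n i : ℕ} {d : ℕ → ℕ → ℝ} (far : Bool) (s : Store)
    (hs : s.var rN = n) (hi : s.var rI = i) (hi0 : 0 < i) (hin : i < n)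
    (hst : Stage n d i (s.arr aOrd) (s.arr aNear)) :
    Ok d (pickCmd far) s (n * 25 + 50) (fun s' => Stage n d i (s'.arr aOrd) (s'.arr aNear) ∧
      s'.var rV = s'.arr aOrd i ∧ (∀ j < i, s'.arr aOrd j = s.arr aOrd j) ∧
      (∀ l, i ≤ l → l < n → ∃ l', i ≤ l' ∧ l' < n ∧ s'.arr aOrd l = s.arr aOrd l') ∧
      ∀ l, i ≤ l → l < n → Better far (d (s'.arr aOrd i) (s.arr aNear (s'.arr aOrd i)))
        (d (s'.arr aOrd l) (s.arr aNear (s'.arr aOrd l)))) := by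
  have h1 : Ok d (.seq (.assign rBest (.var rI)) (.assign rL (.var rI))) s 4
      (fun s' => s'.var rBest = i ∧ s'.var rL = i) := by
    refine (Ok.of_wp ?_).mono (B := Cmd.bound _) (by decide) fun _ _ h => h
    simp [Cmd.wp, Exp.eval, ← hi]
  refine (h1.seq (B' := n * 25 + 46) fun s1 hF1 h1 => ?_).mono (by omega) fun _ _ h => h
  have hord : s1.arr aOrd = s.arr aOrd := hF1.arr aOrd
  have hnear : s1.arr aNear = s.arr aNear := hF1.arr aNear
  have hs1 : s1.var rN = n := (hF1.var rN).trans hs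
  have h2 : Ok d (selectCmd far) s1 (n * 25 + 6) (fun s' => i ≤ s'.var rBest ∧ s'.var rBest < n ∧
      ∀ l, i ≤ l → l < n → Better far
        (d (s.arr aOrd (s'.var rBest)) (s.arr aNear (s.arr aOrd (s'.var rBest))))
        (d (s.arr aOrd l) (s.arr aNear (s.arr aOrd l)))) := by
    refine Ok.up (T := 15) (fun m s' => i ≤ s'.var rBest ∧ s'.var rBest < n ∧
      ∀ l, i ≤ l → l < m → Better far
        (d (s.arr aOrd (s'.var rBest)) (s.arr aNear (s.arr aOrd (s'.var rBest))))
        (d (s.arr aOrd l) (s.arr aNear (s.arr aOrd l)))) rfl rfl hs1 h1.2 hin.le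
        ⟨h1.1.ge, by omega, fun l hl hl' => by omega⟩ ?_
    intro m s' him hm hF hL ⟨hb1, hb2, hb3⟩
    refine (Ok.of_wp ?_).mono (B := Cmd.bound _) (by cases far <;> decide) fun _ _ h => h
    have ho : s'.arr aOrd = s.arr aOrd := (hF.arr aOrd).trans hord
    have hne : s'.arr aNear = s.arr aNear := (hF.arr aNear).trans hnear
    have htest : (betterTest far).Holds d s' ↔ Better far
        (d (s.arr aOrd m) (s.arr aNear (s.arr aOrd m)))
        (d (s.arr aOrd (s'.var rBest)) (s.arr aNear (s.arr aOrd (s'.var rBest)))) := by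
      simp only [rL] at hL
      cases far <;> simp [betterTest, Test.Holds, Exp.eval, Better, ← ho, ← hne, hL]
    simp only [Cmd.wp, htest]
    simp only [rL] at hL
    constructor
    · intro hb
      simp only [Exp.eval, Store.setVar_var, hL]
      refine ⟨by simpa using him, by simpa using hm, fun l hl hl' => ?_⟩
      rcases Nat.lt_succ_iff_lt_or_eq.1 hl' with h | h
      · simpa using hb.trans (hb3 l hl h)
      · subst h; simpa using Better.refl far _
    · intro hb
      simp only [Store.setVar_var]
      refine ⟨by simpa using hb1, by simpa using hb2, fun l hl hl' => ?_⟩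
      rcases Nat.lt_succ_iff_lt_or_eq.1 hl' with h | h
      · simpa using hb3 l hl h
      · subst h; simpa using Better.of_not hb
  refine (h2.seq (B' := 20) fun s2 hF2 h2 => ?_).mono (by omega) fun _ _ h => h
  obtain ⟨hb1, hb2, hb3⟩ := h2
  have ho : s2.arr aOrd = s.arr aOrd := by cases far <;> exact (hF2.arr aOrd).trans hord
  have hne : s2.arr aNear = s.arr aNear := by cases far <;> exact (hF2.arr aNear).trans hnear
  have hI : s2.var rI = i := by
    cases far <;> exact ((hF2.var rI).trans (hF1.var rI)).trans hi
  refine (Ok.of_wp ?_).mono (B := Cmd.bound _) (by decide) fun _ _ h => h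
  set b := s2.var rBest with hbdef
  -- The two writes are composition with a transposition, so the order remains a permutation and its
  -- first i entries are fixed.
  have key : ∀ l, (Function.update (Function.update (s.arr aOrd) b (s.arr aOrd i)) i (s.arr aOrd b)) l
      = s.arr aOrd (Equiv.swap i b l) := by
    intro l
    simp only [Function.update_apply, Equiv.swap_apply_def]
    split_ifs <;> rfl
  have e1 : ∀ l, i ≤ l → l < n → i ≤ Equiv.swap i b l ∧ Equiv.swap i b l < n := by
    intro l hl hl'
    rw [Equiv.swap_apply_def]
    split_ifs <;> omega
  have e2 : ∀ l, l < i → Equiv.swap i b l = l := fun l hl =>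
    Equiv.swap_apply_of_ne_of_ne (by omega) (by omega)
  have e3 : ∀ l, l < n → Equiv.swap i b l < n := by
    intro l hl
    rcases lt_or_ge l i with h | h
    · rwa [e2 l h]
    · exact (e1 l h hl).2
  have hord' : ∀ s' : Store, s'.arr aOrd = (fun l => s.arr aOrd (Equiv.swap i b l)) →
      s'.arr aNear = s.arr aNear → s'.var rV = s.arr aOrd b →
      (Stage n d i (s'.arr aOrd) (s'.arr aNear) ∧
      s'.var rV = s'.arr aOrd i ∧ (∀ j < i, s'.arr aOrd j = s.arr aOrd j) ∧
      (∀ l, i ≤ l → l < n → ∃ l', i ≤ l' ∧ l' < n ∧ s'.arr aOrd l = s.arr aOrd l') ∧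
      ∀ l, i ≤ l → l < n → Better far (d (s'.arr aOrd i) (s.arr aNear (s'.arr aOrd i)))
        (d (s'.arr aOrd l) (s.arr aNear (s'.arr aOrd l)))) := by
    intro s' q1 q2 q3
    rw [q1, q2, q3]
    refine ⟨⟨fun l hl => hst.ord_lt _ (e3 l hl), fun l hl l' hl' he => ?_, ?_, fun v hv => ?_,
      fun v hv j hj => ?_⟩, ?_, fun j hj => ?_, fun l hl hl' => ⟨_, (e1 l hl hl').1, (e1 l hl hl').2,
        rfl⟩, fun l hl hl' => ?_⟩
    · exact (Equiv.swap i b).injective (hst.ord_inj _ (e3 l hl) _ (e3 l' hl') he)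
    · rw [e2 0 hi0]; exact hst.ord_zero
    · obtain ⟨j, hj, he⟩ := hst.near_mem v hv
      exact ⟨j, hj, by rw [e2 j hj]; exact he⟩
    · rw [e2 j hj]; exact hst.near_le v hv j hj
    · change _ = s.arr aOrd (Equiv.swap i b i)
      rw [Equiv.swap_apply_left]
    · change s.arr aOrd (Equiv.swap i b j) = _
      rw [e2 j hj]
    · beta_reduce
      rw [Equiv.swap_apply_left]
      exact hb3 _ (e1 l hl hl').1 (e1 l hl hl').2
  simp only [Cmd.wp, Exp.eval]
  apply hord'
  · funext l
    rw [← key]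
    simp only [rBest, rI, rV] at *
    simp [ho, hI, ← hbdef, Function.update_apply]
  · simp [Store.setArr_arr, hne]
  · simp [ho, ← hbdef]

/-- Take the node in `rV` into account in `near`. -/
def updCmd : Cmd :=
  .for rU (.ite (.distLe (.var rU) (.var rV) (.var rU) (.read aNear (.var rU)))
    (.write aNear (.var rU) (.var rV)) .skip)

theorem updCmd_ok {n i : ℕ} {d : ℕ → ℕ → ℝ} (s : Store)
    (hs : s.var rN = n) (hv : s.var rV = s.arr aOrd i)
    (hst : Stage n d i (s.arr aOrd) (s.arr aNear)) :
    Ok d updCmd s (n * 20 + 8) (fun s' => Stage n d (i + 1) (s'.arr aOrd) (s'.arr aNear)) := by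
  refine (Ok.for (n := n) (T := 10)
    (fun m s' => ∀ v < n, (m ≤ v → s'.arr aNear v = s.arr aNear v) ∧
      (v < m → (∃ j < i + 1, s'.arr aNear v = s.arr aOrd j) ∧
        ∀ j < i + 1, d v (s'.arr aNear v) ≤ d v (s.arr aOrd j))) rfl rfl hs ?_ ?_).mono
      le_rfl ?_
  · intro v hv
    exact ⟨fun _ => rfl, fun h => absurd h (Nat.not_lt_zero v)⟩
  · intro m s' hm hF hU hI
    have hV : s'.var rV = s.arr aOrd i := (hF.var rV).trans hv
    refine (Ok.of_wp ?_).mono (B := Cmd.bound _) (by decide) fun _ _ h => h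
    simp only [rU, rV] at hU hV
    have hm' := (hI m hm).1 le_rfl
    have hrest : ∀ v < n, v ≠ m → (m + 1 ≤ v → s'.arr aNear v = s.arr aNear v) ∧
      (v < m + 1 → (∃ j < i + 1, s'.arr aNear v = s.arr aOrd j) ∧
        ∀ j < i + 1, d v (s'.arr aNear v) ≤ d v (s.arr aOrd j)) := fun v hv hne =>
      ⟨fun h => (hI v hv).1 (by omega), fun h => (hI v hv).2 (by omega)⟩
    simp only [Cmd.wp, Exp.eval, Test.Holds, hU, hV, hm', Store.setVar_arr]
    constructor
    · intro hle v hv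
      by_cases hvm : v = m
      · subst hvm
        refine ⟨fun h => absurd h (by omega), fun _ => ?_⟩
        simp only [Store.setArr_arr_apply, and_self, if_true]
        refine ⟨⟨i, by omega, rfl⟩, fun j hj => ?_⟩
        rcases Nat.lt_succ_iff_lt_or_eq.1 hj with h | h
        · exact hle.trans (hst.near_le v hv j h)
        · rw [h]
      · simpa [hvm] using hrest v hv hvm
    · intro hle v hv
      by_cases hvm : v = m
      · subst hvm
        refine ⟨fun h => absurd h (by omega), fun _ => ?_⟩
        rw [hm']
        obtain ⟨j, hj, he⟩ := hst.near_mem v hv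
        refine ⟨⟨j, by omega, he⟩, fun j hj => ?_⟩
        rcases Nat.lt_succ_iff_lt_or_eq.1 hj with h | h
        · exact hst.near_le v hv j h
        · rw [h]; exact (not_le.1 hle).le
      · exact hrest v hv hvm
  · intro s' hF h
    rw [hF.arr aOrd]
    exact ⟨hst.ord_lt, hst.ord_inj, hst.ord_zero, fun v hv => ((h v hv).2 hv).1,
      fun v hv => ((h v hv).2 hv).2⟩

/-! ### Separated nodes: the farthest-first order -/

/-- Compute in `(rX, rY)` the least distance at which the node in `rV` has a common neighbour with
a node chosen before. -/
def thetaCmd : Cmd :=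
  .seq (.seq (.assign rX (.var rV)) (.assign rY (.read aNear (.var rV))))
    (.seq
      (.for rU (.seq
        (.ite (.distLe (.var rV) (.var rU) (.var rU) (.read aNear (.var rU)))
          (.seq (.assign rP (.var rU)) (.assign rQ (.read aNear (.var rU))))
          (.seq (.assign rP (.var rV)) (.assign rQ (.var rU))))
        (.ite (.distLe (.var rP) (.var rQ) (.var rX) (.var rY))
          (.seq (.assign rX (.var rP)) (.assign rY (.var rQ))) .skip)))
      (.seq (.write aTX (.var rV) (.var rX)) (.write aTY (.var rV) (.var rY))))

/-- The node v and an earlier node share the neighbour u from radius max (d v u) (d u (near u)) on,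
because near u is the earlier node closest to u. This maximum is itself a matrix entry, so its
minimum over u can be kept as a pair of nodes although the machine never sees a distance. -/
theorem thetaCmd_ok {n i v : ℕ} {d : ℕ → ℕ → ℝ} (hd : IsMetric n d) (s : Store)
    (hs : s.var rN = n) (hv : s.var rV = v) (hvn : v < n) (hin : i ≤ n)
    (hst : Stage n d i (s.arr aOrd) (s.arr aNear)) :
    Ok d thetaCmd s (n * 40 + 30) (fun s' => ∃ x < n, ∃ y < n,
      (∀ w, s'.arr aTX w = if w = v then x else s.arr aTX w) ∧
      (∀ w, s'.arr aTY w = if w = v then y else s.arr aTY w) ∧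
      (∀ u < n, d x y ≤ max (d v u) (d u (s.arr aNear u))) ∧
      ∃ u < n, d v u ≤ d x y ∧ d u (s.arr aNear u) ≤ d x y) := by
  have hnn := hst.near_lt hin hvn
  have h1 : Ok d (.seq (.assign rX (.var rV)) (.assign rY (.read aNear (.var rV)))) s 5
      (fun s' => s'.var rX = v ∧ s'.var rY = s.arr aNear v) := by
    refine (Ok.of_wp ?_).mono (B := Cmd.bound _) (by decide) fun _ _ h => h
    simp only [rV] at hv
    simp [Cmd.wp, Exp.eval, hv]
  refine (h1.seq (B' := n * 40 + 25) fun s1 hF1 h1 => ?_).mono (by omega) fun _ _ h => h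
  have h2 := Ok.for (d := d) (s := s1) (n := n) (T := 30) (x := rU)
    (body := .seq
        (.ite (.distLe (.var rV) (.var rU) (.var rU) (.read aNear (.var rU)))
          (.seq (.assign rP (.var rU)) (.assign rQ (.read aNear (.var rU))))
          (.seq (.assign rP (.var rV)) (.assign rQ (.var rU))))
        (.ite (.distLe (.var rP) (.var rQ) (.var rX) (.var rY))
          (.seq (.assign rX (.var rP)) (.assign rY (.var rQ))) .skip))
    (fun m s' => s'.var rX < n ∧ s'.var rY < n ∧
      (∀ u < m, d (s'.var rX) (s'.var rY) ≤ max (d v u) (d u (s.arr aNear u))) ∧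
      ∃ u < n, d v u ≤ d (s'.var rX) (s'.var rY) ∧ d u (s.arr aNear u) ≤ d (s'.var rX) (s'.var rY))
    rfl rfl ((hF1.var rN).trans hs) ?_ ?_
  · refine (h2.seq (B' := 6) fun s2 hF2 h2 => ?_).mono (by omega) fun _ _ h => h
    obtain ⟨hx, hy, hall, hex⟩ := h2
    have hv2 : s2.var rV = v := ((hF2.var rV).trans (hF1.var rV)).trans hv
    have hX2 : s2.arr aTX = s.arr aTX := (hF2.arr aTX).trans (hF1.arr aTX)
    have hY2 : s2.arr aTY = s.arr aTY := (hF2.arr aTY).trans (hF1.arr aTY)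
    refine (Ok.of_wp ?_).mono (B := Cmd.bound _) (by decide) fun _ _ h => h
    refine ⟨s2.var rX, hx, s2.var rY, hy, ?_, ?_, hall, hex⟩ <;>
    · simp only [rV, aTX, aTY] at hv2 hX2 hY2
      simp [Exp.eval, hv2, hX2, hY2]
  · obtain ⟨hx, hy⟩ := h1
    have e1 : (s1.setVar rU 0).var rX = v := by simpa using hx
    have e2 : (s1.setVar rU 0).var rY = s.arr aNear v := by simpa using hy
    rw [e1, e2]
    -- The initial pair (v, near v) is witnessed by u = near v, which is an earlier node and so at
    -- distance at most 0 from the earlier node closest to it.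
    refine ⟨hvn, hnn, fun u hu => absurd hu (Nat.not_lt_zero u), s.arr aNear v, hnn, le_rfl, ?_⟩
    obtain ⟨j, hj, he⟩ := hst.near_mem v hvn
    refine le_trans (hst.near_le _ hnn j hj) ?_
    rw [he, hd.self]
    exact hd.nonneg hvn (hst.ord_lt j (by omega))
  · intro m s' hm hF hU ⟨hx, hy, hall, hex⟩
    have hV : s'.var rV = v := ((hF.var rV).trans (hF1.var rV)).trans hv
    have hN : s'.arr aNear = s.arr aNear := (hF.arr aNear).trans (hF1.arr aNear)
    have hnm := hst.near_lt hin hm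
    refine (Ok.of_wp ?_).mono (B := Cmd.bound _) (by decide) fun _ _ h => h
    have upd : ∀ p q, p < n → q < n → d p q ≤ max (d v m) (d m (s.arr aNear m)) →
        d v m ≤ d p q → d m (s.arr aNear m) ≤ d p q → ∀ s'' : Store,
        (d p q ≤ d (s'.var rX) (s'.var rY) ∧ s''.var rX = p ∧ s''.var rY = q ∨
          ¬ d p q ≤ d (s'.var rX) (s'.var rY) ∧ s''.var rX = s'.var rX ∧ s''.var rY = s'.var rY) →
        (s''.var rX < n ∧ s''.var rY < n ∧
      (∀ u < m + 1, d (s''.var rX) (s''.var rY) ≤ max (d v u) (d u (s.arr aNear u))) ∧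
      ∃ u < n, d v u ≤ d (s''.var rX) (s''.var rY) ∧
        d u (s.arr aNear u) ≤ d (s''.var rX) (s''.var rY)) := by
      rintro p q hp hq h1 h2 h3 s'' (⟨h4, h5, h6⟩ | ⟨h4, h5, h6⟩)
      · rw [h5, h6]
        refine ⟨hp, hq, fun u hu => ?_, m, hm, h2, h3⟩
        rcases Nat.lt_succ_iff_lt_or_eq.1 hu with h | h
        · exact h4.trans (hall u h)
        · rw [h]; exact h1
      · rw [h5, h6]
        refine ⟨hx, hy, fun u hu => ?_, hex⟩
        rcases Nat.lt_succ_iff_lt_or_eq.1 hu with h | h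
        · exact hall u h
        · rw [h]; exact (not_le.1 h4).le.trans h1
    simp only [rU, rV, aNear] at hU hV hN
    simp only [Cmd.wp, Exp.eval, Test.Holds]
    constructor
    · intro h1
      simp only [rU, rV, hU, hV, hN, aNear] at h1
      constructor
      · intro h2
        apply upd m (s.arr aNear m) hm hnm (le_max_right _ _) h1 le_rfl
        left
        simpa [hU, hV, hN] using h2
      · intro h2
        apply upd m (s.arr aNear m) hm hnm (le_max_right _ _) h1 le_rfl
        right
        simpa [hU, hV, hN] using h2
    · intro h1
      simp only [rU, rV, hU, hV, hN, aNear] at h1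
      constructor
      · intro h2
        apply upd v m hvn hm (le_max_left _ _) le_rfl (not_le.1 h1).le
        left
        simpa [hU, hV, hN] using h2
      · intro h2
        apply upd v m hvn hm (le_max_left _ _) le_rfl (not_le.1 h1).le
        right
        simpa [hU, hV, hN] using h2

/-- Node `v` belongs to the separated set at threshold `r`. -/
def InM (d : ℕ → ℕ → ℝ) (tx ty : ℕ → ℕ) (r : ℝ) (v : ℕ) : Prop :=
  ¬ (1 ≤ v ∧ d (tx v) (ty v) ≤ r)

/-- The farthest-first order, with the thresholds for the separated sets. -/
def farCmd : Cmd :=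
  .seq resetCmd (.seq (.assign rI (.const 1))
    (.up rI (.seq (pickCmd true) (.seq thetaCmd updCmd))))

/-- Separation: if two nodes share a neighbour at radius r, then the later one has its threshold at
most r and is not in the set. Covering: the nodes before the first one to drop out already cover
everything within 2r. Both hold for all r with the same order and thresholds; node 0 comes first and
never drops out. -/
theorem farCmd_ok {n : ℕ} {d : ℕ → ℕ → ℝ} (hd : IsMetric n d) (hn : 0 < n) (s : Store)
    (hs : s.var rN = n) (hTX : ∀ v, s.arr aTX v = 0) (hTY : ∀ v, s.arr aTY v = 0) :
    Ok d farCmd s (n * (n * 85 + 98) + n * 16 + 16) (fun s' =>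
      (∀ v < n, s'.arr aTX v < n ∧ s'.arr aTY v < n) ∧
      ∀ r, Separated n d r (InM d (s'.arr aTX) (s'.arr aTY) r) ∧
        ∀ v < n, ∃ m < n, InM d (s'.arr aTX) (s'.arr aTY) r m ∧ (0 ≤ r → d v m ≤ 2 * r)) := by
  refine ((resetCmd_ok hn s hs).seq (B' := n * (n * 85 + 98) + 8) fun s1 hF1 hst1 => ?_).mono
    (by omega) fun _ _ h => h
  have h2 : Ok d (.assign rI (.const 1)) s1 2 (fun s' => s'.var rI = 1) := by
    refine (Ok.of_wp ?_).mono (B := Cmd.bound _) (by decide) fun _ _ h => h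
    simp [Cmd.wp, Exp.eval]
  refine (h2.seq (B' := n * (n * 85 + 98) + 6) fun s2 hF2 h2 => ?_).mono
    (by omega) fun _ _ h => h
  have e1 : s2.arr aOrd = s1.arr aOrd := hF2.arr aOrd
  have e2 : s2.arr aNear = s1.arr aNear := hF2.arr aNear
  have e3 : s2.arr aTX = s.arr aTX := (hF2.arr aTX).trans (hF1.arr aTX)
  have e4 : s2.arr aTY = s.arr aTY := (hF2.arr aTY).trans (hF1.arr aTY)
  have e5 : s2.var rN = n := ((hF2.var rN).trans (hF1.var rN)).trans hs
  refine (Ok.up (n := n) (T := n * 85 + 88) (fun i s' => Stage n d i (s'.arr aOrd) (s'.arr aNear) ∧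
    (∀ v < n, s'.arr aTX v < n ∧ s'.arr aTY v < n) ∧
    (∀ a b u, a < b → b < i → u < n → d (s'.arr aTX (s'.arr aOrd b)) (s'.arr aTY (s'.arr aOrd b)) ≤
      max (d (s'.arr aOrd b) u) (d u (s'.arr aOrd a))) ∧
    ∀ r, (∀ b < i, InM d (s'.arr aTX) (s'.arr aTY) r (s'.arr aOrd b)) ∨
      ∀ v < n, ∃ a < i, InM d (s'.arr aTX) (s'.arr aTY) r (s'.arr aOrd a) ∧
        d v (s'.arr aOrd a) ≤ 2 * r) rfl rfl e5 h2 hn ?_ ?_).mono le_rfl ?_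
  · rw [e1, e2, e3, e4]
    refine ⟨hst1, fun v hv => by rw [hTX, hTY]; exact ⟨hn, hn⟩, fun a b u hab hb => by omega,
      fun r => Or.inl fun b hb => ?_⟩
    obtain rfl : b = 0 := by omega
    rw [hst1.ord_zero]
    simp [InM]
  · intro i s3 hi0 hin hF3 hI3 ⟨hst, hlt, hsep, hcov⟩
    have hN3 : s3.var rN = n := (hF3.var rN).trans e5
    refine ((pickCmd_ok true s3 hN3 hI3 hi0 hin hst).seq (B' := n * 60 + 38)
      fun s4 hF4 ⟨hst4, hV4, hpre, hsuf, hbest⟩ => ?_).mono (by omega) fun _ _ h => h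
    have hv4 : s4.arr aOrd i < n := hst4.ord_lt i hin
    have n4 : s4.arr aNear = s3.arr aNear := hF4.arr aNear
    have tx4 : s4.arr aTX = s3.arr aTX := hF4.arr aTX
    have ty4 : s4.arr aTY = s3.arr aTY := hF4.arr aTY
    refine ((thetaCmd_ok hd s4 ((hF4.var rN).trans hN3) hV4 hv4 hin.le hst4).seq (B' := n * 20 + 8)
      fun s5 hF5 h5 => ?_).mono (by omega) fun _ _ h => h
    obtain ⟨x, hx, y, hy, hTx, hTy, hle, u0, hu0, hu1, hu2⟩ := h5
    have o5 : s5.arr aOrd = s4.arr aOrd := hF5.arr aOrd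
    have n5 : s5.arr aNear = s4.arr aNear := hF5.arr aNear
    refine (updCmd_ok (n := n) (i := i) s5 (((hF5.var rN).trans (hF4.var rN)).trans hN3)
      (by rw [o5, ← hV4]; exact hF5.var rV) (by rw [o5, n5]; exact hst4)).mono le_rfl ?_
    intro s6 hF6 hst6
    simp only [Store.setVar_arr]
    refine ⟨hst6, ?_⟩
    have o6 : s6.arr aOrd = s4.arr aOrd := (hF6.arr aOrd).trans o5
    have tx6 : s6.arr aTX = s5.arr aTX := hF6.arr aTX
    have ty6 : s6.arr aTY = s5.arr aTY := hF6.arr aTY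
    rw [o6, tx6, ty6]
    rw [tx4] at hTx
    rw [ty4] at hTy
    have hne : ∀ b < i, s4.arr aOrd b ≠ s4.arr aOrd i := fun b hb he => by
      have := hst4.ord_inj b (by omega) i hin he
      omega
    have hold : ∀ r, ∀ b < i, InM d (s5.arr aTX) (s5.arr aTY) r (s4.arr aOrd b) ↔
        InM d (s3.arr aTX) (s3.arr aTY) r (s3.arr aOrd b) := fun r b hb => by
      rw [InM, InM, hTx, hTy, if_neg (hne b hb), if_neg (hne b hb), hpre b hb]
    refine ⟨fun v hv => ?_, fun a b u hab hb hu => ?_, fun r => ?_⟩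
    · rw [hTx, hTy]
      split
      · exact ⟨hx, hy⟩
      · exact hlt v hv
    · rcases Nat.lt_succ_iff_lt_or_eq.1 hb with h | h
      · rw [hTx, hTy, if_neg (hne b h), if_neg (hne b h), hpre b h, hpre a (hab.trans h)]
        exact hsep a b u hab h hu
      · subst h
        rw [hTx, hTy, if_pos rfl, if_pos rfl]
        exact (hle u hu).trans (max_le_max le_rfl (hst4.near_le u hu a hab))
    -- Either all chosen nodes are in the set at r, or those already in it cover all nodes. The
    -- second alternative persists; the switch to it happens at the first node that drops out.
    · rcases hcov r with h | h
      · by_cases hi : InM d (s5.arr aTX) (s5.arr aTY) r (s4.arr aOrd i)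
        · left
          intro b hb
          rcases Nat.lt_succ_iff_lt_or_eq.1 hb with h' | h'
          · exact (hold r b h').2 (h b h')
          · rw [h']; exact hi
        · right
          have hxy : d x y ≤ r := by
            rw [InM, not_not, hTx, hTy, if_pos rfl, if_pos rfl] at hi
            exact hi.2
          have hnu := hst4.near_lt hin.le hu0
          -- The witness `u0` is within r of both the new node and an earlier one, so the new node
          -- is within 2r of the earlier nodes. As it was the farthest from them, so is every
          -- remaining node.
          have hvr : d (s4.arr aOrd i) (s4.arr aNear (s4.arr aOrd i)) ≤ 2 * r := by
            obtain ⟨j, hj, he⟩ := hst4.near_mem u0 hu0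
            have h7 := hst4.near_le _ hv4 j hj
            rw [he] at hu2 hnu
            have h8 := hd.tri _ _ _ hv4 hu0 hnu
            linarith
          intro v hv
          by_cases hvi : ∃ l, i ≤ l ∧ l < n ∧ s4.arr aOrd l = v
          · obtain ⟨l, hl, hl', rfl⟩ := hvi
            obtain ⟨j, hj, he⟩ := hst4.near_mem _ hv
            refine ⟨j, by omega, (hold r j hj).2 (h j hj), ?_⟩
            rw [← he]
            have h9 := hbest l hl hl'
            simp only [Better, if_true, ← n4] at h9
            exact h9.trans hvr
          · obtain ⟨l, hl, rfl⟩ := hst4.surj hv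
            have hli : l < i := by
              by_contra h'
              exact hvi ⟨l, by omega, hl, rfl⟩
            refine ⟨l, by omega, (hold r l hli).2 (h l hli), ?_⟩
            rw [hd.self]
            have := hd.nonneg hv4 (hst4.near_lt hin.le hv4)
            linarith
      · right
        intro v hv
        obtain ⟨a, ha, h1, h2⟩ := h v hv
        exact ⟨a, by omega, (hold r a ha).2 h1, by rw [hpre a ha]; exact h2⟩
  · intro s' _ ⟨hst, hlt, hsep, hcov⟩
    refine ⟨hlt, fun r => ⟨?_, fun v hv => ?_⟩⟩
    · have key : ∀ a b u, a < b → b < n → u < n →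
          InM d (s'.arr aTX) (s'.arr aTY) r (s'.arr aOrd b) →
          d (s'.arr aOrd a) u ≤ r → d (s'.arr aOrd b) u ≤ r → False := by
        intro a b u hab hb hu hM ha hb'
        refine hM ⟨?_, (hsep a b u hab hb hu).trans (max_le hb' (by rwa [hd.symm]))⟩
        by_contra h0
        have : b = 0 := hst.ord_inj b hb 0 hn (by rw [hst.ord_zero]; omega)
        omega
      intro v hv w hw hMv hMw u hu hvu hwu
      obtain ⟨a, ha, rfl⟩ := hst.surj hv
      obtain ⟨b, hb, rfl⟩ := hst.surj hw
      rcases lt_trichotomy a b with h | h | h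
      · exact (key a b u h hb hu hMw hvu hwu).elim
      · rw [h]
      · exact (key b a u h ha hu hMv hwu hvu).elim
    · rcases hcov r with h | h
      · obtain ⟨a, ha, rfl⟩ := hst.surj hv
        exact ⟨_, hv, h a ha, fun hr => by rw [hd.self]; linarith⟩
      · obtain ⟨a, ha, h1, h2⟩ := h v hv
        exact ⟨_, hst.ord_lt a ha, h1, fun _ => h2⟩

/-! ### Connected components: the nearest-first order -/

/-- The nearest-first order, with the parents of the nodes. -/
def nearCmd : Cmd :=
  .seq resetCmd (.seq (.assign rI (.const 1))
    (.up rI (.seq (pickCmd false)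
      (.seq (.write aPar (.var rV) (.read aNear (.var rV))) updCmd))))

/-- `ord` enumerates the nodes below `n`, starting with `0`, and the parent `par v` of every other
node `v` comes before it. The distance of `v` to its parent is at most the distance of any two nodes
of which one comes before `v` and the other does not. -/
structure Spanning (n : ℕ) (d : ℕ → ℕ → ℝ) (ord par : ℕ → ℕ) : Prop where
  lt : ∀ l < n, ord l < n
  inj : ∀ l < n, ∀ l' < n, ord l = ord l' → l = l'
  surj : ∀ v < n, ∃ l < n, ord l = v
  zero : ord 0 = 0
  par_lt : ∀ v < n, par v < n
  par_zero : par 0 = 0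
  par_mem : ∀ b, 0 < b → b < n → ∃ j < b, par (ord b) = ord j
  par_le : ∀ a b l, a < b → b ≤ l → l < n → d (ord b) (par (ord b)) ≤ d (ord l) (ord a)

/-- Prim's algorithm: the node chosen next has the shortest edge to the prefix, and its parent is
the end of that edge. -/
theorem nearCmd_ok {n : ℕ} {d : ℕ → ℕ → ℝ} (hn : 0 < n) (s : Store)
    (hs : s.var rN = n) (hpar : ∀ v, s.arr aPar v = 0) :
    Ok d nearCmd s (n * (n * 45 + 78) + n * 16 + 16)
      (fun s' => Spanning n d (s'.arr aOrd) (s'.arr aPar)) := by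
  refine ((resetCmd_ok hn s hs).seq (B' := n * (n * 45 + 78) + 8) fun s1 hF1 hst1 => ?_).mono
    (by omega) fun _ _ h => h
  have h2 : Ok d (.assign rI (.const 1)) s1 2 (fun s' => s'.var rI = 1) := by
    refine (Ok.of_wp ?_).mono (B := Cmd.bound _) (by decide) fun _ _ h => h
    simp [Cmd.wp, Exp.eval]
  refine (h2.seq (B' := n * (n * 45 + 78) + 6) fun s2 hF2 h2 => ?_).mono
    (by omega) fun _ _ h => h
  have e1 : s2.arr aOrd = s1.arr aOrd := hF2.arr aOrd
  have e2 : s2.arr aNear = s1.arr aNear := hF2.arr aNear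
  have e3 : s2.arr aPar = s.arr aPar := (hF2.arr aPar).trans (hF1.arr aPar)
  have e5 : s2.var rN = n := ((hF2.var rN).trans (hF1.var rN)).trans hs
  refine (Ok.up (n := n) (T := n * 45 + 68) (fun i s' => Stage n d i (s'.arr aOrd) (s'.arr aNear) ∧
    (∀ v < n, s'.arr aPar v < n) ∧ s'.arr aPar 0 = 0 ∧
    (∀ b, 0 < b → b < i → ∃ j < b, s'.arr aPar (s'.arr aOrd b) = s'.arr aOrd j) ∧
    ∀ a b l, a < b → b < i → b ≤ l → l < n → d (s'.arr aOrd b) (s'.arr aPar (s'.arr aOrd b)) ≤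
      d (s'.arr aOrd l) (s'.arr aOrd a)) rfl rfl e5 h2 hn ?_ ?_).mono le_rfl ?_
  · rw [e1, e2, e3]
    exact ⟨hst1, fun v hv => by rw [hpar]; exact hn, hpar 0, fun b hb hb' => by omega,
      fun a b l hab hb => by omega⟩
  · intro i s3 hi0 hin hF3 hI3 ⟨hst, hlt, hzero, hmem, hle⟩
    have hN3 : s3.var rN = n := (hF3.var rN).trans e5
    refine ((pickCmd_ok false s3 hN3 hI3 hi0 hin hst).seq (B' := n * 20 + 18)
      fun s4 hF4 ⟨hst4, hV4, hpre, hsuf, hbest⟩ => ?_).mono (by omega) fun _ _ h => h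
    have hv4 : s4.arr aOrd i < n := hst4.ord_lt i hin
    have n4 : s4.arr aNear = s3.arr aNear := hF4.arr aNear
    have p4 : s4.arr aPar = s3.arr aPar := hF4.arr aPar
    have h5 : Ok d (.write aPar (.var rV) (.read aNear (.var rV))) s4 10 (fun s' =>
        ∀ w, s'.arr aPar w = if w = s4.arr aOrd i then s4.arr aNear w else s3.arr aPar w) := by
      refine (Ok.of_wp ?_).mono (B := Cmd.bound _) (by decide) fun _ _ h => h
      simp only [Cmd.wp, Exp.eval, hV4, Store.setArr_arr_apply, true_and, p4]
      intro w
      by_cases hw : w = s4.arr aOrd i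
      · rw [if_pos hw, if_pos hw, hw]
      · rw [if_neg hw, if_neg hw]
    refine (h5.seq (B' := n * 20 + 8) fun s5 hF5 hp => ?_).mono (by omega) fun _ _ h => h
    have o5 : s5.arr aOrd = s4.arr aOrd := hF5.arr aOrd
    have n5 : s5.arr aNear = s4.arr aNear := hF5.arr aNear
    refine (updCmd_ok (n := n) (i := i) s5 (((hF5.var rN).trans (hF4.var rN)).trans hN3)
      (by rw [o5, ← hV4]; exact hF5.var rV) (by rw [o5, n5]; exact hst4)).mono le_rfl ?_
    intro s6 hF6 hst6
    simp only [Store.setVar_arr]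
    refine ⟨hst6, ?_⟩
    have o6 : s6.arr aOrd = s4.arr aOrd := (hF6.arr aOrd).trans o5
    have p6 : s6.arr aPar = s5.arr aPar := hF6.arr aPar
    rw [o6, p6]
    have hne : ∀ b < i, s4.arr aOrd b ≠ s4.arr aOrd i := fun b hb he => by
      have := hst4.ord_inj b (by omega) i hin he
      omega
    refine ⟨fun v hv => ?_, ?_, fun b hb0 hb => ?_, fun a b l hab hb hbl hl => ?_⟩
    · rw [hp]
      split
      · exact hst4.near_lt hin.le hv
      · exact hlt v hv
    · rw [hp, if_neg (by rw [← hst4.ord_zero]; exact hne 0 hi0), hzero]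
    · rcases Nat.lt_succ_iff_lt_or_eq.1 hb with h | h
      · obtain ⟨j, hj, he⟩ := hmem b hb0 h
        exact ⟨j, hj, by rw [hp, if_neg (hne b h), hpre b h, hpre j (by omega), he]⟩
      · subst h
        rw [hp, if_pos rfl]
        exact hst4.near_mem _ hv4
    · rcases Nat.lt_succ_iff_lt_or_eq.1 hb with h | h
      · rw [hp, if_neg (hne b h), hpre b h, hpre a (hab.trans h)]
        rcases lt_or_ge l i with hli | hli
        · rw [hpre l hli]
          exact hle a b l hab h hbl hl
        -- The swap may have moved this node, but only from another unchosen position, where the old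
        -- bound applies.
        · obtain ⟨l', h1, h2, h3⟩ := hsuf l hli hl
          rw [h3]
          exact hle a b l' hab h (by omega) h2
      · subst h
        rw [hp, if_pos rfl]
        have h9 := hbest l hbl hl
        simp only [Better, ← n4] at h9
        exact h9.trans (hst4.near_le _ (hst4.ord_lt l hl) a hab)
  · intro s' _ ⟨hst, hlt, hzero, hmem, hle⟩
    exact ⟨hst.ord_lt, hst.ord_inj, fun v hv => hst.surj hv, hst.ord_zero, hlt, hzero,
      hmem, fun a b l hab hbl hl => hle a b l hab (by omega) hbl hl⟩

/-! ### Nearest nodes of another label -/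

/-- For every node `v`, find the nearest node whose label is not the default parity of `v`. -/
def labelCmd : Cmd :=
  .for rV (.seq
    (.ite (.and (.le (.read aLab (.var rV)) (.const 1)) (.le (.const 1) (.read aLab (.var rV))))
      (.assign rT (.const 1)) (.assign rT (.const 0)))
    (.for rU (.ite
      (.and (.not (.and (.le (.read aLab (.var rU)) (.var rT)) (.le (.var rT) (.read aLab (.var rU)))))
        (.not (.and (.le (.const 1) (.read aHw (.var rV)))
          (.distLe (.var rV) (.read aWl (.var rV)) (.var rV) (.var rU)))))
      (.seq (.write aWl (.var rV) (.var rU)) (.write aHw (.var rV) (.const 1))) .skip)))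

/-- `wl v` is the nearest node whose label is not the default parity of `v`, provided that there is
one, which is indicated by `hw v`. -/
structure OtherLabel (n : ℕ) (d : ℕ → ℕ → ℝ) (lab wl hw : ℕ → ℕ) (v : ℕ) (m : ℕ) : Prop where
  lt : wl v < n
  ne : 1 ≤ hw v → lab (wl v) ≠ target (lab v)
  le : ∀ u < m, lab u ≠ target (lab v) → 1 ≤ hw v ∧ d v (wl v) ≤ d v u

theorem OtherLabel.congr {n : ℕ} {d : ℕ → ℕ → ℝ} {lab wl hw wl' hw' : ℕ → ℕ} {v m : ℕ}
    (h : OtherLabel n d lab wl hw v m) (h1 : wl' v = wl v) (h2 : hw' v = hw v) :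
    OtherLabel n d lab wl' hw' v m := by
  obtain ⟨a, b, c⟩ := h
  constructor <;> rw [h1] <;> try rw [h2]
  all_goals assumption

/-- The flag `hw` is needed because the default value 0 of `wl` is a genuine node. In exchange `wl
v` is always a node, so its distance to v is a legitimate candidate threshold even when no other
label occurs. -/
theorem labelCmd_ok {n : ℕ} {d : ℕ → ℕ → ℝ} (hn : 0 < n) (s : Store)
    (hs : s.var rN = n) (hwl : ∀ v, s.arr aWl v = 0) (hhw : ∀ v, s.arr aHw v = 0) :
    Ok d labelCmd s (n * (n * 50 + 40) + 8)
      (fun s' => ∀ v < n, OtherLabel n d (s.arr aLab) (s'.arr aWl) (s'.arr aHw) v n) := by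
  refine (Ok.for (n := n) (T := n * 50 + 30) (fun i s' =>
    (∀ v < i, OtherLabel n d (s.arr aLab) (s'.arr aWl) (s'.arr aHw) v n) ∧
    ∀ v, i ≤ v → s'.arr aWl v = 0 ∧ s'.arr aHw v = 0) rfl rfl hs
    ⟨fun v hv => absurd hv (Nat.not_lt_zero v), fun v _ => ⟨hwl v, hhw v⟩⟩ ?_).mono le_rfl
    fun _ _ h => h.1
  intro i s1 hi hF1 hV1 ⟨hdone, htodo⟩
  have lab1 : s1.arr aLab = s.arr aLab := hF1.arr aLab
  have h2 : Ok d (.ite (.and (.le (.read aLab (.var rV)) (.const 1))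
      (.le (.const 1) (.read aLab (.var rV))))
      (.assign rT (.const 1)) (.assign rT (.const 0))) s1 20
      (fun s' => s'.var rT = target (s.arr aLab i)) := by
    refine (Ok.of_wp ?_).mono (B := Cmd.bound _) (by decide) fun _ _ h => h
    simp only [rV] at hV1
    simp only [Cmd.wp, Test.Holds, Exp.eval, rV, hV1, lab1, target]
    constructor
    · intro h
      rw [if_pos (le_antisymm h.1 h.2)]; simp
    · intro h
      rw [if_neg (fun h' => h ⟨h'.le, h'.ge⟩)]; simp
  refine (h2.seq (B' := n * 50 + 8) fun s2 hF2 h2 => ?_).mono (by omega) fun _ _ h => h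
  have lab2 : s2.arr aLab = s.arr aLab := (hF2.arr aLab).trans lab1
  have wl2 : s2.arr aWl = s1.arr aWl := hF2.arr aWl
  have hw2 : s2.arr aHw = s1.arr aHw := hF2.arr aHw
  have hV2 : s2.var rV = i := (hF2.var rV).trans hV1
  refine (Ok.for (n := n) (T := 40) (fun m s' =>
    (∀ v, v ≠ i → s'.arr aWl v = s1.arr aWl v ∧ s'.arr aHw v = s1.arr aHw v) ∧
    OtherLabel n d (s.arr aLab) (s'.arr aWl) (s'.arr aHw) i m) rfl rfl
    (((hF2.var rN).trans (hF1.var rN)).trans hs) ?_ ?_).mono le_rfl ?_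
  · simp only [Store.setVar_arr, wl2, hw2]
    refine ⟨fun v _ => ⟨trivial, trivial⟩, ?_, fun h => ?_, fun u hu => absurd hu (Nat.not_lt_zero u)⟩
    · rw [(htodo i le_rfl).1]; exact hn
    · rw [(htodo i le_rfl).2] at h; omega
  · intro m s3 hm hF3 hU3 ⟨hoth, hol⟩
    have lab3 : s3.arr aLab = s.arr aLab := (hF3.arr aLab).trans lab2
    have hV3 : s3.var rV = i := (hF3.var rV).trans hV2
    have hT3 : s3.var rT = target (s.arr aLab i) := (hF3.var rT).trans h2
    refine (Ok.of_wp ?_).mono (B := Cmd.bound _) (by decide) fun _ _ h => h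
    simp only [rU, rV, rT, aLab] at hU3 hV3 hT3 lab3
    simp only [Cmd.wp, Test.Holds, Exp.eval, rU, rV, rT, hU3, hV3, hT3, aLab, lab3]
    have heq : ∀ a b : ℕ, (a ≤ b ∧ b ≤ a) ↔ a = b := fun a b => by omega
    simp only [heq, Store.setVar_arr]
    constructor
    · rintro ⟨hne, hlt⟩
      refine ⟨fun v hv => ?_, ?_, ?_, ?_⟩
      · simpa [hv, hV3] using hoth v hv
      · simpa using hm
      · intro _
        simpa using hne
      · intro u hu hu'
        simp only [Store.setArr_arr_apply, Store.setArr_var, hV3]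
        refine ⟨by simp, ?_⟩
        simp only [and_self, if_true, aWl, aHw, Nat.reduceEqDiff, false_and, if_false]
        rcases Nat.lt_succ_iff_lt_or_eq.1 hu with h | h
        · have := hol.le u h hu'
          by_contra hcon
          exact hlt ⟨this.1, this.2.trans (not_le.1 hcon).le⟩
        · rw [h]
    · intro hnot
      refine ⟨hoth, hol.lt, hol.ne, fun u hu hu' => ?_⟩
      rcases Nat.lt_succ_iff_lt_or_eq.1 hu with h | h
      · exact hol.le u h hu'
      · subst h
        by_contra hcon
        exact hnot ⟨hu', hcon⟩
  · intro s3 _ ⟨hoth, hol⟩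
    simp only [Store.setVar_arr]
    refine ⟨fun v hv => ?_, fun v hv => ?_⟩
    · rcases Nat.lt_succ_iff_lt_or_eq.1 hv with h | h
      · exact (hdone v h).congr (hoth v (by omega)).1 (hoth v (by omega)).2
      · rw [h]; exact hol
    · rw [(hoth v (by omega)).1, (hoth v (by omega)).2]
      exact htodo v (by omega)

/-! ### The test of a threshold -/

/-- The labels and the results of the preprocessing. -/
structure Arrays where
  lab : ℕ → ℕ
  ord : ℕ → ℕ
  par : ℕ → ℕ
  tx : ℕ → ℕ
  ty : ℕ → ℕ
  wl : ℕ → ℕ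
  hw : ℕ → ℕ

/-- The specification of the preprocessing. -/
structure Data (n : ℕ) (d : ℕ → ℕ → ℝ) (a : Arrays) : Prop where
  pos : 0 < n
  metric : IsMetric n d
  lab_le : ∀ v < n, a.lab v ≤ 2
  span : Spanning n d a.ord a.par
  t_lt : ∀ v < n, a.tx v < n ∧ a.ty v < n
  sep : ∀ r, Separated n d r (InM d a.tx a.ty r)
  cover : ∀ r, 0 ≤ r → ∀ v < n, ∃ m < n, InM d a.tx a.ty r m ∧ d v m ≤ 2 * r
  other : ∀ v < n, OtherLabel n d a.lab a.wl a.hw v n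

noncomputable instance (d : ℕ → ℕ → ℝ) (tx ty : ℕ → ℕ) (r : ℝ) : DecidablePred (InM d tx ty r) :=
  Classical.decPred _

/-- `v` is the first node of its component at threshold `r`. -/
def IsStart (d : ℕ → ℕ → ℝ) (a : Arrays) (r : ℝ) (v : ℕ) : Prop := ¬ (1 ≤ v ∧ d v (a.par v) ≤ r)

/-- There is a node near `v` whose label is not the default parity of `v`. -/
def HasOther (d : ℕ → ℕ → ℝ) (a : Arrays) (r : ℝ) (v : ℕ) : Prop := 1 ≤ a.hw v ∧ d v (a.wl v) ≤ r

/-- The separated set at threshold `r`. -/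
abbrev Sep (d : ℕ → ℕ → ℝ) (a : Arrays) (r : ℝ) : ℕ → Prop := InM d a.tx a.ty r

/-- All candidate distances compare in the same way with `ρ` and with `r`. -/
def Agree (n : ℕ) (d : ℕ → ℕ → ℝ) (a : Arrays) (ρ r : ℝ) : Prop :=
  ∀ v < n, (d v (a.par v) ≤ r ↔ d v (a.par v) ≤ ρ) ∧ (d (a.tx v) (a.ty v) ≤ r ↔ d (a.tx v) (a.ty v) ≤ ρ) ∧
    (d v (a.wl v) ≤ r ↔ d v (a.wl v) ≤ ρ)

/-- The center `rep v` of the cluster of `v` is as it should be: `isc v` says whether there is a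
cluster of `v`, and `1 - z v` is the parity of the number of nodes to be assigned to it. -/
structure Local (n : ℕ) (d : ℕ → ℕ → ℝ) (a : Arrays) (ρ : ℝ) (rep isc z : ℕ → ℕ) (v : ℕ) : Prop where
  isc_le : isc v ≤ 1
  z_le : z v ≤ 1
  isc_eq : Sep d a ρ v → isc v = 1
  z_eq : isc v = 0 → z v = 1
  rep_lt : rep v < n
  rep_dist : d v (rep v) ≤ ρ
  rep_self : ¬ Sep d a ρ v → rep v = v
  rep_lab : isc v = 1 → a.lab (rep v) = 2 ∨ a.lab (rep v) + z v = 1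

theorem Local.congr {n : ℕ} {d : ℕ → ℕ → ℝ} {a : Arrays} {ρ : ℝ} {rep isc z rep' isc' z' : ℕ → ℕ}
    {v : ℕ} (h : Local n d a ρ rep isc z v) (h1 : rep' v = rep v) (h2 : isc' v = isc v)
    (h3 : z' v = z v) : Local n d a ρ rep' isc' z' v := by
  obtain ⟨p1, p2, p3, p4, p5, p6, p7, p8⟩ := h
  constructor <;> simp only [h1, h2, h3] <;> assumption

/-- The positions from `l` on have been visited, and of these the ones from `e` on
belong to completed components. -/
structure Scan (n : ℕ) (d : ℕ → ℕ → ℝ) (a : Arrays) (ρ : ℝ) (m l e : ℕ) (rep isc z : ℕ → ℕ)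
    (cnt fail par free paid : ℕ) : Prop where
  le : l ≤ e
  le_n : e ≤ n
  start : e < n → IsStart d a ρ (a.ord e)
  no_start : ∀ i, m ≤ i → i < e → ¬ IsStart d a ρ (a.ord i)
  loc : ∀ i, l ≤ i → i < n → Local n d a ρ rep isc z (a.ord i)
  opn : ∀ i, l ≤ i → i < e → rep (a.ord i) = a.ord i ∧
    isc (a.ord i) = (if Sep d a ρ (a.ord i) then 1 else 0) ∧
    z (a.ord i) = defect a.lab (Sep d a ρ) (a.ord i)
  inj : ∀ i j, l ≤ i → i < n → l ≤ j → j < n → isc (a.ord i) = 1 → isc (a.ord j) = 1 →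
    rep (a.ord i) = rep (a.ord j) → i = j
  par_eq : par = (∑ i ∈ Finset.Ico l e, z (a.ord i)) % 2
  free_eq : (free = 0 ∧ ∀ i, l ≤ i → i < e → Sep d a ρ (a.ord i) → ¬ HasOther d a ρ (a.ord i)) ∨
    ∃ i, l ≤ i ∧ i < e ∧ free = a.ord i + 1 ∧ Sep d a ρ (a.ord i) ∧ HasOther d a ρ (a.ord i)
  paid_eq : (paid = 0 ∧ ∀ i, l ≤ i → i < e → ¬ Sep d a ρ (a.ord i) → a.lab (a.ord i) = 0) ∨
    ∃ i, l ≤ i ∧ i < e ∧ paid = a.ord i + 1 ∧ ¬ Sep d a ρ (a.ord i) ∧ a.lab (a.ord i) ≠ 0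
  cnt_eq : cnt = ∑ i ∈ Finset.Ico l n, isc (a.ord i)
  even : fail = 0 → ∀ b, e ≤ b → b < n → IsStart d a ρ (a.ord b) →
    Even (∑ i ∈ Finset.Ico b n, z (a.ord i))
  lower : ∀ r S σ, Agree n d a ρ r → Sol n a.lab d r S σ → fail = 0 ∧
    ∑ i ∈ Finset.Ico e n, isc (a.ord i) ≤ ∑ i ∈ Finset.Ico e n, if a.ord i ∈ S then 1 else 0

/-! ### Invariance of the scan: visiting a node and completing a component. -/

section scan

variable {n : ℕ} {d : ℕ → ℕ → ℝ} {a : Arrays} {ρ r : ℝ} {l e : ℕ} {rep isc z rep' isc' z' : ℕ → ℕ}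
  {cnt fail par free paid : ℕ}

theorem Data.ord_ne (h : Data n d a) {i j : ℕ} (hi : i < n) (hj : j < n) (hij : i ≠ j) :
    a.ord i ≠ a.ord j := fun he => hij (h.span.inj i hi j hj he)

/-- Nodes of different components are at distance greater than `ρ`. -/
theorem Data.cross (h : Data n d a) {e i j : ℕ} (hs : IsStart d a ρ (a.ord e)) (hi : i < e)
    (hj : e ≤ j) (hjn : j < n) : ρ < d (a.ord j) (a.ord i) := by
  have h0 : 1 ≤ a.ord e := by
    have := h.ord_ne (i := e) (j := 0) (by omega) h.pos (by omega)
    rw [h.span.zero] at this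
    omega
  -- By `par_le`, every edge across a start is at least as long as the parent edge of the start,
  -- which exceeds the threshold.
  have h1 : ρ < d (a.ord e) (a.par (a.ord e)) := by
    by_contra h2
    exact hs ⟨h0, not_lt.1 h2⟩
  exact h1.trans_le (h.span.par_le i e j hi hj hjn)

theorem Agree.sep (hA : Agree n d a ρ r) {v : ℕ} (hv : v < n) : Sep d a r v ↔ Sep d a ρ v := by
  unfold Sep InM
  rw [(hA v hv).2.1]

theorem Agree.isStart (hA : Agree n d a ρ r) {v : ℕ} (hv : v < n) :
    IsStart d a r v ↔ IsStart d a ρ v := by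
  unfold IsStart
  rw [(hA v hv).1]

theorem Agree.separated (h : Data n d a) (hA : Agree n d a ρ r) : Separated n d r (Sep d a ρ) :=
  fun v hv w hw hv' hw' => h.sep r v hv w hw ((hA.sep hv).2 hv') ((hA.sep hw).2 hw')

theorem Sol.nonneg {lab : ℕ → ℕ} {S : Finset ℕ} {σ : ℕ → ℕ} (h : Sol n lab d r S σ)
    (hd : IsMetric n d) (hn : 0 < n) : 0 ≤ r :=
  (hd.nonneg hn (h.lt _ (h.mem 0 hn))).trans (h.dist 0 hn)

/-- The visited node joins the open component with its default data. Its position may turn out to be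
a start, so the absence of starts is claimed only from l + 1 on; this is why `Scan` has the
parameter m besides l. The flip candidates `free` and `paid` are stored as node plus one, so that 0
means none. -/
theorem Scan.visit (h : Data n d a) (hρ : 0 ≤ ρ) {v cnt' par' free' paid' : ℕ}
    (hS : Scan n d a ρ (l + 1) (l + 1) e rep isc z cnt fail par free paid) (hl : l < n)
    (hv : v = a.ord l)
    (hrep : ∀ w, rep' w = if w = v then v else rep w)
    (hisc : ∀ w, isc' w = if w = v then (if Sep d a ρ v then 1 else 0) else isc w)
    (hz : ∀ w, z' w = if w = v then defect a.lab (Sep d a ρ) v else z w)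
    (hcnt : cnt' = cnt + if Sep d a ρ v then 1 else 0)
    (hpar : par' = if z' v = 0 then par else 1 - par)
    (hfree : free' = v + 1 ∧ Sep d a ρ v ∧ HasOther d a ρ v ∨
      free' = free ∧ ¬ (Sep d a ρ v ∧ HasOther d a ρ v))
    (hpaid : paid' = v + 1 ∧ ¬ Sep d a ρ v ∧ a.lab v ≠ 0 ∨
      paid' = paid ∧ ¬ (¬ Sep d a ρ v ∧ a.lab v ≠ 0)) :
    Scan n d a ρ (l + 1) l e rep' isc' z' cnt' fail par' free' paid' := by
  have hvn : v < n := by rw [hv]; exact h.span.lt l hl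
  have hne : ∀ i, l + 1 ≤ i → i < n → a.ord i ≠ v := fun i hi hin => by
    rw [hv]; exact h.ord_ne hin hl (by omega)
  have r1 : rep' v = v := by rw [hrep, if_pos rfl]
  have i1 : isc' v = if Sep d a ρ v then 1 else 0 := by rw [hisc, if_pos rfl]
  have z1 : z' v = defect a.lab (Sep d a ρ) v := by rw [hz, if_pos rfl]
  have r2 : ∀ i, l + 1 ≤ i → i < n → rep' (a.ord i) = rep (a.ord i) := fun i hi hin => by
    rw [hrep, if_neg (hne i hi hin)]
  have i2 : ∀ i, l + 1 ≤ i → i < n → isc' (a.ord i) = isc (a.ord i) := fun i hi hin => by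
    rw [hisc, if_neg (hne i hi hin)]
  have z2 : ∀ i, l + 1 ≤ i → i < n → z' (a.ord i) = z (a.ord i) := fun i hi hin => by
    rw [hz, if_neg (hne i hi hin)]
  have hle := hS.le
  have hen := hS.le_n
  have si : ∀ b, l + 1 ≤ b → ∀ c, c ≤ n → ∑ i ∈ Finset.Ico b c, isc' (a.ord i) =
      ∑ i ∈ Finset.Ico b c, isc (a.ord i) := fun b hb c hc =>
    Finset.sum_congr rfl fun i hi => by rw [Finset.mem_Ico] at hi; exact i2 i (by omega) (by omega)
  have sz : ∀ b, l + 1 ≤ b → ∀ c, c ≤ n → ∑ i ∈ Finset.Ico b c, z' (a.ord i) =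
      ∑ i ∈ Finset.Ico b c, z (a.ord i) := fun b hb c hc =>
    Finset.sum_congr rfl fun i hi => by rw [Finset.mem_Ico] at hi; exact z2 i (by omega) (by omega)
  have hdef : defect a.lab (Sep d a ρ) v ≤ 1 := by unfold defect; split <;> simp
  -- In the open component every node still represents itself; in a completed one the center is
  -- within the threshold of its cluster node, hence not in the component of v.
  have hinj : ∀ j, l + 1 ≤ j → j < n → isc (a.ord j) = 1 → rep (a.ord j) ≠ v := by
    intro j hj hjn hj1 he
    rcases lt_or_ge j e with h1 | h1
    · rw [(hS.opn j hj h1).1] at he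
      exact hne j hj hjn he
    · have h2 := (hS.loc j hj hjn).rep_dist
      rw [he, hv] at h2
      exact absurd h2 (not_le.2 (h.cross (hS.start (by omega)) (by omega) h1 hjn))
  refine ⟨by omega, hen, hS.start, hS.no_start, fun i hi hin => ?_, fun i hi hie => ?_,
    fun i j hi hin hj hjn h1 h2 h3 => ?_, ?_, ?_, ?_, ?_, fun hf b hb hbn hbs => ?_,
    fun r S σ hA hsol => ?_⟩
  · rcases hi.eq_or_lt with rfl | hi'
    · rw [← hv]
      refine ⟨by rw [i1]; split <;> simp, by rw [z1]; exact hdef, fun hM => by rw [i1, if_pos hM],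
        fun hi0 => ?_, by rw [r1]; exact hvn, by rw [r1, h.metric.self]; exact hρ, fun _ => r1,
        fun hi1 => ?_⟩
      · have : ¬ Sep d a ρ v := fun hM => by rw [i1, if_pos hM] at hi0; omega
        rw [z1, defect, if_neg (fun hh => this hh.1)]
      · have hM : Sep d a ρ v := by
          by_contra hM
          rw [i1, if_neg hM] at hi1; omega
        rw [r1, z1, defect]
        have := h.lab_le v hvn
        simp only [hM, true_and]
        split <;> omega
    · exact (hS.loc i hi' hin).congr (r2 i hi' hin) (i2 i hi' hin) (z2 i hi' hin)
  · rcases hi.eq_or_lt with rfl | hi'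
    · rw [← hv]; exact ⟨r1, i1, z1⟩
    · rw [r2 i hi' (by omega), i2 i hi' (by omega), z2 i hi' (by omega)]
      exact hS.opn i hi' hie
  · rcases hi.eq_or_lt with rfl | hi'
    · rcases hj.eq_or_lt with rfl | hj'
      · rfl
      · rw [← hv, r1, r2 j hj' hjn] at h3
        rw [i2 j hj' hjn] at h2
        exact absurd h3.symm (hinj j hj' hjn h2)
    · rcases hj.eq_or_lt with rfl | hj'
      · rw [← hv, r1, r2 i hi' hin] at h3
        rw [i2 i hi' hin] at h1
        exact absurd h3 (hinj i hi' hin h1)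
      · rw [r2 i hi' hin, r2 j hj' hjn] at h3
        rw [i2 i hi' hin] at h1
        rw [i2 j hj' hjn] at h2
        exact hS.inj i j hi' hin hj' hjn h1 h2 h3
  · rw [hpar, Finset.sum_eq_sum_Ico_succ_bot (by omega), sz _ le_rfl _ hen, ← hv]
    have := hS.par_eq
    rw [← z1] at hdef
    split
    · omega
    · omega
  · rcases hfree with ⟨h1, h2, h3⟩ | ⟨h1, h2⟩
    · right
      exact ⟨l, le_rfl, by omega, by rw [← hv]; exact h1, by rw [← hv]; exact h2,
        by rw [← hv]; exact h3⟩
    · rcases hS.free_eq with ⟨h3, h4⟩ | ⟨i, h3, h4, h5⟩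
      · left
        refine ⟨h1.trans h3, fun i hi hie => ?_⟩
        rcases hi.eq_or_lt with rfl | hi'
        · rw [← hv]; exact fun h5 h6 => h2 ⟨h5, h6⟩
        · exact h4 i hi' hie
      · right
        exact ⟨i, by omega, h4, by rw [h1]; exact h5⟩
  · rcases hpaid with ⟨h1, h2, h3⟩ | ⟨h1, h2⟩
    · right
      exact ⟨l, le_rfl, by omega, by rw [← hv]; exact h1, by rw [← hv]; exact h2,
        by rw [← hv]; exact h3⟩
    · rcases hS.paid_eq with ⟨h3, h4⟩ | ⟨i, h3, h4, h5⟩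
      · left
        refine ⟨h1.trans h3, fun i hi hie => ?_⟩
        rcases hi.eq_or_lt with rfl | hi'
        · rw [← hv]; intro h5; by_contra h6; exact h2 ⟨h5, h6⟩
        · exact h4 i hi' hie
      · right
        exact ⟨i, by omega, h4, by rw [h1]; exact h5⟩
  · rw [Finset.sum_eq_sum_Ico_succ_bot hl, si _ le_rfl _ le_rfl, ← hv, i1, hcnt, hS.cnt_eq, add_comm]
  · rw [sz b (by omega) n le_rfl]
    exact hS.even hf b hb hbn hbs
  · rw [si e (by omega) n le_rfl]
    exact hS.lower r S σ hA hsol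

/-- The nodes at the positions from `l` to `e - 1`. -/
def block (a : Arrays) (l e : ℕ) : Finset ℕ := (Finset.Ico l e).image a.ord

theorem Data.sum_block (h : Data n d a) (hen : e ≤ n) (f : ℕ → ℕ) :
    ∑ v ∈ block a l e, f v = ∑ i ∈ Finset.Ico l e, f (a.ord i) := by
  refine Finset.sum_image fun i hi j hj he => ?_
  simp only [Finset.coe_Ico, Set.mem_Ico] at hi hj
  exact h.span.inj i (by omega) j (by omega) he

theorem Data.card_block_filter (h : Data n d a) (hen : e ≤ n) (p : ℕ → Prop) [DecidablePred p] :
    ((block a l e).filter p).card = ∑ i ∈ Finset.Ico l e, if p (a.ord i) then 1 else 0 := by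
  rw [Finset.card_filter, h.sum_block hen]

theorem Data.block_lt (h : Data n d a) (hen : e ≤ n) : ∀ u ∈ block a l e, u < n := by
  intro u hu
  obtain ⟨i, hi, rfl⟩ := Finset.mem_image.1 hu
  rw [Finset.mem_Ico] at hi
  exact h.span.lt i (by omega)

/-- Both ends of the interval are starts, or its right end is the end of the order, so by
`Data.cross` no edge of length at most r leaves it. -/
theorem Data.block_closed (h : Data n d a) (hl : IsStart d a r (a.ord l))
    (he : e < n → IsStart d a r (a.ord e)) (hen : e ≤ n) :
    ∀ u ∈ block a l e, ∀ v < n, d u v ≤ r → v ∈ block a l e := by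
  intro u hu v hv huv
  obtain ⟨i, hi, rfl⟩ := Finset.mem_image.1 hu
  rw [Finset.mem_Ico] at hi
  obtain ⟨j, hj, rfl⟩ := h.span.surj v hv
  refine Finset.mem_image.2 ⟨j, Finset.mem_Ico.2 ⟨?_, ?_⟩, rfl⟩
  · by_contra hjl
    exact absurd huv (not_le.2 (h.cross hl (by omega) hi.1 (by omega)))
  · by_contra hje
    rw [h.metric.symm] at huv
    exact absurd huv (not_le.2 (h.cross (he (by omega)) hi.2 (by omega) hj))

theorem even_sum_of_flip {s : Finset ℕ} {f g : ℕ → ℕ} {k : ℕ} (hk : k ∈ s)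
    (hfg : ∀ i ∈ s, i ≠ k → g i = f i) (h1 : f k + g k = 1) (hodd : (∑ i ∈ s, f i) % 2 = 1) :
    (∑ i ∈ s, g i) % 2 = 0 := by
  rw [← Finset.add_sum_erase s _ hk] at hodd ⊢
  have : ∑ i ∈ s.erase k, g i = ∑ i ∈ s.erase k, f i :=
    Finset.sum_congr rfl fun i hi => hfg i (Finset.mem_of_mem_erase hi) (Finset.ne_of_mem_erase hi)
  omega

/-- All ways of completing a component leave the flags and parities of the completed ones alone. So
beyond `hloc` and `hinj` only the present block matters: its total defect must become even (unless
failure is reported), and its clusters must not outnumber the centers of a solution there. -/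
theorem Scan.close_aux
    (hS : Scan n d a ρ (l + 1) l e rep isc z cnt fail par free paid) (hl : l < n)
    (hst : IsStart d a ρ (a.ord l)) {cnt' fail' : ℕ}
    (hloc : ∀ i, l ≤ i → i < n → Local n d a ρ rep' isc' z' (a.ord i))
    (hinj : ∀ i j, l ≤ i → i < n → l ≤ j → j < n → isc' (a.ord i) = 1 → isc' (a.ord j) = 1 →
      rep' (a.ord i) = rep' (a.ord j) → i = j)
    (hisc : ∀ i, e ≤ i → i < n → isc' (a.ord i) = isc (a.ord i))
    (hz : ∀ i, e ≤ i → i < n → z' (a.ord i) = z (a.ord i))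
    (hcnt : cnt' = ∑ i ∈ Finset.Ico l n, isc' (a.ord i))
    (heven : fail' = 0 → fail = 0 ∧ (∑ i ∈ Finset.Ico l e, z' (a.ord i)) % 2 = 0)
    (hlow : ∀ r S σ, Agree n d a ρ r → Sol n a.lab d r S σ → (fail = 0 → fail' = 0) ∧
      ∑ i ∈ Finset.Ico l e, isc' (a.ord i) ≤ ∑ i ∈ Finset.Ico l e, if a.ord i ∈ S then 1 else 0) :
    Scan n d a ρ l l l rep' isc' z' cnt' fail' 0 0 0 := by
  have hle := hS.le
  have hen := hS.le_n
  refine ⟨le_rfl, hl.le, fun _ => hst, fun i _ _ => by omega, hloc, fun i _ _ => by omega, hinj,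
    by simp, Or.inl ⟨rfl, fun i _ _ => by omega⟩, Or.inl ⟨rfl, fun i _ _ => by omega⟩, hcnt,
    fun hf b hb hbn hbs => ?_, fun r S σ hA hsol => ?_⟩
  · obtain ⟨hf0, hpar⟩ := heven hf
    have hcl : ∀ b, e ≤ b → b < n → IsStart d a ρ (a.ord b) →
        Even (∑ i ∈ Finset.Ico b n, z' (a.ord i)) := fun b hb hbn hbs => by
      rw [Finset.sum_congr rfl fun i hi => hz i (by rw [Finset.mem_Ico] at hi; omega)
        (Finset.mem_Ico.1 hi).2]
      exact hS.even hf0 b hb hbn hbs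
    rcases lt_or_ge b e with h1 | h1
    · have hbl : b = l := by
        by_contra hne
        exact hS.no_start b (by omega) h1 hbs
      subst hbl
      rw [← Finset.sum_Ico_consecutive _ hle hen]
      refine Even.add (Nat.even_iff.2 hpar) ?_
      rcases hen.eq_or_lt with h2 | h2
      · simp [h2]
      · exact hcl e le_rfl h2 (hS.start h2)
    · exact hcl b h1 hbn hbs
  · obtain ⟨h1, h2⟩ := hS.lower r S σ hA hsol
    obtain ⟨h3, h4⟩ := hlow r S σ hA hsol
    refine ⟨h3 h1, ?_⟩
    rw [← Finset.sum_Ico_consecutive _ hle hen, ← Finset.sum_Ico_consecutive _ hle hen]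
    refine Nat.add_le_add h4 ?_
    rw [Finset.sum_congr rfl fun i hi => hisc i (Finset.mem_Ico.1 hi).1 (Finset.mem_Ico.1 hi).2]
    exact h2

/-- Before any flip the clusters of the open block are the nodes of the separated set, to which
`Sol.card_le` applies. -/
theorem Scan.block_card_le (h : Data n d a)
    (hS : Scan n d a ρ (l + 1) l e rep isc z cnt fail par free paid) (hl : l < n)
    (hst : IsStart d a ρ (a.ord l)) {S : Finset ℕ} {σ : ℕ → ℕ} (hA : Agree n d a ρ r)
    (hsol : Sol n a.lab d r S σ) :
    ∑ i ∈ Finset.Ico l e, isc (a.ord i) ≤ ∑ i ∈ Finset.Ico l e, if a.ord i ∈ S then 1 else 0 := by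
  have hen := hS.le_n
  have := hsol.card_le (h.block_lt hen)
    (h.block_closed ((hA.isStart (h.span.lt l hl)).2 hst)
      (fun he => (hA.isStart (h.span.lt e he)).2 (hS.start he)) hen) (hA.separated h)
  rw [h.card_block_filter hen, h.card_block_filter hen] at this
  refine le_trans (le_of_eq (Finset.sum_congr rfl fun i hi => ?_)) this
  rw [Finset.mem_Ico] at hi
  exact (hS.opn i hi.1 hi.2).2.1

/-- With `free` equal to 0, no separated node of the block has a neighbour off its default parity at
ρ, hence by `Agree` none at r; `par ≠ 0` is the odd defect. So `Sol.card_lt` applies, and its node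
outside the separated set has been recorded in `paid`. -/
theorem Scan.block_card_lt (h : Data n d a)
    (hS : Scan n d a ρ (l + 1) l e rep isc z cnt fail par 0 paid) (hl : l < n)
    (hst : IsStart d a ρ (a.ord l)) (hpar : par ≠ 0) {S : Finset ℕ} {σ : ℕ → ℕ}
    (hA : Agree n d a ρ r) (hsol : Sol n a.lab d r S σ) :
    ∑ i ∈ Finset.Ico l e, isc (a.ord i) < ∑ i ∈ Finset.Ico l e, (if a.ord i ∈ S then 1 else 0) ∧
      paid ≠ 0 := by
  have hen := hS.le_n
  have hfree : ∀ i, l ≤ i → i < e → Sep d a ρ (a.ord i) → ¬ HasOther d a ρ (a.ord i) := by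
    rcases hS.free_eq with h1 | ⟨i, _, _, h1, _⟩
    · exact h1.2
    · omega
  have hsum : ∑ v ∈ block a l e, defect a.lab (Sep d a ρ) v = ∑ i ∈ Finset.Ico l e, z (a.ord i) := by
    rw [h.sum_block hen]
    refine Finset.sum_congr rfl fun i hi => ?_
    rw [Finset.mem_Ico] at hi
    exact (hS.opn i hi.1 hi.2).2.2.symm
  obtain ⟨h1, w, hw, hwM, hwl⟩ := hsol.card_lt h.metric (hsol.nonneg h.metric h.pos) (h.block_lt hen)
    (h.block_closed ((hA.isStart (h.span.lt l hl)).2 hst)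
      (fun he => (hA.isStart (h.span.lt e he)).2 (hS.start he)) hen) (hA.separated h)
    (fun m hm hmM w hw hmw => by
      obtain ⟨i, hi, rfl⟩ := Finset.mem_image.1 hm
      rw [Finset.mem_Ico] at hi
      by_contra hne
      have hin := h.span.lt i (by omega)
      have ho := (h.other _ hin).le w hw hne
      exact hfree i hi.1 hi.2 hmM ⟨ho.1, ((hA _ hin).2.2).1 (ho.2.trans hmw)⟩)
    (by
      rw [hsum, Nat.odd_iff]
      have := hS.par_eq
      omega)
  rw [h.card_block_filter hen, h.card_block_filter hen] at h1
  refine ⟨lt_of_le_of_lt (le_of_eq (Finset.sum_congr rfl fun i hi => ?_)) h1, fun h0 => ?_⟩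
  · rw [Finset.mem_Ico] at hi
    exact (hS.opn i hi.1 hi.2).2.1
  · obtain ⟨i, hi, rfl⟩ := Finset.mem_image.1 hw
    rw [Finset.mem_Ico] at hi
    rcases hS.paid_eq with h2 | ⟨j, _, _, h2, _⟩
    · exact hwl (h2.2 i hi.1 hi.2 hwM)
    · omega

theorem Scan.close_even (h : Data n d a)
    (hS : Scan n d a ρ (l + 1) l e rep isc z cnt fail 0 free paid) (hl : l < n)
    (hst : IsStart d a ρ (a.ord l)) : Scan n d a ρ l l l rep isc z cnt fail 0 0 0 :=
  hS.close_aux hl hst hS.loc hS.inj (fun _ _ _ => rfl) (fun _ _ _ => rfl) hS.cnt_eq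
    (fun hf => ⟨hf, hS.par_eq.symm⟩) fun _ _ _ hA hsol => ⟨id, hS.block_card_le h hl hst hA hsol⟩

/-- By the second half of `Scan.block_card_lt`, no solution agrees with this threshold, and the
clause about solutions is vacuous. -/
theorem Scan.close_fail (h : Data n d a)
    (hS : Scan n d a ρ (l + 1) l e rep isc z cnt fail par 0 0) (hl : l < n)
    (hst : IsStart d a ρ (a.ord l)) (hpar : par ≠ 0) : Scan n d a ρ l l l rep isc z cnt 1 0 0 0 :=
  hS.close_aux hl hst hS.loc hS.inj (fun _ _ _ => rfl) (fun _ _ _ => rfl) hS.cnt_eq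
    (fun hf => absurd hf one_ne_zero)
    fun _ _ _ hA hsol => absurd rfl (hS.block_card_lt h hl hst hpar hA hsol).2

/-- The free flip: the new center has a label other than the default parity, so it is unconstrained
or demands exactly the flipped parity. -/
theorem Scan.close_free (h : Data n d a) {f : ℕ}
    (hS : Scan n d a ρ (l + 1) l e rep isc z cnt fail par (f + 1) paid) (hl : l < n)
    (hst : IsStart d a ρ (a.ord l)) (hpar : par ≠ 0)
    (hrep : ∀ w, rep' w = if w = f then a.wl f else rep w)
    (hz : ∀ w, z' w = if w = f then 1 - z f else z w) :
    Scan n d a ρ l l l rep' isc z' cnt fail 0 0 0 := by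
  have hen := hS.le_n
  obtain ⟨k, hlk, hke, hfk, hkM, hkO⟩ : ∃ i, l ≤ i ∧ i < e ∧ f = a.ord i ∧ Sep d a ρ (a.ord i) ∧
      HasOther d a ρ (a.ord i) := by
    rcases hS.free_eq with h1 | ⟨i, h1, h2, h3, h4⟩
    · exact absurd h1.1 (by omega)
    · exact ⟨i, h1, h2, by omega, h4⟩
  subst hfk
  have hkn : k < n := by omega
  have hfn := h.span.lt k hkn
  have hne : ∀ i, i < n → i ≠ k → a.ord i ≠ a.ord k := fun i hi hik => h.ord_ne hi hkn hik
  have r2 : ∀ i, i < n → i ≠ k → rep' (a.ord i) = rep (a.ord i) := fun i hi hik => by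
    rw [hrep, if_neg (hne i hi hik)]
  have z2 : ∀ i, i < n → i ≠ k → z' (a.ord i) = z (a.ord i) := fun i hi hik => by
    rw [hz, if_neg (hne i hi hik)]
  have r1 : rep' (a.ord k) = a.wl (a.ord k) := by rw [hrep, if_pos rfl]
  have z1 : z' (a.ord k) = 1 - z (a.ord k) := by rw [hz, if_pos rfl]
  have hwn := (h.other _ hfn).lt
  have hlk' := hS.loc k hlk hkn
  -- The new center differs from all others: from those of separated nodes, for which it would be a
  -- common neighbour, and from extra clusters in completed components, which are too far away. The
  -- open block has no extra clusters.
  have hinj : ∀ i, l ≤ i → i < n → i ≠ k → isc (a.ord i) = 1 → rep (a.ord i) ≠ a.wl (a.ord k) := by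
    intro i hi hin hik hi1 he
    by_cases hM : Sep d a ρ (a.ord i)
    · refine hne i hin hik (h.sep ρ _ (h.span.lt i hin) _ hfn hM hkM (a.wl (a.ord k)) hwn ?_ hkO.2)
      rw [← he]; exact (hS.loc i hi hin).rep_dist
    · rcases lt_or_ge i e with h1 | h1
      · have := (hS.opn i hi h1).2.1
        rw [if_neg hM] at this
        omega
      · rw [(hS.loc i hi hin).rep_self hM] at he
        have h2 := hkO.2
        rw [← he, h.metric.symm] at h2
        exact absurd h2 (not_le.2 (h.cross (hS.start (by omega)) hke h1 hin))
  refine hS.close_aux hl hst (fun i hi hin => ?_) (fun i j hi hin hj hjn h1 h2 h3 => ?_)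
    (fun _ _ _ => rfl) (fun i hi hin => z2 i hin (by omega)) hS.cnt_eq (fun hf => ⟨hf, ?_⟩)
    fun _ _ _ hA hsol => ⟨id, hS.block_card_le h hl hst hA hsol⟩
  · by_cases hik : i = k
    · subst hik
      refine ⟨hlk'.isc_le, by rw [z1]; omega, hlk'.isc_eq, fun h0 => ?_, by rw [r1]; exact hwn,
        by rw [r1]; exact hkO.2, fun hM => absurd hkM hM, fun _ => ?_⟩
      · have := hlk'.isc_eq hkM
        omega
      · rw [r1, z1]
        have h1 := (h.other _ hfn).ne hkO.1
        have h2 := h.lab_le _ hwn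
        have h3 := (hS.opn i hlk hke).2.2
        simp only [defect, hkM, true_and] at h3
        unfold target at h1
        rw [h3]
        split at h1 <;> simp_all <;> omega
    · exact (hS.loc i hi hin).congr (r2 i hin hik) rfl (z2 i hin hik)
  · by_cases hik : i = k
    · by_cases hjk : j = k
      · omega
      · rw [hik, r1, r2 j hjn hjk] at h3
        exact absurd h3.symm (hinj j hj hjn hjk h2)
    · by_cases hjk : j = k
      · rw [hjk, r1, r2 i hin hik] at h3
        exact absurd h3 (hinj i hi hin hik h1)
      · rw [r2 i hin hik, r2 j hjn hjk] at h3
        exact hS.inj i j hi hin hj hjn h1 h2 h3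
  · refine even_sum_of_flip (f := fun i => z (a.ord i)) (Finset.mem_Ico.2 ⟨hlk, hke⟩)
      (fun i hi hik => z2 i (by rw [Finset.mem_Ico] at hi; omega) hik) ?_ ?_
    · have := hlk'.z_le
      rw [z1]; omega
    · have := hS.par_eq
      omega

/-- The paid flip: a node outside the separated set whose label is not even becomes a cluster of odd
parity. The strict inequality of `Scan.block_card_lt` pays for it. -/
theorem Scan.close_paid (h : Data n d a) {f : ℕ}
    (hS : Scan n d a ρ (l + 1) l e rep isc z cnt fail par 0 (f + 1)) (hl : l < n)
    (hst : IsStart d a ρ (a.ord l)) (hpar : par ≠ 0)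
    (hisc : ∀ w, isc' w = if w = f then 1 else isc w)
    (hz : ∀ w, z' w = if w = f then 1 - z f else z w) :
    Scan n d a ρ l l l rep isc' z' (cnt + 1) fail 0 0 0 := by
  have hen := hS.le_n
  obtain ⟨k, hlk, hke, hfk, hkM, hkO⟩ : ∃ i, l ≤ i ∧ i < e ∧ f = a.ord i ∧ ¬ Sep d a ρ (a.ord i) ∧
      a.lab (a.ord i) ≠ 0 := by
    rcases hS.paid_eq with h1 | ⟨i, h1, h2, h3, h4⟩
    · exact absurd h1.1 (by omega)
    · exact ⟨i, h1, h2, by omega, h4⟩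
  subst hfk
  have hkn : k < n := by omega
  have hfn := h.span.lt k hkn
  have hne : ∀ i, i < n → i ≠ k → a.ord i ≠ a.ord k := fun i hi hik => h.ord_ne hi hkn hik
  have i2 : ∀ i, i < n → i ≠ k → isc' (a.ord i) = isc (a.ord i) := fun i hi hik => by
    rw [hisc, if_neg (hne i hi hik)]
  have z2 : ∀ i, i < n → i ≠ k → z' (a.ord i) = z (a.ord i) := fun i hi hik => by
    rw [hz, if_neg (hne i hi hik)]
  have i1 : isc' (a.ord k) = 1 := by rw [hisc, if_pos rfl]
  have z1 : z' (a.ord k) = 1 - z (a.ord k) := by rw [hz, if_pos rfl]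
  have hlk' := hS.loc k hlk hkn
  have i0 : isc (a.ord k) = 0 := by
    have := (hS.opn k hlk hke).2.1
    rwa [if_neg hkM] at this
  have zk : z (a.ord k) = 1 := hlk'.z_eq i0
  have rk : rep (a.ord k) = a.ord k := hlk'.rep_self hkM
  have hinj : ∀ i, l ≤ i → i < n → i ≠ k → rep (a.ord i) ≠ a.ord k := by
    intro i hi hin hik he
    rcases lt_or_ge i e with h1 | h1
    · rw [(hS.opn i hi h1).1] at he
      exact hne i hin hik he
    · have h2 := (hS.loc i hi hin).rep_dist
      rw [he] at h2
      exact absurd h2 (not_le.2 (h.cross (hS.start (by omega)) hke h1 hin))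
  have hsum : ∀ c, k < c → c ≤ n → ∑ i ∈ Finset.Ico l c, isc' (a.ord i) =
      ∑ i ∈ Finset.Ico l c, isc (a.ord i) + 1 := by
    intro c hc hcn
    have hk : k ∈ Finset.Ico l c := Finset.mem_Ico.2 ⟨hlk, hc⟩
    rw [← Finset.add_sum_erase _ _ hk, ← Finset.add_sum_erase _ (fun i => isc (a.ord i)) hk, i1, i0]
    have : ∑ i ∈ (Finset.Ico l c).erase k, isc' (a.ord i) =
        ∑ i ∈ (Finset.Ico l c).erase k, isc (a.ord i) := Finset.sum_congr rfl fun i hi => by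
      rw [Finset.mem_erase, Finset.mem_Ico] at hi
      exact i2 i (by omega) hi.1
    omega
  refine hS.close_aux hl hst (fun i hi hin => ?_) (fun i j hi hin hj hjn h1 h2 h3 => ?_)
    (fun i hi hin => i2 i hin (by omega)) (fun i hi hin => z2 i hin (by omega)) ?_
    (fun hf => ⟨hf, ?_⟩) fun r S σ hA hsol => ⟨id, ?_⟩
  · by_cases hik : i = k
    · subst hik
      refine ⟨by rw [i1], by rw [z1]; omega, fun _ => i1, fun h0 => by omega, hlk'.rep_lt,
        hlk'.rep_dist, hlk'.rep_self, fun _ => ?_⟩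
      have := h.lab_le _ hfn
      rw [rk, z1, zk]
      omega
    · exact (hS.loc i hi hin).congr rfl (i2 i hin hik) (z2 i hin hik)
  · by_cases hik : i = k
    · by_cases hjk : j = k
      · omega
      · rw [hik, rk] at h3
        exact absurd h3.symm (hinj j hj hjn hjk)
    · by_cases hjk : j = k
      · rw [hjk, rk] at h3
        exact absurd h3 (hinj i hi hin hik)
      · rw [i2 i hin hik] at h1
        rw [i2 j hjn hjk] at h2
        exact hS.inj i j hi hin hj hjn h1 h2 h3
  · rw [hsum n hkn le_rfl, hS.cnt_eq]
  · refine even_sum_of_flip (f := fun i => z (a.ord i)) (Finset.mem_Ico.2 ⟨hlk, hke⟩)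
      (fun i hi hik => z2 i (by rw [Finset.mem_Ico] at hi; omega) hik) ?_ ?_
    · have := hlk'.z_le
      rw [z1]; omega
    · have := hS.par_eq
      omega
  · rw [hsum e hke hen]
    exact (hS.block_card_lt h hl hst hpar hA hsol).1

end scan

/-- The arrays that the test of a threshold reads. -/
def Store.arrays (s : Store) : Arrays :=
  ⟨s.arr aLab, s.arr aOrd, s.arr aPar, s.arr aTX, s.arr aTY, s.arr aWl, s.arr aHw⟩

/-- `1 ≤ e` -/
abbrev Test.pos (e : Exp) : Test := .le (.const 1) e

/-- Visit the node at position `rL`. -/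
def visitCmd : Cmd :=
  .seq (.seq (.assign rV (nodeAt rL)) (.write aRep (.var rV) (.var rV)))
    (.seq
      (.ite (.and (.pos (.var rV))
          (.distLe (.read aTX (.var rV)) (.read aTY (.var rV)) (.var rA) (.var rB)))
        (.seq (.seq (.write aIsc (.var rV) (.const 0)) (.write aZ (.var rV) (.const 1)))
          (.ite (.pos (.read aLab (.var rV))) (.assign rPaid (.add (.var rV) (.const 1))) .skip))
        (.seq (.seq (.write aIsc (.var rV) (.const 1)) (.assign rCnt (.add (.var rCnt) (.const 1))))
          (.seq
            (.ite (.and (.pos (.read aLab (.var rV))) (.le (.read aLab (.var rV)) (.const 1)))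
              (.write aZ (.var rV) (.const 0)) (.write aZ (.var rV) (.const 1)))
            (.ite (.and (.pos (.read aHw (.var rV)))
                (.distLe (.var rV) (.read aWl (.var rV)) (.var rA) (.var rB)))
              (.assign rFree (.add (.var rV) (.const 1))) .skip))))
      (.ite (.pos (.read aZ (.var rV))) (.assign rPar (.sub (.const 1) (.var rPar))) .skip))

/-- Complete the component if the node in `rV` is its first node. -/
def closeCmd : Cmd :=
  .ite (.and (.pos (.var rV)) (.distLe (.var rV) (.read aPar (.var rV)) (.var rA) (.var rB)))
    .skip
    (.seq
      (.ite (.pos (.var rPar))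
        (.ite (.pos (.var rFree))
          (.seq (.assign rU (.sub (.var rFree) (.const 1)))
            (.seq (.write aRep (.var rU) (.read aWl (.var rU)))
              (.write aZ (.var rU) (.sub (.const 1) (.read aZ (.var rU))))))
          (.ite (.pos (.var rPaid))
            (.seq (.assign rU (.sub (.var rPaid) (.const 1)))
              (.seq (.write aIsc (.var rU) (.const 1))
                (.seq (.write aZ (.var rU) (.sub (.const 1) (.read aZ (.var rU))))
                  (.assign rCnt (.add (.var rCnt) (.const 1))))))
            (.assign rFail (.const 1))))
        .skip)
      (.seq (.assign rPar (.const 0)) (.seq (.assign rFree (.const 0)) (.assign rPaid (.const 0)))))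

/-- Test the threshold given by the nodes in `rA` and `rB`. -/
def scanCmd : Cmd :=
  .seq
    (.seq (.assign rCnt (.const 0)) (.seq (.assign rFail (.const 0)) (.seq (.assign rPar (.const 0))
      (.seq (.assign rFree (.const 0)) (.seq (.assign rPaid (.const 0)) (.assign rL (.var rN)))))))
    (.down rL (.seq visitCmd closeCmd))

/-- The store describes the state of a scan. -/
def Store.Scan (n : ℕ) (d : ℕ → ℕ → ℝ) (a : Arrays) (ρ : ℝ) (m l : ℕ) (s : Store) : Prop :=
  ∃ e, ParityKCenter.Scan n d a ρ m l e (s.arr aRep) (s.arr aIsc) (s.arr aZ) (s.var rCnt)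
    (s.var rFail) (s.var rPar) (s.var rFree) (s.var rPaid)

theorem visitCmd_ok {n l : ℕ} {d : ℕ → ℕ → ℝ} {a : Arrays} {ρ : ℝ} (h : Data n d a) (hρ : 0 ≤ ρ)
    (s : Store) (ha : s.arrays = a) (hr : d (s.var rA) (s.var rB) = ρ) (hL : s.var rL = l)
    (hl : l < n) (hS : s.Scan n d a ρ (l + 1) (l + 1)) :
    Ok d visitCmd s 100 (fun s' => s'.Scan n d a ρ (l + 1) l ∧ s'.var rV = a.ord l) := by
  obtain ⟨e, hS⟩ := hS
  refine (Ok.of_wp (Q := fun s' => s'.var rV = a.ord l ∧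
    (∀ w, s'.arr aRep w = if w = a.ord l then a.ord l else s.arr aRep w) ∧
    (∀ w, s'.arr aIsc w = if w = a.ord l then (if Sep d a ρ (a.ord l) then 1 else 0)
      else s.arr aIsc w) ∧
    (∀ w, s'.arr aZ w = if w = a.ord l then defect a.lab (Sep d a ρ) (a.ord l) else s.arr aZ w) ∧
    (s'.var rCnt = s.var rCnt + if Sep d a ρ (a.ord l) then 1 else 0) ∧
    (s'.var rFail = s.var rFail) ∧
    (s'.var rPar = if s'.arr aZ (a.ord l) = 0 then s.var rPar else 1 - s.var rPar) ∧
    (s'.var rFree = a.ord l + 1 ∧ Sep d a ρ (a.ord l) ∧ HasOther d a ρ (a.ord l) ∨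
      s'.var rFree = s.var rFree ∧ ¬ (Sep d a ρ (a.ord l) ∧ HasOther d a ρ (a.ord l))) ∧
    (s'.var rPaid = a.ord l + 1 ∧ ¬ Sep d a ρ (a.ord l) ∧ a.lab (a.ord l) ≠ 0 ∨
      s'.var rPaid = s.var rPaid ∧ ¬ (¬ Sep d a ρ (a.ord l) ∧ a.lab (a.ord l) ≠ 0))) ?_).mono
    (B := Cmd.bound _) (by decide) ?_
  · subst ha
    have hv : s.arrays.ord l = s.arr 2 l := rfl
    have hlab : s.arrays.lab (s.arr 2 l) = s.arr 0 (s.arr 2 l) := rfl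
    have hM : Sep d s.arrays ρ (s.arr 2 l) ↔ ¬ (1 ≤ s.arr 2 l ∧
      d (s.arr 5 (s.arr 2 l)) (s.arr 6 (s.arr 2 l)) ≤ ρ) := Iff.rfl
    have hO : HasOther d s.arrays ρ (s.arr 2 l) ↔ (1 ≤ s.arr 8 (s.arr 2 l) ∧
      d (s.arr 2 l) (s.arr 7 (s.arr 2 l)) ≤ ρ) := Iff.rfl
    have heq : ∀ b : ℕ, (1 ≤ b ∧ b ≤ 1) ↔ b = 1 := fun b => by omega
    have hpos : ∀ b : ℕ, 1 ≤ b ↔ b ≠ 0 := fun b => by omega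
    simp only [rL, rA, rB] at hL hr
    rw [hv]
    simp only [visitCmd, Cmd.wp, Test.Holds, Exp.eval, Store.setArr_arr_apply, Store.setVar_var,
      Store.setArr_var, Store.setVar_arr, rV, rL, rA, rB, rCnt, rPar, rFree, rPaid, rFail, aRep,
      aIsc, aZ, aLab, aOrd, aTX, aTY, aHw, aWl, Nat.reduceEqDiff,
      OfNat.zero_ne_ofNat, false_and, true_and, and_true, if_true, if_false, hL, hr, heq, ← hO,
      hlab, defect]
    refine ⟨fun c1 => ?_, fun c1 => ?_⟩
    · have c1' : ¬ Sep d s.arrays ρ (s.arr 2 l) := fun hh => hM.1 hh c1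
      refine ⟨fun c2 => ?_, fun c2 => ?_⟩
      · simp [c1', hpos] at c2 ⊢
        simp [c2]
      · simp [c1', hpos] at c2 ⊢
        simp [c2]
    · have c1' : Sep d s.arrays ρ (s.arr 2 l) := hM.2 c1
      refine ⟨fun c2 => ⟨fun c3 => ?_, fun c3 => ?_⟩, fun c2 => ⟨fun c3 => ?_, fun c3 => ?_⟩⟩ <;>
        simp [c1', c2, c3]
  · rintro s' - ⟨p0, p1, p2, p3, p4, p5, p6, p7, p8⟩
    refine ⟨⟨e, ?_⟩, p0⟩
    rw [p5]
    exact hS.visit h hρ hl rfl p1 p2 p3 p4 p6 p7 p8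

theorem closeCmd_ok {n l : ℕ} {d : ℕ → ℕ → ℝ} {a : Arrays} {ρ : ℝ} (h : Data n d a)
    (s : Store) (ha : s.arrays = a) (hr : d (s.var rA) (s.var rB) = ρ) (hV : s.var rV = a.ord l)
    (hl : l < n) (hS : s.Scan n d a ρ (l + 1) l) :
    Ok d closeCmd s 60 (fun s' => s'.Scan n d a ρ l l) := by
  obtain ⟨e, hS⟩ := hS
  refine (Ok.of_wp ?_).mono (B := Cmd.bound _) (by decide) fun _ _ h => h
  have hst : IsStart d a ρ (a.ord l) ↔ ¬ (1 ≤ a.ord l ∧ d (a.ord l) (s.arr 4 (a.ord l)) ≤ ρ) := by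
    rw [← ha]; rfl
  have hwl : s.arr 7 = a.wl := by rw [← ha]; rfl
  simp only [rV, rA, rB] at hV hr
  simp only [closeCmd, Cmd.wp, Test.Holds, Exp.eval, Store.setArr_arr_apply, Store.setVar_var,
      Store.setArr_var, Store.setVar_arr, rV, rA, rB, rCnt, rPar, rFree, rPaid, rFail, rU, aRep,
      aIsc, aZ, aPar, aWl, Nat.reduceEqDiff, and_true, if_true, if_false, hr, hV, hwl]
  refine ⟨fun c1 => ?_, fun c1 => ⟨fun c2 => ⟨fun c3 => ?_, fun c3 => ⟨fun c4 => ?_, fun c4 => ?_⟩⟩,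
    fun c2 => ?_⟩⟩
  -- The node is not a start: nothing is done, and the absence of starts extends to position l.
  · refine ⟨e, hS.le, hS.le_n, hS.start, fun i hi hie => ?_, hS.loc, hS.opn, hS.inj, hS.par_eq,
      hS.free_eq, hS.paid_eq, hS.cnt_eq, hS.even, hS.lower⟩
    rcases hi.eq_or_lt with rfl | hi'
    · rw [hst, not_not]; exact c1
    · exact hS.no_start i hi' hie
  · obtain ⟨f, hf⟩ : ∃ f, s.var 16 = f + 1 := ⟨s.var 16 - 1, by omega⟩
    have hf' : s.var rFree = f + 1 := hf
    rw [hf'] at hS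
    refine ⟨l, ?_⟩
    simp only [Store.setVar_arr, Store.setArr_var, Store.setVar_var, rPar, rFree, rPaid, rCnt, rFail,
      Nat.reduceEqDiff, if_true, if_false, hf, Nat.add_sub_cancel]
    rw [Store.setArr_arr_ne _ _ _ _ aIsc (by decide), Store.setArr_arr_ne _ _ _ _ aIsc (by decide)]
    refine hS.close_free h hl (hst.2 c1) (Nat.one_le_iff_ne_zero.1 c2) (fun w => ?_) (fun w => ?_) <;>
    simp
  · have hf' : s.var rFree = 0 := by simp only [rFree]; omega
    obtain ⟨f, hf⟩ : ∃ f, s.var 17 = f + 1 := ⟨s.var 17 - 1, by omega⟩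
    have hp' : s.var rPaid = f + 1 := hf
    rw [hf', hp'] at hS
    refine ⟨l, ?_⟩
    simp only [Store.setVar_arr, Store.setArr_var, Store.setVar_var, rPar, rFree, rPaid, rCnt, rFail,
      Nat.reduceEqDiff, if_true, if_false, hf, Nat.add_sub_cancel]
    rw [Store.setArr_arr_ne _ _ _ _ aRep (by decide), Store.setArr_arr_ne _ _ _ _ aRep (by decide)]
    refine hS.close_paid h hl (hst.2 c1) (Nat.one_le_iff_ne_zero.1 c2) (fun w => ?_) (fun w => ?_) <;>
    simp
  · have hf' : s.var rFree = 0 := by simp only [rFree]; omega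
    have hp' : s.var rPaid = 0 := by simp only [rPaid]; omega
    rw [hf', hp'] at hS
    exact ⟨l, by simpa using hS.close_fail h hl (hst.2 c1) (Nat.one_le_iff_ne_zero.1 c2)⟩
  · have hf' : s.var rPar = 0 := by simp only [rPar]; omega
    rw [hf'] at hS
    exact ⟨l, by simpa using hS.close_even h hl (hst.2 c1)⟩

/-- The clusters, their centers and their parities are suitable for an assignment of the nodes. -/
structure Good (n : ℕ) (d : ℕ → ℕ → ℝ) (a : Arrays) (ρ : ℝ) (rep isc z : ℕ → ℕ) : Prop where
  loc : ∀ v < n, Local n d a ρ rep isc z v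
  inj : ∀ v < n, ∀ w < n, isc v = 1 → isc w = 1 → rep v = rep w → v = w
  even : ∀ b < n, IsStart d a ρ (a.ord b) → Even (∑ i ∈ Finset.Ico b n, z (a.ord i))

theorem Data.sum_ord {n : ℕ} {d : ℕ → ℕ → ℝ} {a : Arrays} (h : Data n d a) (f : ℕ → ℕ) :
    ∑ i ∈ Finset.Ico 0 n, f (a.ord i) = ∑ v ∈ Finset.range n, f v := by
  rw [← h.sum_block le_rfl]
  refine Finset.sum_congr ?_ fun _ _ => rfl
  ext v
  constructor
  · intro hv; exact Finset.mem_range.2 (h.block_lt le_rfl v hv)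
  · intro hv
    obtain ⟨l, hl, rfl⟩ := h.span.surj v (Finset.mem_range.1 hv)
    exact Finset.mem_image_of_mem _ (Finset.mem_Ico.2 ⟨Nat.zero_le _, hl⟩)

/-- The comparison with solutions is stated for every radius r that agrees with ρ, not for ρ alone:
this is what makes finitely many thresholds sufficient. -/
theorem scanCmd_ok {n : ℕ} {d : ℕ → ℕ → ℝ} {a : Arrays} {ρ : ℝ} (h : Data n d a) (hρ : 0 ≤ ρ)
    (s : Store) (hs : s.var rN = n) (ha : s.arrays = a) (hr : d (s.var rA) (s.var rB) = ρ) :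
    Ok d scanCmd s (n * 168 + 20) (fun s' =>
      (s'.var rFail = 0 → Good n d a ρ (s'.arr aRep) (s'.arr aIsc) (s'.arr aZ)) ∧
      s'.var rCnt = ∑ v ∈ Finset.range n, s'.arr aIsc v ∧
      ∀ r S σ, Agree n d a ρ r → Sol n a.lab d r S σ → s'.var rFail = 0 ∧ s'.var rCnt ≤ S.card) := by
  have h1 : Ok d (.seq (.assign rCnt (.const 0)) (.seq (.assign rFail (.const 0))
      (.seq (.assign rPar (.const 0)) (.seq (.assign rFree (.const 0))
        (.seq (.assign rPaid (.const 0)) (.assign rL (.var rN))))))) s 12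
      (fun s' => s'.var rL = n ∧ s'.var rCnt = 0 ∧ s'.var rFail = 0 ∧ s'.var rPar = 0 ∧
        s'.var rFree = 0 ∧ s'.var rPaid = 0) := by
    refine (Ok.of_wp ?_).mono (B := Cmd.bound _) (by decide) fun _ _ h => h
    simp only [rN] at hs
    simp [Cmd.wp, Exp.eval, hs]
  refine (h1.seq (B' := n * 168 + 4) fun s1 hF1 ⟨p1, p2, p3, p4, p5, p6⟩ => ?_).mono (by omega)
    fun _ _ h => h
  have ha1 : s1.arrays = a := by
    rw [← ha]
    simp only [Store.arrays, hF1.arr aLab, hF1.arr aOrd, hF1.arr aPar, hF1.arr aTX, hF1.arr aTY,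
      hF1.arr aWl, hF1.arr aHw]
  have hr1 : d (s1.var rA) (s1.var rB) = ρ := by rw [← hr, hF1.var rA, hF1.var rB]
  refine (Ok.down (T := 160) (fun l s' => s'.Scan n d a ρ l l) rfl p1 ?_ ?_).mono (by omega) ?_
  · refine ⟨n, ?_⟩
    rw [p2, p3, p4, p5, p6]
    refine ⟨le_rfl, le_rfl, fun h => by omega, fun i _ _ => by omega, fun i _ _ => by omega,
      fun i _ _ => by omega, fun i j _ _ _ _ => by omega, by simp, Or.inl ⟨rfl, fun i _ _ => by omega⟩,
      Or.inl ⟨rfl, fun i _ _ => by omega⟩, by simp, fun _ b _ _ => by omega,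
      fun r S σ _ _ => ⟨rfl, by simp⟩⟩
  · intro l s2 hl hF2 hL2 hS
    have ha2 : (s2.setVar rL l).arrays = a := by
      rw [← ha1]
      simp only [Store.arrays, Store.setVar_arr, hF2.arr aLab, hF2.arr aOrd, hF2.arr aPar,
        hF2.arr aTX, hF2.arr aTY, hF2.arr aWl, hF2.arr aHw]
    have hr2 : d ((s2.setVar rL l).var rA) ((s2.setVar rL l).var rB) = ρ := by
      rw [← hr1, ← hF2.var rA, ← hF2.var rB]; simp
    refine ((visitCmd_ok h hρ (s2.setVar rL l) ha2 hr2 (by simp) hl (by simpa [Store.Scan] using hS)).seq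
      (B' := 60) fun s3 hF3 ⟨hS3, hV3⟩ => ?_).mono (by omega) fun _ _ h => h
    refine closeCmd_ok h s3 ?_ ?_ hV3 hl hS3
    · rw [← ha2]
      simp only [Store.arrays, hF3.arr aLab, hF3.arr aOrd, hF3.arr aPar, hF3.arr aTX, hF3.arr aTY,
        hF3.arr aWl, hF3.arr aHw]
    · rw [← hr2, hF3.var rA, hF3.var rB]
  · rintro s2 - ⟨e, hS⟩
    -- Node 0 is a start at every threshold, so at the end no component is left open.
    have he : e = 0 := by
      by_contra hne
      refine hS.no_start 0 le_rfl (Nat.pos_of_ne_zero hne) ?_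
      rw [h.span.zero]
      simp [IsStart]
    subst he
    refine ⟨fun hf => ⟨fun v hv => ?_, fun v hv w hw h1 h2 h3 => ?_, fun b hb hbs => ?_⟩, ?_,
      fun r S σ hA hsol => ?_⟩
    · obtain ⟨l, hl, rfl⟩ := h.span.surj v hv
      exact hS.loc l (Nat.zero_le _) hl
    · obtain ⟨l, hl, rfl⟩ := h.span.surj v hv
      obtain ⟨l', hl', rfl⟩ := h.span.surj w hw
      rw [hS.inj l l' (Nat.zero_le _) hl (Nat.zero_le _) hl' h1 h2 h3]
    · exact hS.even hf b (Nat.zero_le _) hb hbs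
    · rw [hS.cnt_eq, h.sum_ord]
    · obtain ⟨h1, h2⟩ := hS.lower r S σ hA hsol
      refine ⟨h1, ?_⟩
      rw [hS.cnt_eq]
      refine h2.trans ?_
      rw [h.sum_ord (fun v => if v ∈ S then 1 else 0), ← Finset.card_filter]
      refine Finset.card_le_card fun v hv => (Finset.mem_filter.1 hv).2

/-! ### The search for the threshold -/

theorem Good.congr {n : ℕ} {d : ℕ → ℕ → ℝ} {a : Arrays} {ρ : ℝ} {rep isc z rep' isc' z' : ℕ → ℕ}
    (hD : Data n d a) (h : Good n d a ρ rep isc z) (h1 : ∀ v < n, rep' v = rep v)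
    (h2 : ∀ v < n, isc' v = isc v) (h3 : ∀ v < n, z' v = z v) : Good n d a ρ rep' isc' z' := by
  refine ⟨fun v hv => (h.loc v hv).congr (h1 v hv) (h2 v hv) (h3 v hv), fun v hv w hw => ?_,
    fun b hb hbs => ?_⟩
  · rw [h1 v hv, h1 w hw, h2 v hv, h2 w hw]
    exact h.inj v hv w hw
  · rw [Finset.sum_congr rfl fun i hi => h3 _ (hD.span.lt i (Finset.mem_Ico.1 hi).2)]
    exact h.even b hb hbs

/-- Save the clusters. -/
def copyCmd : Cmd :=
  .for rV (.seq (.write aZB (.var rV) (.read aZ (.var rV)))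
    (.seq (.write aRepB (.var rV) (.read aRep (.var rV)))
      (.write aIscB (.var rV) (.read aIsc (.var rV)))))

theorem copyCmd_ok {n : ℕ} {d : ℕ → ℕ → ℝ} (s : Store) (hs : s.var rN = n) :
    Ok d copyCmd s (n * 22 + 8) (fun s' => ∀ v < n, s'.arr aZB v = s.arr aZ v ∧
      s'.arr aRepB v = s.arr aRep v ∧ s'.arr aIscB v = s.arr aIsc v) := by
  refine Ok.for (n := n) (T := 12) (fun i s' => ∀ v < i, s'.arr aZB v = s.arr aZ v ∧
      s'.arr aRepB v = s.arr aRep v ∧ s'.arr aIscB v = s.arr aIsc v) rfl rfl hs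
    (fun v hv => absurd hv (Nat.not_lt_zero v)) ?_
  intro i s' hi hF hV hI
  refine (Ok.of_wp ?_).mono (B := Cmd.bound _) (by decide) fun _ _ h => h
  have e1 := hF.arr aZ
  have e2 := hF.arr aRep
  have e3 := hF.arr aIsc
  simp only [rV, aZ, aRep, aIsc] at hV e1 e2 e3
  intro v hv
  rcases Nat.lt_succ_iff_lt_or_eq.1 hv with h | h
  · simpa [Exp.eval, hV, h.ne] using hI v h
  · simp [Exp.eval, hV, h, e1, e2, e3]

/-- If a threshold has been found, the best one is in `rBX` and `rBY`, with suitable clusters. -/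
def Store.Best (n k : ℕ) (d : ℕ → ℕ → ℝ) (a : Arrays) (s : Store) : Prop :=
  1 ≤ s.var rFound → 0 ≤ d (s.var rBX) (s.var rBY) ∧
    Good n d a (d (s.var rBX) (s.var rBY)) (s.arr aRepB) (s.arr aIscB) (s.arr aZB) ∧
    ∑ v ∈ Finset.range n, s.arr aIscB v ≤ k

/-- If there is a solution for which `ρ` has to be accepted, then a threshold
of at most `ρ` has been found. -/
def Store.Covers (n k : ℕ) (d : ℕ → ℕ → ℝ) (a : Arrays) (s : Store) (ρ : ℝ) : Prop :=
  (∃ r S σ, Agree n d a ρ r ∧ Sol n a.lab d r S σ ∧ S.card ≤ k) →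
    1 ≤ s.var rFound ∧ d (s.var rBX) (s.var rBY) ≤ ρ

/-- Test the threshold given by `rA` and `rB`, and save the result if it is the best so far. -/
def tryCmd : Cmd :=
  .seq scanCmd
    (.ite (.and (.and (.le (.var rFail) (.const 0)) (.le (.var rCnt) (.var rK)))
        (.not (.and (.pos (.var rFound)) (.distLe (.var rBX) (.var rBY) (.var rA) (.var rB)))))
      (.seq (.seq (.assign rBX (.var rA)) (.seq (.assign rBY (.var rB)) (.assign rFound (.const 1))))
        copyCmd)
      .skip)

/-- The stored threshold is replaced only if there was none or the old one was larger, so whatever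
was covered stays covered. -/
theorem tryCmd_ok {n k : ℕ} {d : ℕ → ℕ → ℝ} {a : Arrays} {ρ : ℝ} (h : Data n d a) (hρ : 0 ≤ ρ)
    (s : Store) (hs : s.var rN = n) (hk : s.var rK = k) (ha : s.arrays = a)
    (hr : d (s.var rA) (s.var rB) = ρ) (hbest : s.Best n k d a) :
    Ok d tryCmd s (n * 190 + 60) (fun s' => s'.Best n k d a ∧ s'.Covers n k d a ρ ∧
      ∀ ρ', s.Covers n k d a ρ' → s'.Covers n k d a ρ') := by
  refine ((scanCmd_ok h hρ s hs ha hr).seq (B' := n * 22 + 40) fun s1 hF1 ⟨hgood, hcnt, hlow⟩ => ?_).mono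
    (by omega) fun _ _ h => h
  have k1 : s1.var rK = k := (hF1.var rK).trans hk
  have r1 : d (s1.var rA) (s1.var rB) = ρ := by rw [← hr, hF1.var rA, hF1.var rB]
  have f1 : s1.var rFound = s.var rFound := hF1.var rFound
  have x1 : s1.var rBX = s.var rBX := hF1.var rBX
  have y1 : s1.var rBY = s.var rBY := hF1.var rBY
  refine (Ok.ite (B := n * 22 + 20) (fun hb => ?_) (fun hb => ?_)).mono
    (by simp only [Test.time, Exp.time]; omega) fun _ _ h => h
  · simp only [Test.Holds, Exp.eval, k1, r1, f1, x1, y1] at hb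
    obtain ⟨⟨hfail, hcntk⟩, hnew⟩ := hb
    have h2 : Ok d (.seq (.assign rBX (.var rA)) (.seq (.assign rBY (.var rB))
        (.assign rFound (.const 1)))) s1 6 (fun s' => s'.var rBX = s1.var rA ∧
          s'.var rBY = s1.var rB ∧ s'.var rFound = 1) := by
      refine (Ok.of_wp ?_).mono (B := Cmd.bound _) (by decide) fun _ _ h => h
      simp [Cmd.wp, Exp.eval]
    refine (h2.seq (B' := n * 22 + 8) fun s2 hF2 ⟨x2, y2, f2⟩ => ?_).mono (by omega) fun _ _ h => h
    refine (copyCmd_ok s2 (((hF2.var rN).trans (hF1.var rN)).trans hs)).mono le_rfl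
      fun s3 hF3 hcopy => ?_
    have f3 : s3.var rFound = 1 := (hF3.var rFound).trans f2
    have d3 : d (s3.var rBX) (s3.var rBY) = ρ := by rw [hF3.var rBX, hF3.var rBY, x2, y2, r1]
    rw [hF2.arr aZ, hF2.arr aRep, hF2.arr aIsc] at hcopy
    refine ⟨fun _ => ⟨by rw [d3]; exact hρ, ?_, ?_⟩, fun _ => ⟨f3.ge, d3.le⟩, fun ρ' hc hex => ?_⟩
    · rw [d3]
      exact (hgood (by omega)).congr h (fun v hv => (hcopy v hv).2.1) (fun v hv => (hcopy v hv).2.2)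
        (fun v hv => (hcopy v hv).1)
    · rw [Finset.sum_congr rfl fun v hv => (hcopy v (Finset.mem_range.1 hv)).2.2, ← hcnt]
      exact hcntk
    · obtain ⟨h4, h5⟩ := hc hex
      refine ⟨f3.ge, ?_⟩
      rw [d3]
      by_contra h6
      exact hnew ⟨h4, h5.trans (not_le.1 h6).le⟩
  · refine (Ok.of_wp (p := .skip) (Q := fun s' => s' = s1) rfl).mono (by simp [Cmd.bound]) ?_
    rintro _ - rfl
    simp only [Test.Holds, Exp.eval, k1, r1, f1, x1, y1] at hb
    have e1 := hF1.arr aRepB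
    have e2 := hF1.arr aIscB
    have e3 := hF1.arr aZB
    refine ⟨?_, ?_, ?_⟩
    · unfold Store.Best
      rw [f1, x1, y1, e1, e2, e3]
      exact hbest
    · rintro ⟨r, S, σ, hA, hsol, hSk⟩
      obtain ⟨h4, h5⟩ := hlow r S σ hA hsol
      rw [f1, x1, y1]
      by_contra hcon
      exact hb ⟨⟨h4.le, h5.trans hSk⟩, hcon⟩
    · intro ρ' hc
      unfold Store.Covers
      rw [f1, x1, y1]
      exact hc

/-- Load the candidate `(e, f)` and test it. -/
def tryAt (e f : Exp) : Cmd := .seq (.seq (.assign rA e) (.assign rB f)) tryCmd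

/-- Test all candidates. -/
def searchCmd : Cmd :=
  .for rI (.seq (tryAt (.var rI) (.read aPar (.var rI)))
    (.seq (tryAt (.read aTX (.var rI)) (.read aTY (.var rI)))
      (tryAt (.var rI) (.read aWl (.var rI)))))

theorem tryAt_ok {n k x y : ℕ} {d : ℕ → ℕ → ℝ} {a : Arrays} {e f : Exp} (h : Data n d a)
    (s : Store) (hs : s.var rN = n) (hk : s.var rK = k) (ha : s.arrays = a)
    (he : e.eval s = x) (hf : f.eval (s.setVar rA x) = y) (hx : x < n) (hy : y < n)
    (het : e.time ≤ 5) (hft : f.time ≤ 5) (hbest : s.Best n k d a) :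
    Ok d (tryAt e f) s (n * 190 + 72) (fun s' => s'.Best n k d a ∧ s'.Covers n k d a (d x y) ∧
      ∀ ρ', s.Covers n k d a ρ' → s'.Covers n k d a ρ') := by
  have h1 : Ok d (.seq (.assign rA e) (.assign rB f)) s 12 (fun s' =>
      s' = (s.setVar rA x).setVar rB y) := by
    refine (Ok.of_wp ?_).mono (by simp only [Cmd.bound]; omega) fun _ _ h => h
    simp only [Cmd.wp, he, hf]
  refine (h1.seq (B' := n * 190 + 60) fun s1 hF1 hs1 => ?_).mono (by omega) fun _ _ h => h
  subst hs1
  refine (tryCmd_ok h (h.metric.nonneg hx hy) ((s.setVar rA x).setVar rB y) (by simpa using hs) (by simpa using hk) ha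
    (by simp) (by simpa [Store.Best] using hbest)).mono le_rfl fun s' _ h' => ?_
  refine ⟨h'.1, h'.2.1, fun ρ' hc => h'.2.2 ρ' ?_⟩
  simpa [Store.Covers] using hc

theorem searchCmd_ok {n k : ℕ} {d : ℕ → ℕ → ℝ} {a : Arrays} (h : Data n d a)
    (s : Store) (hs : s.var rN = n) (hk : s.var rK = k) (ha : s.arrays = a)
    (hfound : s.var rFound = 0) :
    Ok d searchCmd s (n * (n * 570 + 226) + 8) (fun s' => s'.Best n k d a ∧
      ∀ v < n, s'.Covers n k d a (d v (a.par v)) ∧ s'.Covers n k d a (d (a.tx v) (a.ty v)) ∧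
        s'.Covers n k d a (d v (a.wl v))) := by
  refine Ok.for (n := n) (T := n * 570 + 216) (fun i s' => s'.Best n k d a ∧
      ∀ v < i, s'.Covers n k d a (d v (a.par v)) ∧ s'.Covers n k d a (d (a.tx v) (a.ty v)) ∧
        s'.Covers n k d a (d v (a.wl v))) rfl rfl hs ⟨fun hf => ?_, fun v hv => by omega⟩ ?_
  · simp only [rFound] at hfound
    simp [hfound] at hf
  intro i s1 hi hF1 hI1 ⟨hbest, hcov⟩
  have arrays_eq : ∀ {s s' : Store} {p : Cmd}, Frame p s s' → p = searchCmd ∨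
      (∃ e f, p = tryAt e f) → s'.arrays = s.arrays := by
    rintro s s' p hF (rfl | ⟨e, f, rfl⟩) <;>
    simp only [Store.arrays, hF.arr aLab, hF.arr aOrd, hF.arr aPar, hF.arr aTX, hF.arr aTY,
      hF.arr aWl, hF.arr aHw]
  have a1 : s1.arrays = a := (arrays_eq hF1 (Or.inl rfl)).trans ha
  have n1 : s1.var rN = n := (hF1.var rN).trans hs
  have k1 : s1.var rK = k := (hF1.var rK).trans hk
  simp only [rI] at hI1
  refine ((tryAt_ok (x := i) (y := a.par i) h s1 n1 k1 a1 (by simpa [Exp.eval] using hI1)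
    (by simp [Exp.eval, hI1, ← a1, Store.arrays]) hi (h.span.par_lt i hi) (by decide) (by decide)
    hbest).seq (B' := n * 380 + 144) fun s2 hF2 ⟨b2, c2, p2⟩ => ?_).mono (by omega) fun _ _ h => h
  have a2 : s2.arrays = a := (arrays_eq hF2 (Or.inr ⟨_, _, rfl⟩)).trans a1
  have n2 : s2.var rN = n := (hF2.var rN).trans n1
  have k2 : s2.var rK = k := (hF2.var rK).trans k1
  have i2 : s2.var 2 = i := (hF2.var rI).trans hI1
  refine ((tryAt_ok (x := a.tx i) (y := a.ty i) h s2 n2 k2 a2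
    (by simp [Exp.eval, i2, ← a2, Store.arrays])
    (by simp [Exp.eval, i2, ← a2, Store.arrays]) (h.t_lt i hi).1 (h.t_lt i hi).2 (by decide)
    (by decide) b2).seq (B' := n * 190 + 72) fun s3 hF3 ⟨b3, c3, p3⟩ => ?_).mono (by omega)
    fun _ _ h => h
  have a3 : s3.arrays = a := (arrays_eq hF3 (Or.inr ⟨_, _, rfl⟩)).trans a2
  have n3 : s3.var rN = n := (hF3.var rN).trans n2
  have k3 : s3.var rK = k := (hF3.var rK).trans k2
  have i3 : s3.var 2 = i := (hF3.var rI).trans i2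
  refine (tryAt_ok (x := i) (y := a.wl i) h s3 n3 k3 a3 (by simpa [Exp.eval] using i3)
    (by simp [Exp.eval, i3, ← a3, Store.arrays]) hi (h.other i hi).lt (by decide)
    (by decide) b3).mono (by omega) ?_
  rintro s4 - ⟨b4, c4, p4⟩
  have e1 : (s4.setVar rI (i + 1)).Best n k d a ↔ s4.Best n k d a := by simp [Store.Best]
  have e2 : ∀ ρ, (s4.setVar rI (i + 1)).Covers n k d a ρ ↔ s4.Covers n k d a ρ := fun ρ => by
    simp [Store.Covers]
  simp only [e1, e2]
  refine ⟨b4, fun v hv => ?_⟩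
  rcases Nat.lt_succ_iff_lt_or_eq.1 hv with hvi | rfl
  · obtain ⟨q1, q2, q3⟩ := hcov v hvi
    exact ⟨p4 _ (p3 _ (p2 _ q1)), p4 _ (p3 _ (p2 _ q2)), p4 _ (p3 _ (p2 _ q3))⟩
  · exact ⟨p4 _ (p3 _ c2), p4 _ c3, c4⟩

/-- The search finds a threshold that is at most the value of any solution. -/
theorem found_le {n k : ℕ} {d : ℕ → ℕ → ℝ} {a : Arrays} (h : Data n d a) {s : Store}
    (hc : ∀ v < n, s.Covers n k d a (d v (a.par v)) ∧ s.Covers n k d a (d (a.tx v) (a.ty v)) ∧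
        s.Covers n k d a (d v (a.wl v))) {r : ℝ} {S : Finset ℕ} {σ : ℕ → ℕ}
    (hsol : Sol n a.lab d r S σ) (hS : S.card ≤ k) :
    1 ≤ s.var rFound ∧ d (s.var rBX) (s.var rBY) ≤ r := by
  classical
  set C : Finset ℝ := (Finset.range n).image (fun v => d v (a.par v)) ∪
    (Finset.range n).image (fun v => d (a.tx v) (a.ty v)) ∪
    (Finset.range n).image (fun v => d v (a.wl v)) with hC
  have hcov : ∀ ρ ∈ C, s.Covers n k d a ρ := by
    intro ρ hρ
    simp only [hC, Finset.mem_union, Finset.mem_image, Finset.mem_range] at hρ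
    rcases hρ with (⟨v, hv, rfl⟩ | ⟨v, hv, rfl⟩) | ⟨v, hv, rfl⟩
    · exact (hc v hv).1
    · exact (hc v hv).2.1
    · exact (hc v hv).2.2
  -- Node 0 is its own parent, so 0 is among the candidates.
  have hne : (C.filter (· ≤ r)).Nonempty := by
    refine ⟨d 0 (a.par 0), Finset.mem_filter.2 ⟨?_, ?_⟩⟩
    · simp only [hC, Finset.mem_union, Finset.mem_image, Finset.mem_range]
      exact Or.inl (Or.inl ⟨0, h.pos, rfl⟩)
    · rw [h.span.par_zero, h.metric.self]
      exact hsol.nonneg h.metric h.pos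
  -- No candidate lies strictly between the largest one not exceeding r and r, so the two compare
  -- alike with all candidates.
  obtain ⟨ρ, hρ, hmax⟩ := (C.filter (· ≤ r)).exists_max_image id hne
  rw [Finset.mem_filter] at hρ
  have key : ∀ x ∈ C, (x ≤ r ↔ x ≤ ρ) := fun x hx =>
    ⟨fun hxr => hmax x (Finset.mem_filter.2 ⟨hx, hxr⟩), fun hxρ => hxρ.trans hρ.2⟩
  have hA : Agree n d a ρ r := by
    intro v hv
    refine ⟨key _ ?_, key _ ?_, key _ ?_⟩ <;>
      simp only [hC, Finset.mem_union, Finset.mem_image, Finset.mem_range]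
    · exact Or.inl (Or.inl ⟨v, hv, rfl⟩)
    · exact Or.inl (Or.inr ⟨v, hv, rfl⟩)
    · exact Or.inr ⟨v, hv, rfl⟩
  obtain ⟨h1, h2⟩ := hcov ρ hρ.1 ⟨r, S, σ, hA, hsol, hS⟩
  exact ⟨h1, h2.trans hρ.2⟩

/-! ### The assignment of the nodes -/

/-- Assign every node to the nearest cluster. -/
def ownCmd : Cmd :=
  .for rV (.seq
    (.seq (.write aOwn (.var rV) (.const 0))
      (.for rU (.ite (.and (.pos (.read aIscB (.var rU)))
          (.distLe (.var rV) (.var rU) (.var rV) (.read aOwn (.var rV))))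
        (.write aOwn (.var rV) (.var rU)) .skip)))
    (.ite (.pos (.read aIscB (.var rV))) (.write aOwn (.var rV) (.var rV)) .skip))

/-- `own v` is the cluster nearest to `v`, and `v` itself if there is a cluster of `v`. -/
structure Nearest (n : ℕ) (d : ℕ → ℕ → ℝ) (isc : ℕ → ℕ) (v c : ℕ) : Prop where
  lt : c < n
  isc_eq : isc c = 1
  self : isc v = 1 → c = v
  le : ∀ m < n, isc m = 1 → d v c ≤ d v m

/-- The search starts from node 0, which must therefore be a cluster. The final write makes a
cluster own its node even when another cluster is at distance 0 from it; the parity count depends on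
this. -/
theorem ownCmd_ok {n : ℕ} {d : ℕ → ℕ → ℝ} (hd : IsMetric n d) (hn : 0 < n) (s : Store)
    (hs : s.var rN = n) (h0 : s.arr aIscB 0 = 1) (hle : ∀ v < n, s.arr aIscB v ≤ 1) :
    Ok d ownCmd s (n * (n * 40 + 40) + 8)
      (fun s' => ∀ v < n, Nearest n d (s.arr aIscB) v (s'.arr aOwn v)) := by
  refine Ok.for (n := n) (T := n * 40 + 30) (fun i s' => ∀ v < i, Nearest n d (s.arr aIscB) v
    (s'.arr aOwn v)) rfl rfl hs (fun v hv => absurd hv (Nat.not_lt_zero v)) ?_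
  intro i s1 hi hF1 hV1 hI
  have c1 : s1.arr aIscB = s.arr aIscB := hF1.arr aIscB
  have n1 : s1.var rN = n := (hF1.var rN).trans hs
  have h2 : Ok d (.write aOwn (.var rV) (.const 0)) s1 3 (fun s' => s'.arr aOwn i = 0 ∧
      ∀ v, v ≠ i → s'.arr aOwn v = s1.arr aOwn v) := by
    refine (Ok.of_wp ?_).mono (B := Cmd.bound _) (by decide) fun _ _ h => h
    simp only [rV] at hV1
    simp +contextual [Cmd.wp, Exp.eval, hV1]
  have h3 : Ok d (.seq (.write aOwn (.var rV) (.const 0))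
      (.for rU (.ite (.and (.pos (.read aIscB (.var rU)))
          (.distLe (.var rV) (.var rU) (.var rV) (.read aOwn (.var rV))))
        (.write aOwn (.var rV) (.var rU)) .skip))) s1 (n * 40 + 11) (fun s' =>
      (∀ v, v ≠ i → s'.arr aOwn v = s1.arr aOwn v) ∧ s'.arr aOwn i < n ∧
      s.arr aIscB (s'.arr aOwn i) = 1 ∧
      ∀ m < n, s.arr aIscB m = 1 → d i (s'.arr aOwn i) ≤ d i m) := by
    refine (h2.seq (B' := n * 40 + 8) fun s2 hF2 ⟨o2, o2'⟩ => ?_).mono (by omega) fun _ _ h => h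
    have c2 : s2.arr aIscB = s.arr aIscB := (hF2.arr aIscB).trans c1
    refine Ok.for (n := n) (T := 30) (fun j s' =>
      (∀ v, v ≠ i → s'.arr aOwn v = s1.arr aOwn v) ∧ s'.arr aOwn i < n ∧
      s.arr aIscB (s'.arr aOwn i) = 1 ∧
      ∀ m < j, s.arr aIscB m = 1 → d i (s'.arr aOwn i) ≤ d i m) rfl rfl ((hF2.var rN).trans n1)
      ⟨o2', by simpa using o2.trans_lt hn, by simpa [o2] using h0, fun m hm => by omega⟩ ?_
    intro j s3 hj hF3 hU3 ⟨q1, q2, q3, q4⟩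
    have c3 : s3.arr aIscB = s.arr aIscB := (hF3.arr aIscB).trans c2
    have v3 : s3.var rV = i := ((hF3.var rV).trans (hF2.var rV)).trans hV1
    refine (Ok.of_wp ?_).mono (B := Cmd.bound _) (by decide) fun _ _ h => h
    simp only [rV, rU, aIscB] at hU3 v3 c3
    simp only [Cmd.wp, Test.Holds, Exp.eval, rV, rU, aIscB, hU3, v3, c3, Store.setVar_arr]
    refine ⟨fun ⟨b1, b2⟩ => ?_, fun b => ?_⟩
    · have b1' : s.arr aIscB j = 1 := le_antisymm (hle j hj) b1
      have e : (s3.setArr aOwn i j).arr aOwn i = j := by simp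
      rw [e]
      refine ⟨fun v hv => by simpa [hv] using q1 v hv, hj, b1', fun m hm hm1 => ?_⟩
      rcases Nat.lt_succ_iff_lt_or_eq.1 hm with h | h
      · exact b2.trans (q4 m h hm1)
      · rw [h]
    · refine ⟨q1, q2, q3, fun m hm hm1 => ?_⟩
      rcases Nat.lt_succ_iff_lt_or_eq.1 hm with h | h
      · exact q4 m h hm1
      · subst h
        by_contra hcon
        exact b ⟨hm1.ge, (not_le.1 hcon).le⟩
  refine (h3.seq (B' := 10) fun s4 hF4 ⟨q1, q2, q3, q4⟩ => ?_).mono (by omega) fun _ _ h => h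
  have c4 : s4.arr aIscB = s.arr aIscB := (hF4.arr aIscB).trans c1
  have v4 : s4.var rV = i := (hF4.var rV).trans hV1
  refine (Ok.of_wp ?_).mono (B := Cmd.bound _) (by decide) fun _ _ h => h
  simp only [rV, aIscB] at v4 c4
  simp only [Cmd.wp, Test.Holds, Exp.eval, rV, aIscB, v4, c4, Store.setVar_arr]
  refine ⟨fun b v hv => ?_, fun b v hv => ?_⟩
  · rcases Nat.lt_succ_iff_lt_or_eq.1 hv with h | h
    · have := hI v h
      rw [← q1 v h.ne] at this
      simpa [h.ne] using this
    · subst h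
      have e : (s4.setArr aOwn v v).arr aOwn v = v := by simp
      rw [e]
      exact ⟨hi, le_antisymm (hle v hi) b, fun _ => rfl, fun m hm _ => by
        rw [hd.self]; exact hd.nonneg hi hm⟩
  · rcases Nat.lt_succ_iff_lt_or_eq.1 hv with h | h
    · rw [q1 v h.ne]; exact hI v h
    · subst h
      exact ⟨q2, q3, fun h1 => absurd h1.ge b, q4⟩

theorem sum_add_sum_of_flip {s : Finset ℕ} {f g : ℕ → ℕ} {k : ℕ} (hk : k ∈ s)
    (hfg : ∀ i ∈ s, i ≠ k → g i = f i) :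
    (∑ i ∈ s, g i + ∑ i ∈ s, f i) % 2 = (g k + f k) % 2 := by
  rw [← Finset.add_sum_erase s _ hk, ← Finset.add_sum_erase s f hk]
  have : ∑ i ∈ s.erase k, g i = ∑ i ∈ s.erase k, f i :=
    Finset.sum_congr rfl fun i hi => hfg i (Finset.mem_of_mem_erase hi) (Finset.ne_of_mem_erase hi)
  omega

/-- Move nodes to the cluster of their parents, where the parities require it. -/
def assignCmd : Cmd :=
  .seq (.assign rL (.var rN))
    (.down rL (.seq (.assign rV (nodeAt rL))
      (.ite (.pos (.read aZB (.var rV)))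
        (.seq (.assign rU (.read aPar (.var rV)))
          (.seq (.write aZB (.var rU) (.sub (.const 1) (.read aZB (.var rU))))
            (.write aSig (.var rV) (.read aOwn (.var rU)))))
        (.write aSig (.var rV) (.read aOwn (.var rV))))))

/-- The nodes from position `l` on have been assigned to clusters. -/
structure Moves (n : ℕ) (d : ℕ → ℕ → ℝ) (a : Arrays) (ρ : ℝ) (own z₀ : ℕ → ℕ) (l : ℕ)
    (z sig : ℕ → ℕ) : Prop where
  z_le : ∀ v < n, z v ≤ 1
  sig_eq : ∀ i, l ≤ i → i < n → ∃ p < n, d (a.ord i) p ≤ ρ ∧ sig (a.ord i) = own p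
  even : ∀ b < l, IsStart d a ρ (a.ord b) → Even (∑ i ∈ Finset.Ico b l, z (a.ord i))
  count : ∀ c < n, (∑ i ∈ Finset.Ico l n, (if sig (a.ord i) = c then 1 else 0) +
      ∑ i ∈ Finset.Ico 0 l, if own (a.ord i) = c then 1 + z (a.ord i) else 0) % 2 =
    (∑ i ∈ Finset.Ico 0 n, if own (a.ord i) = c then 1 + z₀ (a.ord i) else 0) % 2

/-! ### Parity correction along the spanning tree. -/

section moves

variable {n : ℕ} {d : ℕ → ℕ → ℝ} {a : Arrays} {ρ : ℝ} {own z₀ z sig z' sig' : ℕ → ℕ} {l : ℕ}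

/-- In `count`, an unprocessed node weighs 1 + z at its own cluster. For z = 0 this is exactly the
one node that is now assigned there. -/
theorem Moves.stay (h : Data n d a) (hρ : 0 ≤ ρ) (hM : Moves n d a ρ own z₀ (l + 1) z sig)
    (hl : l < n) (hz : z (a.ord l) = 0)
    (hsig : ∀ w, sig' w = if w = a.ord l then own (a.ord l) else sig w) :
    Moves n d a ρ own z₀ l z sig' := by
  have s1 : sig' (a.ord l) = own (a.ord l) := by rw [hsig, if_pos rfl]
  have s2 : ∀ i, l + 1 ≤ i → i < n → sig' (a.ord i) = sig (a.ord i) := fun i hi hin => by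
    rw [hsig, if_neg (h.ord_ne hin hl (by omega))]
  refine ⟨hM.z_le, fun i hi hin => ?_, fun b hb hbs => ?_, fun c hc => ?_⟩
  · rcases hi.eq_or_lt with rfl | hi'
    · exact ⟨_, h.span.lt l hin, by rw [h.metric.self]; exact hρ, s1⟩
    · rw [s2 i hi' hin]; exact hM.sig_eq i hi' hin
  · have := hM.even b (by omega) hbs
    rwa [Finset.sum_Ico_succ_top hb.le, hz, add_zero] at this
  · have := hM.count c hc
    rw [Finset.sum_Ico_succ_top (Nat.zero_le l), hz] at this
    rw [← this, Finset.sum_eq_sum_Ico_succ_bot hl, s1, Finset.sum_congr rfl fun i hi => by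
      rw [s2 i (Finset.mem_Ico.1 hi).1 (Finset.mem_Ico.1 hi).2]]
    congr 1
    ring

/-- When a start is reached, its component has shrunk to that node alone, and an even total leaves
no defect. -/
theorem Moves.not_start (hM : Moves n d a ρ own z₀ (l + 1) z sig)
    (hz : z (a.ord l) = 1) : ¬ IsStart d a ρ (a.ord l) := fun hs => by
  have := hM.even l (Nat.lt_succ_self l) hs
  rw [Nat.Ico_succ_singleton, Finset.sum_singleton, hz] at this
  exact absurd this (by decide)

/-- A node with z = 1 weighs 2 at its own cluster, which vanishes modulo 2. It adds one to the
cluster of its parent, and flipping z at the parent changes the weight pending there by one, which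
compensates. -/
theorem Moves.move (h : Data n d a) (hM : Moves n d a ρ own z₀ (l + 1) z sig)
    (hl : l < n) (hz : z (a.ord l) = 1)
    (hsig : ∀ w, sig' w = if w = a.ord l then own (a.par (a.ord l)) else sig w)
    (hz' : ∀ w, z' w = if w = a.par (a.ord l) then 1 - z w else z w) :
    Moves n d a ρ own z₀ l z' sig' := by
  have hns : 1 ≤ a.ord l ∧ d (a.ord l) (a.par (a.ord l)) ≤ ρ := by
    have := hM.not_start hz
    rwa [IsStart, not_not] at this
  have hl0 : 0 < l := by
    by_contra h0
    obtain rfl : l = 0 := by omega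
    rw [h.span.zero] at hns
    exact absurd hns.1 (by decide)
  obtain ⟨j, hj, hp⟩ := h.span.par_mem l hl0 hl
  rw [hp] at hsig hz' hns
  have hjn : j < n := by omega
  have s1 : sig' (a.ord l) = own (a.ord j) := by rw [hsig, if_pos rfl]
  have s2 : ∀ i, l + 1 ≤ i → i < n → sig' (a.ord i) = sig (a.ord i) := fun i hi hin => by
    rw [hsig, if_neg (h.ord_ne hin hl (by omega))]
  have z1 : z' (a.ord j) = 1 - z (a.ord j) := by rw [hz', if_pos rfl]
  have z2 : ∀ i, i < n → i ≠ j → z' (a.ord i) = z (a.ord i) := fun i hin hij => by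
    rw [hz', if_neg (h.ord_ne hin hjn hij)]
  have zj := hM.z_le _ (h.span.lt j hjn)
  refine ⟨fun v hv => ?_, fun i hi hin => ?_, fun b hb hbs => ?_, fun c hc => ?_⟩
  · rw [hz']
    split
    · omega
    · exact hM.z_le v hv
  · rcases hi.eq_or_lt with rfl | hi'
    · exact ⟨_, h.span.lt j hjn, hns.2, s1⟩
    · rw [s2 i hi' hin]; exact hM.sig_eq i hi' hin
  · have := hM.even b (by omega) hbs
    rw [Finset.sum_Ico_succ_top hb.le, hz] at this
    -- The edge to the parent is short, so it does not cross a start, and the flip stays within the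
    -- interval that is summed.
    have hbj : b ≤ j := by
      by_contra hbj
      exact absurd hns.2 (not_le.2 (h.cross hbs (not_le.1 hbj) hb.le hl))
    rw [Nat.even_iff] at this ⊢
    refine even_sum_of_flip (f := fun i => z (a.ord i)) (Finset.mem_Ico.2 ⟨hbj, hj⟩)
      (fun i hi hij => z2 i (by rw [Finset.mem_Ico] at hi; omega) hij) (by rw [z1]; omega) (by omega)
  · have h1 := hM.count c hc
    rw [Finset.sum_Ico_succ_top (Nat.zero_le l), hz] at h1
    rw [← h1, Finset.sum_eq_sum_Ico_succ_bot hl, s1, Finset.sum_congr rfl fun i hi => by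
      rw [s2 i (Finset.mem_Ico.1 hi).1 (Finset.mem_Ico.1 hi).2]]
    have h2 := sum_add_sum_of_flip (s := Finset.Ico 0 l) (k := j)
      (f := fun i => if own (a.ord i) = c then 1 + z (a.ord i) else 0)
      (g := fun i => if own (a.ord i) = c then 1 + z' (a.ord i) else 0)
      (Finset.mem_Ico.2 ⟨Nat.zero_le j, hj⟩)
      (fun i hi hij => by simp only [z2 i (by rw [Finset.mem_Ico] at hi; omega) hij])
    simp only [z1] at h2
    split_ifs at h2 ⊢ <;> omega

end moves

theorem assignCmd_ok {n : ℕ} {d : ℕ → ℕ → ℝ} {a : Arrays} {ρ : ℝ} {rep isc z own : ℕ → ℕ}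
    (h : Data n d a) (hρ : 0 ≤ ρ)
    (hG : Good n d a ρ rep isc z) (hown : ∀ v < n, Nearest n d isc v (own v)) (s : Store)
    (hs : s.var rN = n) (ha : s.arrays = a) (hz : s.arr aZB = z) (ho : s.arr aOwn = own) :
    Ok d assignCmd s (n * 48 + 6) (fun s' =>
      (∀ v < n, ∃ p < n, d v p ≤ ρ ∧ s'.arr aSig v = own p) ∧
      ∀ c < n, isc c = 1 →
        (∑ v ∈ Finset.range n, if s'.arr aSig v = c then 1 else 0) % 2 = (1 + z c) % 2) := by
  have h1 : Ok d (.assign rL (.var rN)) s 2 (fun s' => s'.var rL = n) := by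
    refine (Ok.of_wp ?_).mono (B := Cmd.bound _) (by decide) fun _ _ h => h
    simp only [rN] at hs
    simp [Cmd.wp, Exp.eval, hs]
  refine (h1.seq (B' := n * 48 + 4) fun s1 hF1 hL1 => ?_).mono (by omega) fun _ _ h => h
  have z1 : s1.arr aZB = z := (hF1.arr aZB).trans hz
  refine (Ok.down (T := 40) (fun l s' => Moves n d a ρ own z l (s'.arr aZB) (s'.arr aSig)) rfl hL1
    ?_ ?_).mono le_rfl ?_
  · rw [z1]
    exact ⟨fun v hv => (hG.loc v hv).z_le, fun i _ _ => by omega, fun b hb hbs => hG.even b hb hbs,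
      fun c hc => by simp⟩
  · intro l s2 hl hF2 hL2 hM
    have o2 : s2.arr 2 = a.ord := by
      rw [← ha]; exact (hF2.arr aOrd).trans (hF1.arr aOrd)
    have p2 : s2.arr 4 = a.par := by
      rw [← ha]; exact (hF2.arr aPar).trans (hF1.arr aPar)
    have w2 : s2.arr 12 = own := ((hF2.arr aOwn).trans (hF1.arr aOwn)).trans ho
    refine (Ok.of_wp ?_).mono (B := Cmd.bound _) (by decide) fun _ _ h => h
    simp only [Cmd.wp, Test.Holds, Exp.eval, rV, rL, rU, aOrd, aZB, aPar, aOwn, aSig, Store.setVar_var,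
      Store.setVar_arr, Store.setArr_var, Nat.reduceEqDiff, if_true, if_false, o2, p2]
    refine ⟨fun b => ?_, fun b => ?_⟩
    · have hz1 : s2.arr aZB (a.ord l) = 1 := le_antisymm (hM.z_le _ (h.span.lt l hl)) b
      refine hM.move h hl hz1 (fun w => ?_) (fun w => ?_)
      · simp [w2]
      · by_cases hw : w = a.par (a.ord l) <;> simp [hw]
    · have hz1 : s2.arr aZB (a.ord l) = 0 := by simp only [aZB]; omega
      rw [Store.setArr_arr_ne _ _ _ _ 13 (by decide)]
      refine hM.stay h hρ hl hz1 (fun w => ?_)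
      simp [w2]
  · intro s2 hF2 hM
    refine ⟨fun v hv => ?_, fun c hc hcc => ?_⟩
    · obtain ⟨l, hl, rfl⟩ := h.span.surj v hv
      exact hM.sig_eq l (Nat.zero_le _) hl
    · have := hM.count c hc
      rw [h.sum_ord (fun v => if s2.arr aSig v = c then 1 else 0),
        h.sum_ord (fun v => if own v = c then 1 + z v else 0)] at this
      simp only [Finset.Ico_self, Finset.sum_empty, add_zero] at this
      rw [this, ← Finset.add_sum_erase _ _ (Finset.mem_range.2 hc),
        if_pos ((hown c hc).self hcc)]
      -- A node other than c that is owned by c is not a cluster, so it has z = 1 and weighs 2; only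
      -- c itself matters, with weight 1 + z c.
      have hev : Even (∑ v ∈ (Finset.range n).erase c, if own v = c then 1 + z v else 0) := by
        refine Finset.even_sum _ fun v hv => ?_
        rw [Finset.mem_erase, Finset.mem_range] at hv
        split
        · next hvc =>
          have hv0 : isc v = 0 := by
            have h5 := (hG.loc v hv.2).isc_le
            by_contra h6
            exact hv.1 (((hown v hv.2).self (by omega)).symm.trans hvc)
          rw [(hG.loc v hv.2).z_eq hv0]
          decide
        · exact Even.zero
      rw [Nat.even_iff] at hev
      omega

/-- Output the centers and the assignment. -/
def outCmd : Cmd :=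
  .seq
    (.for rV (.seq (.write aSig (.var rV) (.read aRepB (.read aSig (.var rV))))
      (.write aLab (.var rV) (.const 0))))
    (.seq
      (.for rV (.ite (.pos (.read aIscB (.var rV))) (.write aLab (.read aRepB (.var rV)) (.const 1))
        .skip))
      (.assign rN (.const 1)))

/-- Until now nodes were assigned to clusters; here clusters are replaced by their centers. The
labels are no longer needed, and their array receives the indicator of the centers. -/
theorem outCmd_ok {n : ℕ} {d : ℕ → ℕ → ℝ} (s : Store) (hs : s.var rN = n) :
    Ok d outCmd s (n * 50 + 20) (fun s' => s'.var rN = 1 ∧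
      (∀ v < n, s'.arr aSig v = s.arr aRepB (s.arr aSig v)) ∧
      ∀ w < n, (s'.arr aLab w = 1 ∧ ∃ v < n, 1 ≤ s.arr aIscB v ∧ s.arr aRepB v = w) ∨
        (s'.arr aLab w = 0 ∧ ¬ ∃ v < n, 1 ≤ s.arr aIscB v ∧ s.arr aRepB v = w)) := by
  have h1 : Ok d (.for rV (.seq (.write aSig (.var rV) (.read aRepB (.read aSig (.var rV))))
      (.write aLab (.var rV) (.const 0)))) s (n * 20 + 8) (fun s' =>
        (∀ v < n, s'.arr aSig v = s.arr aRepB (s.arr aSig v) ∧ s'.arr aLab v = 0) ∧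
        ∀ v, n ≤ v → s'.arr aSig v = s.arr aSig v) := by
    refine Ok.for (T := 10) (fun i s' =>
        (∀ v < i, s'.arr aSig v = s.arr aRepB (s.arr aSig v) ∧ s'.arr aLab v = 0) ∧
        ∀ v, i ≤ v → s'.arr aSig v = s.arr aSig v) rfl rfl hs ⟨fun v hv => by omega, fun v _ => rfl⟩ ?_
    intro i s1 hi hF hV ⟨q1, q2⟩
    refine (Ok.of_wp ?_).mono (B := Cmd.bound _) (by decide) fun _ _ h => h
    have e1 : s1.arr 14 = s.arr 14 := hF.arr aRepB
    have e2 : s1.arr 1 i = s.arr 1 i := q2 i le_rfl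
    simp only [rV] at hV
    refine ⟨fun v hv => ?_, fun v hv => ?_⟩
    · rcases Nat.lt_succ_iff_lt_or_eq.1 hv with h | h
      · simpa [Exp.eval, hV, h.ne] using q1 v h
      · simp [Exp.eval, hV, h, e1, e2]
    · have : v ≠ i := by omega
      simpa [Exp.eval, hV, this] using q2 v (by omega)
  refine (h1.seq (B' := n * 30 + 12) fun s1 hF1 ⟨q1, _⟩ => ?_).mono (by omega) fun _ _ h => h
  have e1 : s1.arr aRepB = s.arr aRepB := hF1.arr aRepB
  have e2 : s1.arr aIscB = s.arr aIscB := hF1.arr aIscB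
  have h2 : Ok d (.for rV (.ite (.pos (.read aIscB (.var rV)))
      (.write aLab (.read aRepB (.var rV)) (.const 1)) .skip)) s1 (n * 30 + 8) (fun s' =>
      ∀ w < n, (s'.arr aLab w = 1 ∧ ∃ v < n, 1 ≤ s.arr aIscB v ∧ s.arr aRepB v = w) ∨
        (s'.arr aLab w = 0 ∧ ¬ ∃ v < n, 1 ≤ s.arr aIscB v ∧ s.arr aRepB v = w)) := by
    refine Ok.for (T := 20) (fun i s' =>
      ∀ w < n, (s'.arr aLab w = 1 ∧ ∃ v < i, 1 ≤ s.arr aIscB v ∧ s.arr aRepB v = w) ∨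
        (s'.arr aLab w = 0 ∧ ¬ ∃ v < i, 1 ≤ s.arr aIscB v ∧ s.arr aRepB v = w)) rfl rfl
      ((hF1.var rN).trans hs) (fun w hw => Or.inr ⟨(q1 w hw).2, by simp⟩) ?_
    intro i s2 hi hF2 hV2 hI
    have e3 : s2.arr 14 = s.arr 14 := (hF2.arr aRepB).trans e1
    have e4 : s2.arr 15 = s.arr 15 := (hF2.arr aIscB).trans e2
    simp only [rV] at hV2
    refine (Ok.of_wp ?_).mono (B := Cmd.bound _) (by decide) fun _ _ h => h
    simp only [Cmd.wp, Test.Holds, Exp.eval, rV, aIscB, aRepB, aLab, hV2, e3, e4, Store.setVar_arr]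
    refine ⟨fun b w hw => ?_, fun b w hw => ?_⟩
    · by_cases hwi : w = s.arr 14 i
      · left
        exact ⟨by simp [hwi], i, Nat.lt_succ_self i, b, hwi.symm⟩
      · rcases hI w hw with ⟨h3, v, h4, h5⟩ | ⟨h3, h4⟩
        · left
          exact ⟨by simpa [hwi] using h3, v, by omega, h5⟩
        · right
          refine ⟨by simpa [hwi] using h3, ?_⟩
          rintro ⟨v, hv, h5, h6⟩
          rcases Nat.lt_succ_iff_lt_or_eq.1 hv with h | h
          · exact h4 ⟨v, h, h5, h6⟩
          · exact hwi (by rw [← h6, h])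
    · rcases hI w hw with ⟨h3, v, h4, h5⟩ | ⟨h3, h4⟩
      · left
        exact ⟨h3, v, by omega, h5⟩
      · right
        refine ⟨h3, ?_⟩
        rintro ⟨v, hv, h5, h6⟩
        rcases Nat.lt_succ_iff_lt_or_eq.1 hv with h | h
        · exact h4 ⟨v, h, h5, h6⟩
        · exact b (by rw [← h]; exact h5)
  refine (h2.seq (B' := 4) fun s2 hF2 h2 => ?_).mono (by omega) fun _ _ h => h
  refine (Ok.of_wp ?_).mono (B := Cmd.bound _) (by decide) fun _ _ h => h
  have e5 : s2.arr aSig = s1.arr aSig := hF2.arr aSig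
  refine ⟨by simp [Exp.eval], fun v hv => ?_, h2⟩
  change s2.arr aSig v = _
  rw [e5, (q1 v hv).1]

/-! ### The algorithm -/

/-- The approximation algorithm. -/
def mainCmd : Cmd :=
  .ite (.pos (.var rN))
    (.seq farCmd (.seq nearCmd (.seq labelCmd (.seq searchCmd
      (.ite (.pos (.var rFound)) (.seq ownCmd (.seq assignCmd outCmd)) (.assign rN (.const 0)))))))
    (.assign rN (.const 1))

/-! ### Passing between instances on `Fin n` and functions on the natural numbers. -/

variable {n : ℕ} (I : Instance n)

theorem Instance.matrix_eq (u v : Fin n) : I.matrix u v = I.c u v := by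
  simp [Instance.matrix]

theorem Instance.isMetric_matrix : IsMetric n I.matrix where
  self u := by
    unfold Instance.matrix
    split
    · exact I.c_self _
    · rfl
  symm u v := by
    unfold Instance.matrix
    by_cases hu : u < n <;> by_cases hv : v < n <;> simp [hu, hv]
    exact I.c_symm _ _
  tri u v w hu hv hw := by
    simp only [Instance.matrix, hu, hv, hw, and_self, dite_true]
    exact I.c_triangle _ _ _

theorem Instance.input_lab (v : Fin n) : I.input.arr aLab v = (I.π v).code := by
  simp [Instance.input]

theorem Label.code_le (l : Label) : l.code ≤ 2 := by cases l <;> decide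

theorem card_filter_range_eq (p : ℕ → Prop) [DecidablePred p] :
    ((Finset.range n).filter p).card = (Finset.univ.filter fun v : Fin n => p v).card := by
  rw [Finset.card_filter, Finset.card_filter, Finset.sum_range]

theorem Instance.IsSolution.sol {S : Finset (Fin n)} {σ : Fin n → Fin n} (h : I.IsSolution S σ) :
    Sol n (I.input.arr aLab) I.matrix (I.cost σ) (S.map Fin.valEmbedding)
      (fun v => if hv : v < n then σ ⟨v, hv⟩ else 0) := by
  have hcard : ∀ u : Fin n, ((Finset.range n).filter fun v =>
      (if hv : v < n then (σ ⟨v, hv⟩ : ℕ) else 0) = u).card =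
      (Finset.univ.filter fun v => σ v = u).card := by
    intro u
    rw [card_filter_range_eq]
    simp [Fin.ext_iff]
  refine ⟨fun u hu => ?_, fun v hv => ?_, fun u hu hl => ?_, fun u hu hl => ?_, fun v hv => ?_⟩
  · obtain ⟨w, _, rfl⟩ := Finset.mem_map.1 hu
    exact w.2
  · simp only [hv, dite_true]
    exact Finset.mem_map_of_mem Fin.valEmbedding (h.mem ⟨v, hv⟩)
  · obtain ⟨w, hw, rfl⟩ := Finset.mem_map.1 hu
    rw [Fin.valEmbedding_apply, hcard]
    rw [Fin.valEmbedding_apply, I.input_lab] at hl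
    refine h.odd w hw ?_
    cases hπ : I.π w <;> simp_all [Label.code]
  · obtain ⟨w, hw, rfl⟩ := Finset.mem_map.1 hu
    rw [Fin.valEmbedding_apply, hcard]
    rw [Fin.valEmbedding_apply, I.input_lab] at hl
    refine h.even w hw ?_
    cases hπ : I.π w <;> simp_all [Label.code]
  · simp only [hv, dite_true]
    rw [I.isMetric_matrix.symm]
    exact (I.matrix_eq (σ ⟨v, hv⟩) ⟨v, hv⟩).le.trans
      (le_ciSup (f := fun v => I.c (σ v) v) (Set.finite_range _).bddAbove ⟨v, hv⟩)

/-- Suitable clusters yield a solution of value at most `4ρ`. -/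
theorem Good.exists_solution {a : Arrays} {ρ : ℝ} {rep isc z own sig : ℕ → ℕ}
    (h : Data n I.matrix a) (hlab : a.lab = I.input.arr aLab) (hρ : 0 ≤ ρ)
    (hG : Good n I.matrix a ρ rep isc z) (hk : ∑ v ∈ Finset.range n, isc v ≤ I.k)
    (hown : ∀ v < n, Nearest n I.matrix isc v (own v))
    (hsig : ∀ v < n, ∃ p < n, I.matrix v p ≤ ρ ∧ sig v = own p)
    (hcount : ∀ c < n, isc c = 1 →
      (∑ v ∈ Finset.range n, if sig v = c then 1 else 0) % 2 = (1 + z c) % 2)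
    {s : Store} (h1 : ∀ v < n, s.arr aSig v = rep (sig v))
    (h0 : ∀ w < n, (s.arr aLab w = 1 ∧ ∃ v < n, 1 ≤ isc v ∧ rep v = w) ∨
        (s.arr aLab w = 0 ∧ ¬ ∃ v < n, 1 ≤ isc v ∧ rep v = w)) :
    ∃ S σ, s.Encodes S σ ∧ I.IsSolution S σ ∧ I.cost σ ≤ 4 * ρ := by
  classical
  have hd := I.isMetric_matrix
  have hc : ∀ v < n, sig v < n ∧ isc (sig v) = 1 := by
    intro v hv
    obtain ⟨p, hp, _, he⟩ := hsig v hv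
    rw [he]
    exact ⟨(hown p hp).lt, (hown p hp).isc_eq⟩
  have hr : ∀ v < n, rep (sig v) < n := fun v hv => (hG.loc _ (hc v hv).1).rep_lt
  let S : Finset (Fin n) := Finset.univ.filter fun w => ∃ v < n, 1 ≤ isc v ∧ rep v = w
  let σ : Fin n → Fin n := fun v => ⟨rep (sig v), hr v v.2⟩
  have hcard : ∀ c < n, isc c = 1 → ∀ u : Fin n, rep c = u →
      (Finset.univ.filter fun v => σ v = u).card % 2 = (1 + z c) % 2 := by
    intro c hcn hc1 u hu
    rw [← hcount c hcn hc1, ← Finset.card_filter, card_filter_range_eq]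
    congr 2
    ext v
    simp only [Finset.mem_filter, Finset.mem_univ, true_and, σ, Fin.ext_iff, ← hu]
    -- Distinct clusters have distinct centers, so the nodes at a center are those of a single
    -- cluster, and its parity is the one that was arranged.
    exact ⟨fun he => hG.inj _ (hc v v.2).1 _ hcn (hc v v.2).2 hc1 he, fun he => by rw [he]⟩
  refine ⟨S, σ, fun v => ⟨?_, h1 v v.2⟩, ⟨?_, fun v => ?_, fun u hu hl => ?_, fun u hu hl => ?_⟩, ?_⟩
  · rcases h0 v v.2 with ⟨h2, h3⟩ | ⟨h2, h3⟩
    · rw [if_pos (by simpa [S] using h3)]; exact h2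
    · rw [if_neg (by simpa [S] using h3)]; exact h2
  · calc S.card = (S.map Fin.valEmbedding).card := (Finset.card_map _).symm
      _ ≤ (((Finset.range n).filter fun v => 1 ≤ isc v).image rep).card := by
        refine Finset.card_le_card fun u hu => ?_
        obtain ⟨w, hw, rfl⟩ := Finset.mem_map.1 hu
        obtain ⟨v, hv, hv1, hv2⟩ := (Finset.mem_filter.1 hw).2
        exact Finset.mem_image.2 ⟨v, Finset.mem_filter.2 ⟨Finset.mem_range.2 hv, hv1⟩, hv2⟩
      _ ≤ ((Finset.range n).filter fun v => 1 ≤ isc v).card := Finset.card_image_le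
      _ = ∑ v ∈ Finset.range n, if 1 ≤ isc v then 1 else 0 := Finset.card_filter _ _
      _ ≤ ∑ v ∈ Finset.range n, isc v := Finset.sum_le_sum fun v _ => by split <;> omega
      _ ≤ I.k := hk
  · exact Finset.mem_filter.2 ⟨Finset.mem_univ _, sig v, (hc v v.2).1, (hc v v.2).2.ge, rfl⟩
  · obtain ⟨c, hcn, hc1, hc2⟩ := (Finset.mem_filter.1 hu).2
    have hc1' : isc c = 1 := le_antisymm (hG.loc c hcn).isc_le hc1
    have h2 := (hG.loc c hcn).rep_lab hc1'
    rw [hc2, hlab, I.input_lab, hl] at h2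
    rw [Nat.odd_iff, hcard c hcn hc1' u hc2]
    simp only [Label.code] at h2
    omega
  · obtain ⟨c, hcn, hc1, hc2⟩ := (Finset.mem_filter.1 hu).2
    have hc1' : isc c = 1 := le_antisymm (hG.loc c hcn).isc_le hc1
    have h2 := (hG.loc c hcn).rep_lab hc1'
    rw [hc2, hlab, I.input_lab, hl] at h2
    rw [Nat.even_iff, hcard c hcn hc1' u hc2]
    simp only [Label.code] at h2
    omega
  · have : Nonempty (Fin n) := ⟨⟨0, h.pos⟩⟩
    refine ciSup_le fun v => ?_
    obtain ⟨p, hp, hvp, he⟩ := hsig v v.2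
    obtain ⟨m, hm, hmM, hpm⟩ := h.cover ρ hρ p hp
    have h2 := (hown p hp).le m hm ((hG.loc m hm).isc_eq hmM)
    have hon := (hown p hp).lt
    have hl := hG.loc _ hon
    have h3 := hl.rep_dist
    -- The bound is ρ + 2ρ + ρ: from v to the node p to whose cluster it was moved, from p to its
    -- nearest cluster by `cover`, and from there to the center.
    have h4 := hd.tri v p (own p) v.2 hp hon
    have h5 := hd.tri v (own p) (rep (own p)) v.2 hon hl.rep_lt
    rw [← I.matrix_eq, hd.symm]
    change I.matrix v (rep (sig v)) ≤ _
    rw [he]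
    linarith

theorem isApproxAlgorithm_mainCmd :
    IsApproxAlgorithm 6 (fun n => n * (n * 790 + 612) + 120) mainCmd := by
  intro n I
  suffices H : Ok I.matrix mainCmd I.input (n * (n * 790 + 612) + 120)
      (fun s => I.IsCorrectAnswer 6 s) from H
  have hN : I.input.var rN = n := by simp [Instance.input]
  have hK : I.input.var rK = I.k := by simp [Instance.input]
  refine (Ok.ite (B := n * (n * 790 + 612) + 116) (fun hn => ?_) (fun hn => ?_)).mono
    (by simp only [Test.time, Exp.time]; omega) fun _ _ h => h
  · have hn : 0 < n := by rw [← hN]; exact hn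
    have hd := I.isMetric_matrix
    have hzero : ∀ A, A ≠ 0 → ∀ v, I.input.arr A v = 0 := fun A hA v => by
      simp [Instance.input, hA]
    refine ((farCmd_ok hd hn I.input hN (hzero aTX (by decide)) (hzero aTY (by decide))).seq
      (B' := n * (n * 705 + 498) + 100) fun s1 hF1 ⟨ht, hsc⟩ => ?_).mono (by ring_nf; omega)
      fun _ _ h => h
    have n1 : s1.var rN = n := (hF1.var rN).trans hN
    refine ((nearCmd_ok hn s1 n1 (fun v => by
      rw [hF1.arr aPar]; exact hzero aPar (by decide) v)).seq
      (B' := n * (n * 660 + 404) + 84) fun s2 hF2 hspan => ?_).mono (by ring_nf; omega)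
      fun _ _ h => h
    have n2 : s2.var rN = n := (hF2.var rN).trans n1
    refine ((labelCmd_ok hn s2 n2 (fun v => by
      rw [hF2.arr aWl, hF1.arr aWl]; exact hzero aWl (by decide) v) (fun v => by
      rw [hF2.arr aHw, hF1.arr aHw]; exact hzero aHw (by decide) v)).seq
      (B' := n * (n * 610 + 364) + 76) fun s3 hF3 hoth => ?_).mono (by ring_nf; omega)
      fun _ _ h => h
    have n3 : s3.var rN = n := (hF3.var rN).trans n2
    have k3 : s3.var rK = I.k := (((hF3.var rK).trans (hF2.var rK)).trans (hF1.var rK)).trans hK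
    have l2 : s2.arr aLab = I.input.arr aLab := (hF2.arr aLab).trans (hF1.arr aLab)
    have l3 : s3.arr aLab = I.input.arr aLab := (hF3.arr aLab).trans l2
    have hD : Data n I.matrix s3.arrays := by
      refine ⟨hn, hd, fun v hv => ?_, ?_, ?_, ?_, ?_, ?_⟩
      · change s3.arr aLab v ≤ 2
        rw [l3, I.input_lab ⟨v, hv⟩]
        exact Label.code_le _
      · change Spanning n I.matrix (s3.arr aOrd) (s3.arr aPar)
        rw [hF3.arr aOrd, hF3.arr aPar]
        exact hspan
      · change ∀ v < n, s3.arr aTX v < n ∧ s3.arr aTY v < n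
        rw [hF3.arr aTX, hF3.arr aTY, hF2.arr aTX, hF2.arr aTY]
        exact ht
      · change ∀ r, Separated n I.matrix r (InM I.matrix (s3.arr aTX) (s3.arr aTY) r)
        rw [hF3.arr aTX, hF3.arr aTY, hF2.arr aTX, hF2.arr aTY]
        exact fun r => (hsc r).1
      · change ∀ r, 0 ≤ r → ∀ v < n, ∃ m < n, InM I.matrix (s3.arr aTX) (s3.arr aTY) r m ∧ _
        rw [hF3.arr aTX, hF3.arr aTY, hF2.arr aTX, hF2.arr aTY]
        intro r hr v hv
        obtain ⟨m, hm, h1, h2⟩ := (hsc r).2 v hv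
        exact ⟨m, hm, h1, h2 hr⟩
      · change ∀ v < n, OtherLabel n I.matrix (s3.arr aLab) (s3.arr aWl) (s3.arr aHw) v n
        rw [hF3.arr aLab]
        exact hoth
    have hfound : s3.var rFound = 0 := by
      rw [hF3.var rFound, hF2.var rFound, hF1.var rFound]
      simp [Instance.input]
    refine ((searchCmd_ok hD s3 n3 k3 rfl hfound).seq
      (B' := n * (n * 40 + 138) + 68) fun s4 hF4 ⟨hbest, hcov⟩ => ?_).mono (by ring_nf; omega)
      fun _ _ h => h
    have n4 : s4.var rN = n := (hF4.var rN).trans n3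
    have a4 : s4.arrays = s3.arrays := by
      simp only [Store.arrays, hF4.arr aLab, hF4.arr aOrd, hF4.arr aPar, hF4.arr aTX, hF4.arr aTY,
        hF4.arr aWl, hF4.arr aHw]
    have hlower : ∀ S σ, I.IsSolution S σ → 1 ≤ s4.var rFound ∧
        I.matrix (s4.var rBX) (s4.var rBY) ≤ I.cost σ := fun S σ hS => by
      have hsol := hS.sol
      rw [← l3] at hsol
      exact found_le hD hcov hsol (by rw [Finset.card_map]; exact hS.card_le)
    refine (Ok.ite (B := n * (n * 40 + 138) + 40) (fun hb => ?_) (fun hb => ?_)).mono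
      (by simp only [Test.time, Exp.time]; omega) fun _ _ h => h
    · obtain ⟨hρ, hG, hsum⟩ := hbest hb
      refine ((ownCmd_ok hd hn s4 n4 ((hG.loc 0 hn).isc_eq (by simp [Sep, InM]))
        (fun v hv => (hG.loc v hv).isc_le)).seq
        (B' := n * 98 + 32) fun s5 hF5 hown => ?_).mono (by ring_nf; omega) fun _ _ h => h
      have n5 : s5.var rN = n := (hF5.var rN).trans n4
      have a5 : s5.arrays = s3.arrays := by
        rw [← a4]
        simp only [Store.arrays, hF5.arr aLab, hF5.arr aOrd, hF5.arr aPar, hF5.arr aTX, hF5.arr aTY,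
          hF5.arr aWl, hF5.arr aHw]
      refine ((assignCmd_ok hD hρ hG hown s5 n5 a5 (hF5.arr aZB) rfl).seq
        (B' := n * 50 + 20) fun s6 hF6 ⟨hsig, hcount⟩ => ?_).mono (by omega) fun _ _ h => h
      have r6 : s6.arr aRepB = s4.arr aRepB := (hF6.arr aRepB).trans (hF5.arr aRepB)
      have i6 : s6.arr aIscB = s4.arr aIscB := (hF6.arr aIscB).trans (hF5.arr aIscB)
      refine (outCmd_ok s6 ((hF6.var rN).trans n5)).mono le_rfl fun s7 _ ⟨hvar, hs7, hl7⟩ => ?_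
      rw [r6] at hs7
      rw [r6, i6] at hl7
      obtain ⟨S, σ, henc, hS, hcost⟩ := Good.exists_solution I hD l3 hρ hG hsum hown hsig hcount
        hs7 hl7
      refine Or.inl ⟨hvar, S, σ, henc, hS, fun S' σ' hS' => ?_⟩
      -- The value is at most 4 times the threshold, and the threshold is nonnegative and at most
      -- the value of any solution.
      have h8 := (hlower S' σ' hS').2
      linarith
    · refine (Ok.of_wp (p := .assign rN (.const 0)) (Q := fun s' => s'.var rN = 0)
        (by simp [Cmd.wp, Exp.eval])).mono (by simp [Cmd.bound, Exp.time]) fun s' _ hs' => ?_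
      refine Or.inr ⟨hs', ?_⟩
      rintro ⟨S, σ, hS⟩
      exact hb (hlower S σ hS).1
  -- Without nodes the empty set is a solution, and all values are the empty supremum 0.
  · have hn : n = 0 := by
      simp only [Test.Holds, Exp.eval, hN] at hn
      omega
    subst hn
    refine (Ok.of_wp (p := .assign rN (.const 1)) (Q := fun s' => s'.var rN = 1)
        (by simp [Cmd.wp, Exp.eval])).mono (by simp [Cmd.bound, Exp.time]) fun s' _ hs' => ?_
    refine Or.inl ⟨hs', ∅, id, fun v => v.elim0, ⟨by simp, fun v => v.elim0, fun u => u.elim0,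
      fun u => u.elim0⟩, fun S' σ' _ => ?_⟩
    simp [Instance.cost]

end ParityKCenter

/-- There is a 6-approximation algorithm for the parity-constrained k-center problem that runs in
time `O(|V|² log |V|)`. -/
theorem theorem3 :
    ∃ (p : ParityKCenter.Cmd) (T : ℕ → ℕ),
      ParityKCenter.IsApproxAlgorithm 6 T p ∧
      Asymptotics.IsBigO Filter.atTop (fun n : ℕ => (T n : ℝ))
        (fun n : ℕ => (n : ℝ) ^ 2 * Real.log (n : ℝ)) := by
  refine ⟨ParityKCenter.mainCmd, _, ParityKCenter.isApproxAlgorithm_mainCmd, ?_⟩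
  -- The constant is 790 + 612 + 120, as all terms are at most multiples of n² and log n ≥ 1 from n
  -- = 3 on.
  refine Asymptotics.IsBigO.of_bound 1522 ?_
  filter_upwards [Filter.eventually_ge_atTop 3] with n hn
  have hn' : (3 : ℝ) ≤ n := by exact_mod_cast hn
  have hlog : 1 ≤ Real.log n := by
    rw [Real.le_log_iff_exp_le (by linarith)]
    linarith [Real.exp_one_lt_d9]
  have h2 : (n : ℝ) ^ 2 ≤ (n : ℝ) ^ 2 * Real.log n := le_mul_of_one_le_right (by positivity) hlog
  rw [Real.norm_of_nonneg (by positivity), Real.norm_of_nonneg (by positivity)]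
  push_cast
  nlinarith
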